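/- **Theorem (Mayer–Vietoris for Picard groups).** Let $\mathcal K$ be an idempotent complete tensor triangulated category: a triangulated category with suspension $T$ and a symmetric monoidal structure $(\otimes,\mathbb 1)$ such that $a\otimes-$ and $-\otimes b$ are exact for all $a,b$ and the two isomorphisms $Ta\otimes Tb\cong T^2(a\otimes b)$ (through $T(Ta\otimes b)$ and through $T(a\otimes Tb)$) differ by the sign $-1$. Assume that $\mathcal K$ is strongly closed: there is an internal hom $\underline{\hom}$ right adjoint to $\otimes$, exact in both variables, and with $D(a)=\underline{\hom}(a,\mathbb 1)$ the natural map $D(a)\otimes b\to\underline{\hom}(a,b)$ is an isomorphism for all $a,b$. Let $\mathrm{Spc}(\mathcal K)$ be the set of prime ideals (proper thick triangulated $\otimes$-ideals $\mathcal P$ such that $a\otimes b\in\mathcal P$ implies $a\in\mathcal P$ or $b\in\mathcal P$), let $\mathrm{supp}(a)=\{\mathcal P: a\notin\mathcal P\}$, and give $\mathrm{Spc}(\mathcal K)$ the topology with basis the complements of the sets $\mathrm{supp}(a)$. For $Y\subseteq\mathrm{Spc}(\mathcal K)$ let $\mathcal K_Y=\{a:\mathrm{supp}(a)\subseteq Y\}$.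 For $U$ open with complement $Z$ let $\mathcal K(U)$ be the idempotent completion of the Verdier quotient $\mathcal K/\mathcal K_Z$, with its induced tensor product, $\rho_U:\mathcal K\to\mathcal K(U)$ the restriction functor, and $\mathrm{Mor}_U(a,b)=\mathrm{Mor}_{\mathcal K(U)}(\rho_Ua,\rho_Ub)$; a morphism $s$ of $\mathcal K$ is a $U$-isomorphism if $\rho_U(s)$ is invertible. For a tensor category $\mathcal L$ let $\mathbb G_m(\mathcal L)=\mathrm{Mor}_{\mathcal L}(\mathbb 1,\mathbb 1)^\times$, and let $\mathrm{Pic}(\mathcal L)$ be the group of isomorphism classes of $\otimes$-invertible objects. Suppose $\mathrm{Spc}(\mathcal K)=U_1\cup U_2$ with $U_1,U_2$ open and quasi-compact. Put $U_{12}=U_1\cap U_2$ and $Z_i=\mathrm{Spc}(\mathcal K)\smallsetminus U_i$. Then: (a) For all $a,b\in\mathcal K$ there is a well-defined homomorphism $\partial:\mathrm{Mor}_{U_{12}}(Ta,b)\to\mathrm{Mor}_{\mathcal K}(a,b)$ given as follows. Write $g=fs^{-1}$ with $Ta\xleftarrow{s}x\xrightarrow{f}b$, $s$ a $U_{12}$-isomorphism,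 and choose a distinguished triangle $x\xrightarrow{s}Ta\xrightarrow{\binom{\alpha}{\beta}}c_1\oplus c_2\xrightarrow{(\gamma\ \delta)}Tx$ with $c_i\in\mathcal K_{Z_i}$ (this is always possible). Then $T(\partial g)=T(f)\circ\gamma\circ\alpha$. (b) There is a well-defined homomorphism $\delta:\mathbb G_m(\mathcal K(U_{12}))\to\mathrm{Pic}(\mathcal K)$ sending $\sigma$ to the class of the gluing of two copies of $\mathbb 1$ along $\sigma$, i.e. of any object $p$ admitting isomorphisms $f_i:\rho_{U_i}(p)\to\mathbb 1$ in $\mathcal K(U_i)$ with $\sigma f_1=f_2$ on $U_{12}$. Explicitly, write $\sigma=ts^{-1}$ with $U_{12}$-isomorphisms $\mathbb 1\xleftarrow{s}x\xrightarrow{t}\mathbb 1$, and factor $s=s_1s_2$, $t=t_2t_1$ with $U_i$-isomorphisms $s_i,t_i$, where $s_2:x\to x_1$ and $t_1:x\to x_2$ (this is always possible); then $\delta(\sigma)$ is the class of a weak push-out $p$ of $s_2$ and $t_1$, i.e. there are $u_1:x_1\to p$, $u_2:x_2\to p$ with $u_1s_2=u_2t_1$ and a distinguished triangle $x\xrightarrow{\binom{s_2}{t_1}}x_1\oplus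 x_2\xrightarrow{(-u_1\ u_2)}p\to Tx$. (c) The map $1+\partial$ is a homomorphism from the additive group $\mathrm{Mor}_{U_{12}}(T\mathbb 1,\mathbb 1)$ to the multiplicative group $\mathbb G_m(\mathcal K)$, and there is an exact sequence of abelian groups, infinite to the left, $$\begin{aligned}\cdots&\to\mathrm{Mor}_{U_{12}}(T^{n+1}\mathbb 1,\mathbb 1)\xrightarrow{\partial}\mathrm{Mor}_{\mathcal K}(T^{n}\mathbb 1,\mathbb 1)\to\mathrm{Mor}_{U_1}(T^n\mathbb 1,\mathbb 1)\oplus\mathrm{Mor}_{U_2}(T^n\mathbb 1,\mathbb 1)\to\mathrm{Mor}_{U_{12}}(T^n\mathbb 1,\mathbb 1)\xrightarrow{\partial}\cdots\\ &\to\mathrm{Mor}_{U_1}(T\mathbb 1,\mathbb 1)\oplus\mathrm{Mor}_{U_2}(T\mathbb 1,\mathbb 1)\to\mathrm{Mor}_{U_{12}}(T\mathbb 1,\mathbb 1)\xrightarrow{1+\partial}\mathbb G_m(\mathcal K)\to\mathbb G_m(\mathcal K(U_1))\oplus\mathbb G_m(\mathcal K(U_2))\to\mathbb G_m(\mathcal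 K(U_{12}))\\ &\xrightarrow{\delta}\mathrm{Pic}(\mathcal K)\to\mathrm{Pic}(\mathcal K(U_1))\oplus\mathrm{Pic}(\mathcal K(U_2))\to\mathrm{Pic}(\mathcal K(U_{12})),\end{aligned}$$ with the terms $\mathrm{Mor}(T^n\mathbb 1,\mathbb 1)$ for all $n\ge1$; the unlabelled maps are restrictions and (multiplicative) differences of restrictions. -/

import Mathlib

open CategoryTheory Category Limits MonoidalCategory Pretriangulated Idempotents

universe v u v' u'

namespace TTGlue

section Karoubi

variable {D : Type u} [Category.{v} D]

/-- A morphism `f : P ⟶ Q` of the Karoubi envelope is represented by `g : P.X ⟶ Q.X` if `g` commutes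
with the idempotents and cuts down to `f`. -/
def Rep {P Q : Karoubi D} (f : P ⟶ Q) (g : P.X ⟶ Q.X) : Prop :=
  P.p ≫ g = f.f ∧ g ≫ Q.p = f.f

theorem Rep.ext {P Q : Karoubi D} {f f' : P ⟶ Q} {g g' : P.X ⟶ Q.X} (h : Rep f g) (h' : Rep f' g')
    (e : g = g') : f = f' := by
  ext; rw [← h.1, ← h'.1, e]

theorem Rep.self {P Q : Karoubi D} (f : P ⟶ Q) : Rep f f.f := ⟨by simp, by simp⟩

theorem Rep.id (P : Karoubi D) : Rep (𝟙 P) (𝟙 P.X) := ⟨by simp, by simp⟩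

theorem Rep.comp {P Q R : Karoubi D} {f : P ⟶ Q} {f' : Q ⟶ R} {g : P.X ⟶ Q.X} {g' : Q.X ⟶ R.X}
    (h : Rep f g) (h' : Rep f' g') : Rep (f ≫ f') (g ≫ g') := by
  constructor
  · rw [← assoc, h.1, Karoubi.comp_f, ← h'.1, ← assoc, Karoubi.comp_p]
  · rw [assoc, h'.2, Karoubi.comp_f, ← h.2, assoc, Karoubi.p_comp]

/-- An isomorphism of `D` which commutes with the idempotents `P.p` and `Q.p` induces an isomorphism
of the corresponding formal direct summands. -/
def karoubiIso (P Q : Karoubi D) (e : P.X ≅ Q.X) (h : P.p ≫ e.hom = e.hom ≫ Q.p) : P ≅ Q where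
  hom := ⟨P.p ≫ e.hom, by rw [assoc, ← h]; simp⟩
  inv := ⟨e.inv ≫ P.p, by
    have h' : Q.p ≫ e.inv = e.inv ≫ P.p := by rw [Iso.comp_inv_eq, assoc, h]; simp
    rw [← assoc, ← assoc, h']; simp⟩
  hom_inv_id := by ext; simp
  inv_hom_id := by
    ext
    simp only [Karoubi.comp_f, Karoubi.id_f, assoc]
    rw [P.idem_assoc, h, Iso.inv_hom_id_assoc]

theorem rep_karoubiIso_hom {P Q : Karoubi D} (e : P.X ≅ Q.X) (h : P.p ≫ e.hom = e.hom ≫ Q.p) :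
    Rep (karoubiIso P Q e h).hom e.hom := ⟨rfl, h.symm⟩

theorem rep_karoubiIso_inv {P Q : Karoubi D} (e : P.X ≅ Q.X) (h : P.p ≫ e.hom = e.hom ≫ Q.p) :
    Rep (karoubiIso P Q e h).inv e.inv :=
  ⟨by
    have h' : Q.p ≫ e.inv = e.inv ≫ P.p := by rw [Iso.comp_inv_eq, assoc, h]; simp
    exact h', rfl⟩

variable [MonoidalCategory D]

/-- The tensor product on the Karoubi envelope: `(X, p) ⊗ (Y, q) = (X ⊗ Y, p ⊗ q)`. -/
instance karoubiMonoidalStruct : MonoidalCategoryStruct (Karoubi D) where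
  tensorObj P Q := ⟨P.X ⊗ Q.X, P.p ⊗ₘ Q.p, by simp⟩
  whiskerLeft P _ _ f := ⟨P.p ⊗ₘ f.f, by simp⟩
  whiskerRight f Q := ⟨f.f ⊗ₘ Q.p, by simp⟩
  tensorHom f g := ⟨f.f ⊗ₘ g.f, by simp⟩
  tensorUnit := ⟨𝟙_ D, 𝟙 _, by simp⟩
  associator P Q R := karoubiIso _ _ (α_ P.X Q.X R.X) (associator_naturality _ _ _)
  leftUnitor P := karoubiIso _ _ (λ_ P.X) (by simp)
  rightUnitor P := karoubiIso _ _ (ρ_ P.X) (by simp)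

theorem Rep.tensor {P Q P' Q' : Karoubi D} {f : P ⟶ Q} {f' : P' ⟶ Q'} {g : P.X ⟶ Q.X}
    {g' : P'.X ⟶ Q'.X} (h : Rep f g) (h' : Rep f' g') : Rep (f ⊗ₘ f') (g ⊗ₘ g') := by
  constructor
  · change (P.p ⊗ₘ P'.p) ≫ (g ⊗ₘ g') = f.f ⊗ₘ f'.f
    rw [tensorHom_comp_tensorHom, h.1, h'.1]
  · change (g ⊗ₘ g') ≫ (Q.p ⊗ₘ Q'.p) = f.f ⊗ₘ f'.f
    rw [tensorHom_comp_tensorHom, h.2, h'.2]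

theorem rep_associator (P Q R : Karoubi D) : Rep (α_ P Q R).hom (α_ P.X Q.X R.X).hom :=
  rep_karoubiIso_hom _ _

theorem rep_associator_inv (P Q R : Karoubi D) : Rep (α_ P Q R).inv (α_ P.X Q.X R.X).inv :=
  rep_karoubiIso_inv _ _

theorem rep_leftUnitor (P : Karoubi D) : Rep (λ_ P).hom (λ_ P.X).hom := rep_karoubiIso_hom _ _

theorem rep_rightUnitor (P : Karoubi D) : Rep (ρ_ P).hom (ρ_ P.X).hom := rep_karoubiIso_hom _ _

instance karoubiMonoidal : MonoidalCategory (Karoubi D) :=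
  MonoidalCategory.ofTensorHom
    (id_tensorHom_id := fun _ _ => rfl)
    (id_tensorHom := fun _ _ _ _ => rfl)
    (tensorHom_id := fun _ _ => rfl)
    (tensorHom_comp_tensorHom := fun _ _ _ _ => by
      ext; exact tensorHom_comp_tensorHom _ _ _ _)
    (associator_naturality := fun f₁ f₂ f₃ =>
      Rep.ext ((((Rep.self f₁).tensor (.self f₂)).tensor (.self f₃)).comp (rep_associator _ _ _))
        ((rep_associator _ _ _).comp ((Rep.self f₁).tensor ((Rep.self f₂).tensor (.self f₃))))
        (associator_naturality _ _ _))
    (leftUnitor_naturality := fun f =>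
      Rep.ext (((Rep.id _).tensor (.self f)).comp (rep_leftUnitor _))
        ((rep_leftUnitor _).comp (.self f)) (by
          rw [id_tensorHom]; exact leftUnitor_naturality f.f))
    (rightUnitor_naturality := fun f =>
      Rep.ext (((Rep.self f).tensor (.id _)).comp (rep_rightUnitor _))
        ((rep_rightUnitor _).comp (.self f)) (by
          rw [tensorHom_id]; exact rightUnitor_naturality f.f))
    (pentagon := fun W X Y Z =>
      Rep.ext (((rep_associator W X Y).tensor (.id Z)).comp ((rep_associator _ _ _).comp
        ((Rep.id _).tensor (rep_associator _ _ _))))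
        ((rep_associator _ _ _).comp (rep_associator _ _ _)) (by
          rw [tensorHom_id, id_tensorHom]; exact pentagon W.X X.X Y.X Z.X))
    (triangle := fun X Y =>
      Rep.ext ((rep_associator _ _ _).comp ((Rep.id _).tensor (rep_leftUnitor _)))
        ((rep_rightUnitor _).tensor (.id _)) (by
          rw [tensorHom_id, id_tensorHom]; exact triangle X.X Y.X))


theorem Rep.whiskerLeft (R : Karoubi D) {P Q : Karoubi D} {f : P ⟶ Q} {g : P.X ⟶ Q.X}
    (h : Rep f g) : Rep (R ◁ f) (R.X ◁ g) := by
  rw [← id_tensorHom, ← id_tensorHom]; exact (Rep.id R).tensor h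

theorem Rep.whiskerRight (R : Karoubi D) {P Q : Karoubi D} {f : P ⟶ Q} {g : P.X ⟶ Q.X}
    (h : Rep f g) : Rep (f ▷ R) (g ▷ R.X) := by
  rw [← tensorHom_id, ← tensorHom_id]; exact h.tensor (.id R)

/-- The symmetry of the Karoubi envelope is induced by the one of `D`. -/
instance karoubiSymmetric [SymmetricCategory D] : SymmetricCategory (Karoubi D) where
  braiding P Q := karoubiIso _ _ (β_ P.X Q.X) (BraidedCategory.braiding_naturality _ _)
  braiding_naturality_right X _ _ f :=
    Rep.ext (((Rep.self f).whiskerLeft X).comp (rep_karoubiIso_hom _ _))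
      ((rep_karoubiIso_hom _ _).comp ((Rep.self f).whiskerRight X))
      (BraidedCategory.braiding_naturality_right _ _)
  braiding_naturality_left f Z :=
    Rep.ext (((Rep.self f).whiskerRight Z).comp (rep_karoubiIso_hom _ _))
      ((rep_karoubiIso_hom _ _).comp ((Rep.self f).whiskerLeft Z))
      (BraidedCategory.braiding_naturality_left _ _)
  hexagon_forward X Y Z :=
    Rep.ext ((rep_associator _ _ _).comp ((rep_karoubiIso_hom _ _).comp (rep_associator _ _ _)))
      (((rep_karoubiIso_hom _ _).whiskerRight Z).comp ((rep_associator _ _ _).comp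
        ((rep_karoubiIso_hom _ _).whiskerLeft Y)))
      (BraidedCategory.hexagon_forward X.X Y.X Z.X)
  hexagon_reverse X Y Z :=
    Rep.ext ((rep_associator_inv _ _ _).comp
        ((rep_karoubiIso_hom _ _).comp (rep_associator_inv _ _ _)))
      (((rep_karoubiIso_hom _ _).whiskerLeft X).comp ((rep_associator_inv _ _ _).comp
        ((rep_karoubiIso_hom _ _).whiskerRight Y)))
      (BraidedCategory.hexagon_reverse X.X Y.X Z.X)
  symmetry X Y :=
    Rep.ext ((rep_karoubiIso_hom _ _).comp (rep_karoubiIso_hom _ _)) (Rep.id _)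
      (SymmetricCategory.symmetry X.X Y.X)

instance toKaroubiMonoidal : (toKaroubi D).Monoidal :=
  Functor.CoreMonoidal.toMonoidal
    { εIso := Iso.refl _
      μIso := fun X Y => karoubiIso _ _ (Iso.refl (X ⊗ Y)) (by
        change (𝟙 X ⊗ₘ 𝟙 Y) ≫ 𝟙 _ = 𝟙 _ ≫ 𝟙 _; simp)
      μIso_hom_natural_left := fun f Z =>
        Rep.ext (((Rep.self _).whiskerRight _).comp (rep_karoubiIso_hom _ _))
          ((rep_karoubiIso_hom _ _).comp (.self _)) ((comp_id _).trans (id_comp _).symm)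
      μIso_hom_natural_right := fun Z f =>
        Rep.ext (((Rep.self _).whiskerLeft _).comp (rep_karoubiIso_hom _ _))
          ((rep_karoubiIso_hom _ _).comp (.self _)) ((comp_id _).trans (id_comp _).symm)
      associativity := fun X Y Z =>
        Rep.ext (((rep_karoubiIso_hom _ _).whiskerRight _).comp
            ((rep_karoubiIso_hom _ _).comp (.self _)))
          ((rep_associator _ _ _).comp (((rep_karoubiIso_hom _ _).whiskerLeft _).comp
            (rep_karoubiIso_hom _ _))) (by
          change (𝟙 _ ▷ _) ≫ 𝟙 _ ≫ (α_ X Y Z).hom = (α_ X Y Z).hom ≫ (_ ◁ 𝟙 _) ≫ 𝟙 _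
          simp)
      left_unitality := fun X =>
        Rep.ext (rep_leftUnitor _) (((Rep.id _).whiskerRight _).comp
            ((rep_karoubiIso_hom _ _).comp (.self _))) (by
          change (λ_ X).hom = (𝟙 _ ▷ X) ≫ 𝟙 _ ≫ (λ_ X).hom
          simp)
      right_unitality := fun X =>
        Rep.ext (rep_rightUnitor _) (((Rep.id _).whiskerLeft _).comp
            ((rep_karoubiIso_hom _ _).comp (.self _))) (by
          change (ρ_ X).hom = (X ◁ 𝟙 _) ≫ 𝟙 _ ≫ (ρ_ X).hom
          simp) }

end Karoubi

section KaroubiMap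

variable {D : Type u} [Category.{v} D] {E : Type u'} [Category.{v'} E] (F : D ⥤ E)

/-- The functor induced on Karoubi envelopes. -/
def karoubiMap : Karoubi D ⥤ Karoubi E where
  obj P := ⟨F.obj P.X, F.map P.p, by rw [← F.map_comp, P.idem]⟩
  map f := ⟨F.map f.f, by
    change F.map _ ≫ F.map _ ≫ F.map _ = F.map _
    rw [← F.map_comp, ← F.map_comp, f.comm]⟩
  map_id _ := rfl
  map_comp f g := by ext; exact F.map_comp f.f g.f

theorem Rep.map {P Q : Karoubi D} {f : P ⟶ Q} {g : P.X ⟶ Q.X} (h : Rep f g) :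
    Rep ((karoubiMap F).map f) (F.map g) :=
  ⟨by change F.map _ ≫ F.map _ = F.map _; rw [← F.map_comp, h.1],
   by change F.map _ ≫ F.map _ = F.map _; rw [← F.map_comp, h.2]⟩

instance karoubiMap_additive [Preadditive D] [Preadditive E] [F.Additive] :
    (karoubiMap F).Additive where
  map_add {_ _ f g} := by ext; exact F.map_add (f := f.f) (g := g.f)

/-- The induced functor extends the original one. -/
def toKaroubiCompMap : toKaroubi D ⋙ karoubiMap F ≅ F ⋙ toKaroubi E :=
  NatIso.ofComponents
    (fun X => karoubiIso _ _ (Iso.refl (F.obj X)) (by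
      change F.map (𝟙 X) ≫ 𝟙 _ = 𝟙 _ ≫ 𝟙 _; simp))
    (fun f => Rep.ext ((Rep.self _).comp (rep_karoubiIso_hom _ _))
      ((rep_karoubiIso_hom _ _).comp (.self _)) ((comp_id _).trans (id_comp _).symm))

open Functor.LaxMonoidal Functor.Monoidal in
instance karoubiMap_monoidal [MonoidalCategory D] [MonoidalCategory E] [F.Monoidal] :
    (karoubiMap F).Monoidal :=
  Functor.CoreMonoidal.toMonoidal
    { εIso := karoubiIso _ _ (εIso F) (by
        change 𝟙 _ ≫ _ = _ ≫ F.map (𝟙 _); simp)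
      μIso := fun P Q => karoubiIso _ _ (μIso F P.X Q.X) (μ_natural F P.p Q.p)
      μIso_hom_natural_left := fun f Z =>
        Rep.ext (((Rep.self _).whiskerRight _).comp (rep_karoubiIso_hom _ _))
          ((rep_karoubiIso_hom _ _).comp (((Rep.self f).whiskerRight Z).map F))
          (μ_natural_left F f.f Z.X)
      μIso_hom_natural_right := fun Z f =>
        Rep.ext (((Rep.self _).whiskerLeft _).comp (rep_karoubiIso_hom _ _))
          ((rep_karoubiIso_hom _ _).comp (((Rep.self f).whiskerLeft Z).map F))
          (μ_natural_right F Z.X f.f)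
      associativity := fun X Y Z =>
        Rep.ext (((rep_karoubiIso_hom _ _).whiskerRight _).comp
            ((rep_karoubiIso_hom _ _).comp ((rep_associator X Y Z).map F)))
          ((rep_associator _ _ _).comp (((rep_karoubiIso_hom _ _).whiskerLeft _).comp
            (rep_karoubiIso_hom _ _))) (associativity F X.X Y.X Z.X)
      left_unitality := fun X =>
        Rep.ext (rep_leftUnitor _) (((rep_karoubiIso_hom _ _).whiskerRight _).comp
            ((rep_karoubiIso_hom _ _).comp ((rep_leftUnitor X).map F))) (left_unitality F X.X)
      right_unitality := fun X =>
        Rep.ext (rep_rightUnitor _) (((rep_karoubiIso_hom _ _).whiskerLeft _).comp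
            ((rep_karoubiIso_hom _ _).comp ((rep_rightUnitor X).map F))) (right_unitality F X.X) }

end KaroubiMap

section Units

variable (D : Type u) [Category.{v} D] [MonoidalCategory D]

theorem end_unit_comm (f g : 𝟙_ D ⟶ 𝟙_ D) : f ≫ g = g ≫ f := by
  have h₁ : (λ_ (𝟙_ D)).inv ≫ (f ⊗ₘ g) ≫ (λ_ (𝟙_ D)).hom = f ≫ g := by
    rw [MonoidalCategory.tensorHom_def, assoc, leftUnitor_naturality, unitors_equal,
      rightUnitor_naturality_assoc, ← unitors_equal, Iso.inv_hom_id_assoc]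
  have h₂ : (λ_ (𝟙_ D)).inv ≫ (f ⊗ₘ g) ≫ (λ_ (𝟙_ D)).hom = g ≫ f := by
    rw [MonoidalCategory.tensorHom_def', assoc, unitors_equal, rightUnitor_naturality,
      ← unitors_equal, leftUnitor_naturality_assoc, Iso.inv_hom_id_assoc]
  rw [← h₁, h₂]

/-- The endomorphism monoid of the unit object is commutative. -/
instance endUnitCommMonoid : CommMonoid (End (𝟙_ D)) :=
  { (inferInstance : Monoid (End (𝟙_ D))) with
    mul_comm := fun f g => end_unit_comm D g f }

/-- `𝔾ₘ(D) = Mor(𝟙, 𝟙)ˣ`. -/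
abbrev Gm : Type v := (End (𝟙_ D))ˣ

/-- The Picard group: isomorphism classes of invertible objects, with multiplication `⊗`. -/
abbrev Pic [SymmetricCategory D] : Type u := (Skeleton D)ˣ

variable {D} {E : Type u'} [Category.{v'} E] [MonoidalCategory E] (F : D ⥤ E) [F.Monoidal]

open Functor.Monoidal in
/-- The homomorphism `Mor(𝟙, 𝟙) → Mor(F 𝟙, F 𝟙) ≅ Mor(𝟙, 𝟙)` induced by a monoidal functor. -/
def endUnitMap : End (𝟙_ D) →* End (𝟙_ E) where
  toFun f := (εIso F).hom ≫ F.map f ≫ (εIso F).inv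
  map_one' := by
    change (εIso F).hom ≫ F.map (𝟙 _) ≫ (εIso F).inv = 𝟙 _
    simp
  map_mul' f g := by
    change (εIso F).hom ≫ F.map (g ≫ f) ≫ (εIso F).inv =
      ((εIso F).hom ≫ F.map g ≫ (εIso F).inv) ≫ (εIso F).hom ≫ F.map f ≫ (εIso F).inv
    simp

/-- The homomorphism on units of `Mor(𝟙, 𝟙)` induced by a monoidal functor. -/
def gmMap : Gm D →* Gm E := Units.map (endUnitMap F)

/-- The homomorphism on Picard groups induced by a monoidal functor. -/
noncomputable def picMap [SymmetricCategory D] [SymmetricCategory E] : Pic D →* Pic E :=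
  Units.map (Skeleton.monoidHom F)

end Units

section TT

variable (C : Type u) [Category.{v} C] [HasZeroObject C] [HasShift C ℤ] [Preadditive C]
  [∀ n : ℤ, (shiftFunctor C n).Additive] [Pretriangulated C]

variable {C} in
/-- The commutative square with sides `f : a ⟶ b`, `g : a ⟶ c`, `h : b ⟶ d`, `k : c ⟶ d` is a weak
push-out: there is a distinguished triangle `a --(f, g)--> b ⊕ c --(-h, k)--> d ⟶ T a`. -/
def IsWeakPushout {a b c d : C} (f : a ⟶ b) (g : a ⟶ c) (h : b ⟶ d) (k : c ⟶ d) : Prop :=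
  f ≫ h = g ≫ k ∧ ∃ l : d ⟶ a⟦(1 : ℤ)⟧,
    Triangle.mk (biprod.lift f g) (biprod.desc (-h) k) l ∈ distTriang C

/-- The compatibility of a symmetric monoidal structure with a triangulation: the functors `a ⊗ -` and
`- ⊗ b` are exact, and the square
`T a ⊗ T b ≅ T (T a ⊗ b) ≅ T² (a ⊗ b)`, `T a ⊗ T b ≅ T (a ⊗ T b) ≅ T² (a ⊗ b)` anticommutes. -/
class TensorTriangulated [MonoidalCategory C] [SymmetricCategory C] where
  commShiftLeft (a : C) : (tensorLeft a).CommShift ℤ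
  commShiftRight (b : C) : (tensorRight b).CommShift ℤ
  exact_left (a : C) : (tensorLeft a).IsTriangulated
  exact_right (b : C) : (tensorRight b).IsTriangulated
  anticommutes (a b : C) :
    ((tensorLeft (a⟦(1 : ℤ)⟧)).commShiftIso (1 : ℤ)).hom.app b ≫
        (((tensorRight b).commShiftIso (1 : ℤ)).hom.app a)⟦(1 : ℤ)⟧' =
      -(((tensorRight (b⟦(1 : ℤ)⟧)).commShiftIso (1 : ℤ)).hom.app a ≫
        (((tensorLeft a).commShiftIso (1 : ℤ)).hom.app b)⟦(1 : ℤ)⟧')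

attribute [reducible, instance] TensorTriangulated.commShiftLeft TensorTriangulated.commShiftRight
attribute [instance] TensorTriangulated.exact_left TensorTriangulated.exact_right

section
open scoped Pretriangulated.Opposite

/-- The internal hom functor is exact in both variables, and every object is strongly dualizable:
the natural morphism `D(a) ⊗ b ⟶ hom(a, b)`, with `D(a) = hom(a, 𝟙)`, is an isomorphism. -/
class StronglyClosed [MonoidalCategory C] [MonoidalClosed C] : Prop where
  exact_right (a : C) : ∃ _ : (ihom a).CommShift ℤ, (ihom a).IsTriangulated
  exact_left (c : C) : ∃ _ : (MonoidalClosed.internalHom.flip.obj c).CommShift ℤ,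
    (MonoidalClosed.internalHom.flip.obj c).IsTriangulated
  dualizable (a b : C) : IsIso (MonoidalClosed.curry
    ((α_ a ((ihom a).obj (𝟙_ C)) b).inv ≫ (ihom.ev a).app (𝟙_ C) ▷ b ≫ (λ_ b).hom))

end

/-- Prime ideals: proper full triangulated subcategories which are thick, tensor ideals, and prime. -/
structure IsPrimeIdeal [MonoidalCategory C] (P : ObjectProperty C) : Prop where
  isTriangulated : P.IsTriangulated
  isClosedUnderIso : P.IsClosedUnderIsomorphisms
  thick (a b : C) : P (a ⊞ b) → P a ∧ P b
  ideal (a b : C) : P a → P (a ⊗ b)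
  prime (a b : C) : P (a ⊗ b) → P a ∨ P b
  proper : ∃ a, ¬ P a

/-- The spectrum: the set of prime ideals. -/
def Spc [MonoidalCategory C] : Type u := {P : ObjectProperty C // IsPrimeIdeal C P}

variable {C} [MonoidalCategory C]

/-- `supp a`: the primes not containing `a`. -/
def supp (a : C) : Set (Spc C) := {P | ¬ P.1 a}

/-- The Zariski topology, with basis the complements `{P | a ∈ P}` of the supports. -/
instance : TopologicalSpace (Spc C) := .generateFrom {U | ∃ a : C, U = (supp a)ᶜ}

/-- `K_Y`: the objects supported on `Y`. -/
def supportedOn (Y : Set (Spc C)) : ObjectProperty C := fun a => supp a ⊆ Y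

instance (Y : Set (Spc C)) : (supportedOn Y).IsClosedUnderIsomorphisms where
  of_iso e h P hP := h fun h' => hP (P.2.isClosedUnderIso.of_iso e h')

instance (Y : Set (Spc C)) : (supportedOn Y).IsTriangulated where
  exists_zero := ⟨_, isZero_zero C, fun P hP => (hP (by
    have := P.2.isTriangulated; have := P.2.isClosedUnderIso
    exact P.1.prop_zero)).elim⟩
  isStableUnderShiftBy n := ⟨fun a ha P hP => ha fun h' => hP (by
    have := P.2.isTriangulated
    exact P.1.le_shift n _ h')⟩
  toIsTriangulatedClosed₂ := .mk' fun T hT h₁ h₃ P hP => by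
    have := P.2.isTriangulated; have := P.2.isClosedUnderIso
    by_contra hn
    exact hP (P.1.ext_of_isTriangulatedClosed₂ T hT (by_contra fun h => hn (h₁ h))
      (by_contra fun h => hn (h₃ h)))

theorem supportedOn_mono {Y Y' : Set (Spc C)} (h : Y ⊆ Y') :
    supportedOn Y ≤ supportedOn Y' := fun _ ha => ha.trans h

theorem supportedOn_tensorRight (Y : Set (Spc C)) (b : C) :
    supportedOn Y ≤ (supportedOn Y).inverseImage (tensorRight b) :=
  fun a ha P hP => ha fun h => hP (P.2.ideal a b h)

theorem supportedOn_tensorLeft [SymmetricCategory C] (Y : Set (Spc C)) (a : C) :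
    supportedOn Y ≤ (supportedOn Y).inverseImage (tensorLeft a) :=
  fun b hb P hP => hb fun h => hP (by
    have := P.2.isClosedUnderIso
    exact P.1.prop_of_iso (β_ b a) (P.2.ideal b a h))

variable [IsTriangulated C] [SymmetricCategory C] [TensorTriangulated C]

/-- The morphisms whose cone is supported on `Z = Spc ∖ U`. -/
abbrev uW (U : TopologicalSpace.Opens (Spc C)) : MorphismProperty C :=
  (supportedOn (U : Set (Spc C))ᶜ).trW

instance (U : TopologicalSpace.Opens (Spc C)) : (uW U).IsMonoidal where
  whiskerLeft X _ _ g hg := ((supportedOn (U : Set (Spc C))ᶜ).inverseImage_trW_iff (tensorLeft X) g).1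
    (ObjectProperty.trW_monotone (supportedOn_tensorLeft _ X) g hg)
  whiskerRight f hf Y := ((supportedOn (U : Set (Spc C))ᶜ).inverseImage_trW_iff (tensorRight Y) f).1
    (ObjectProperty.trW_monotone (supportedOn_tensorRight _ Y) f hf)

/-- The Verdier localization `L(U) = K / K_Z`, where `Z = Spc ∖ U`, with its induced tensor product. -/
abbrev LU (U : TopologicalSpace.Opens (Spc C)) : Type u :=
  LocalizedMonoidal (uW U).Q (uW U) (Iso.refl ((uW U).Q.obj (𝟙_ C)))

/-- The localization functor `K ⥤ L(U)`. -/
noncomputable abbrev toLU (U : TopologicalSpace.Opens (Spc C)) : C ⥤ LU U :=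
  Localization.Monoidal.toMonoidalCategory (uW U).Q (uW U) (Iso.refl ((uW U).Q.obj (𝟙_ C)))

noncomputable instance (U : TopologicalSpace.Opens (Spc C)) : Preadditive (LU U) :=
  Localization.preadditive (toLU U) (uW U)

instance (U : TopologicalSpace.Opens (Spc C)) : (toLU U).Additive :=
  Localization.functor_additive (toLU U) (uW U)

variable {U V : TopologicalSpace.Opens (Spc C)}

theorem uW_inverted (h : U ≤ V) : (uW V).IsInvertedBy (toLU U) := fun _ _ f hf =>
  Localization.inverts (toLU U) (uW U) f
    (ObjectProperty.trW_monotone (supportedOn_mono (Set.compl_subset_compl.2 h)) f hf)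

/-- The localization functor `L(V) ⥤ L(U)` for `U ≤ V`. -/
noncomputable def resL (h : U ≤ V) : LU V ⥤ LU U :=
  Localization.lift (toLU U) (uW_inverted h) (toLU V)

noncomputable instance resLLifting (h : U ≤ V) :
    Localization.Lifting (toLU V) (uW V) (toLU U) (resL h) :=
  inferInstanceAs (Localization.Lifting (toLU V) (uW V) (toLU U) (Localization.lift _ _ _))

noncomputable instance (h : U ≤ V) : (resL h).Monoidal :=
  Localization.Monoidal.functorMonoidalOfComp (toLU V) (uW V) (resL h) (toLU U)

instance (h : U ≤ V) : (resL h).Additive :=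
  (Localization.functor_additive_iff (toLU V) (uW V) _).2
    (Functor.additive_of_iso (Localization.Lifting.iso (toLU V) (uW V) (toLU U) (resL h)).symm)

/-- The tensor category `K(U)`: the idempotent completion of `L(U)`. -/
abbrev KU (U : TopologicalSpace.Opens (Spc C)) : Type (max u v) := Karoubi (LU U)

/-- The restriction functor `ρ_U : K ⥤ K(U)`. -/
noncomputable abbrev rho (U : TopologicalSpace.Opens (Spc C)) : C ⥤ KU U :=
  toLU U ⋙ toKaroubi (LU U)

/-- The restriction functor `ρ_{V,U} : K(V) ⥤ K(U)` for `U ≤ V`. -/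
noncomputable abbrev res (h : U ≤ V) : KU V ⥤ KU U := karoubiMap (resL h)

/-- Transitivity of restriction: `ρ_{V,U} ∘ ρ_V ≅ ρ_U`. -/
noncomputable def resComp (h : U ≤ V) : rho V ⋙ res h ≅ rho U :=
  Functor.associator _ _ _ ≪≫ Functor.isoWhiskerLeft (toLU V) (toKaroubiCompMap (resL h)) ≪≫
    (Functor.associator _ _ _).symm ≪≫
    Functor.isoWhiskerRight (Localization.Lifting.iso (toLU V) (uW V) (toLU U) (resL h)) _

/-- `Mor_U(a, b)`: the group of morphisms `ρ_U(a) ⟶ ρ_U(b)` in `K(U)`. -/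
abbrev Mor (U : TopologicalSpace.Opens (Spc C)) (a b : C) : Type (max u v) :=
  (rho U).obj a ⟶ (rho U).obj b

/-- Restriction `Mor_V(a, b) → Mor_U(a, b)`. -/
noncomputable def resMor (h : U ≤ V) (a b : C) : Mor V a b →+ Mor U a b :=
  AddMonoidHom.mk' (fun g => (resComp h).inv.app a ≫ (res h).map g ≫ (resComp h).hom.app b)
    (fun g g' => by
      rw [Functor.map_add, Preadditive.add_comp, Preadditive.comp_add])

variable (C) in
/-- The iterated suspensions `Tⁿ 𝟙` of the unit object. -/
def iterT : ℕ → C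
  | 0 => 𝟙_ C
  | n + 1 => (iterT n)⟦(1 : ℤ)⟧

variable (U₁ U₂ : TopologicalSpace.Opens (Spc C))

/-- `Hom_K(a, b) → Mor_{U₁}(a, b) ⊕ Mor_{U₂}(a, b)`: the two restrictions. -/
noncomputable def pairMor (a b : C) : (a ⟶ b) →+ Mor U₁ a b × Mor U₂ a b :=
  (rho U₁).mapAddHom.prod (rho U₂).mapAddHom

/-- `Mor_{U₁}(a, b) ⊕ Mor_{U₂}(a, b) → Mor_{U₁ ∩ U₂}(a, b)`: the difference of the restrictions. -/
noncomputable def diffMor (a b : C) : Mor U₁ a b × Mor U₂ a b →+ Mor (U₁ ⊓ U₂) a b :=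
  (resMor inf_le_left a b).comp (AddMonoidHom.fst _ _) -
    (resMor inf_le_right a b).comp (AddMonoidHom.snd _ _)

/-- The two restrictions of units. -/
noncomputable def pairGm : Gm C →* Gm (KU U₁) × Gm (KU U₂) :=
  (gmMap (rho U₁)).prod (gmMap (rho U₂))

/-- The (multiplicative) difference of the restrictions of units. -/
noncomputable def diffGm : Gm (KU U₁) × Gm (KU U₂) →* Gm (KU (U₁ ⊓ U₂)) :=
  (gmMap (res inf_le_left)).comp (MonoidHom.fst _ _) /
    (gmMap (res inf_le_right)).comp (MonoidHom.snd _ _)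

/-- The two restrictions of invertible objects. -/
noncomputable def pairPic : Pic C →* Pic (KU U₁) × Pic (KU U₂) :=
  (picMap (rho U₁)).prod (picMap (rho U₂))

/-- The (multiplicative) difference of the restrictions of invertible objects. -/
noncomputable def diffPic : Pic (KU U₁) × Pic (KU U₂) →* Pic (KU (U₁ ⊓ U₂)) :=
  (picMap (res inf_le_left)).comp (MonoidHom.fst _ _) /
    (picMap (res inf_le_right)).comp (MonoidHom.snd _ _)

/-- `s` is a `U`-isomorphism: it becomes an isomorphism in `K(U)`. -/
def IsUIso (U : TopologicalSpace.Opens (Spc C)) {a b : C} (s : a ⟶ b) : Prop :=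
  IsIso ((rho U).map s)

/-- `d : a ⟶ T b` arises from `g ∈ Mor_{U₁ ∩ U₂}(a, b)` by the construction of the connecting
homomorphism: `g = f s⁻¹`, there is a distinguished triangle `x --s--> a --(α, β)--> c₁ ⊕ c₂
--(γ, δ)--> T x` with `c_i` supported on the complement of `U_i`, and `d = T(f) γ α`. -/
def IsConnecting {a b : C} (g : Mor (U₁ ⊓ U₂) a b) (d : a ⟶ b⟦(1 : ℤ)⟧) : Prop :=
  ∃ (x c₁ c₂ : C) (s : x ⟶ a) (f : x ⟶ b) (α : a ⟶ c₁) (β : a ⟶ c₂)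
    (γ : c₁ ⟶ x⟦(1 : ℤ)⟧) (δ : c₂ ⟶ x⟦(1 : ℤ)⟧),
    IsUIso (U₁ ⊓ U₂) s ∧ (rho (U₁ ⊓ U₂)).map s ≫ g = (rho (U₁ ⊓ U₂)).map f ∧
    supportedOn (U₁ : Set (Spc C))ᶜ c₁ ∧ supportedOn (U₂ : Set (Spc C))ᶜ c₂ ∧
    Triangle.mk s (biprod.lift α β) (biprod.desc γ δ) ∈ distTriang C ∧
    d = α ≫ γ ≫ f⟦(1 : ℤ)⟧'

/-- `a`, together with suitable isomorphisms `f_i : a ≅ a_i` over `U_i`, is a gluing of `a₁` and `a₂`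
along the isomorphism `σ` over `U₁ ∩ U₂`. -/
def IsGluing {a₁ : KU U₁} {a₂ : KU U₂}
    (σ : (res (inf_le_left : U₁ ⊓ U₂ ≤ U₁)).obj a₁ ≅ (res (inf_le_right : U₁ ⊓ U₂ ≤ U₂)).obj a₂)
    (a : C) : Prop :=
  ∃ (f₁ : (rho U₁).obj a ≅ a₁) (f₂ : (rho U₂).obj a ≅ a₂),
    (resComp (inf_le_left : U₁ ⊓ U₂ ≤ U₁)).inv.app a ≫ (res inf_le_left).map f₁.hom ≫ σ.hom =
      (resComp (inf_le_right : U₁ ⊓ U₂ ≤ U₂)).inv.app a ≫ (res inf_le_right).map f₂.hom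

open Functor.Monoidal in
/-- The unit `σ`, as an isomorphism over `U₁ ∩ U₂` between the restrictions of the unit objects
`𝟙 ∈ K(U₁)` and `𝟙 ∈ K(U₂)`. -/
noncomputable def unitGlueIso (σ : Gm (KU (U₁ ⊓ U₂))) :
    (res (inf_le_left : U₁ ⊓ U₂ ≤ U₁)).obj (𝟙_ (KU U₁)) ≅
      (res (inf_le_right : U₁ ⊓ U₂ ≤ U₂)).obj (𝟙_ (KU U₂)) :=
  (εIso (res (inf_le_left : U₁ ⊓ U₂ ≤ U₁))).symm ≪≫ Aut.unitsEndEquivAut _ σ ≪≫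
    εIso (res (inf_le_right : U₁ ⊓ U₂ ≤ U₂))

open Functor.Monoidal in
/-- `p` is obtained from `σ` as follows. Write `σ = t s⁻¹` with `U₁ ∩ U₂`-isomorphisms
`𝟙 <--s-- x --t--> 𝟙`, factor `s = s₁ s₂` and `t = t₂ t₁` with `U_i`-isomorphisms `s_i`, `t_i` (here
`s₂ : x ⟶ x₁` and `t₁ : x ⟶ x₂`), and let `p` be a weak push-out of `s₂` and `t₁`. -/
def IsWeakPushoutGluing (σ : Gm (KU (U₁ ⊓ U₂))) (p : C) : Prop :=
  ∃ (x x₁ x₂ : C) (s t : x ⟶ 𝟙_ C) (s₁ : x₁ ⟶ 𝟙_ C) (s₂ : x ⟶ x₁) (t₁ : x ⟶ x₂)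
    (t₂ : x₂ ⟶ 𝟙_ C) (u₁ : x₁ ⟶ p) (u₂ : x₂ ⟶ p),
    IsUIso (U₁ ⊓ U₂) s ∧ IsUIso (U₁ ⊓ U₂) t ∧
    (rho (U₁ ⊓ U₂)).map s ≫ (εIso (rho (U₁ ⊓ U₂))).inv ≫ (σ : End (𝟙_ (KU (U₁ ⊓ U₂)))) ≫
      (εIso (rho (U₁ ⊓ U₂))).hom = (rho (U₁ ⊓ U₂)).map t ∧
    s = s₂ ≫ s₁ ∧ t = t₁ ≫ t₂ ∧
    IsUIso U₁ s₁ ∧ IsUIso U₂ s₂ ∧ IsUIso U₁ t₁ ∧ IsUIso U₂ t₂ ∧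
    IsWeakPushout s₂ t₁ u₁ u₂

end TT
end TTGlue
open TTGlue

/-! Write Z₁ and Z₂ for the complements of U₁ and U₂; they are disjoint. Two facts carry the
theorem.

Orthogonality (`eq_zero_of_disjoint_supp`): objects with disjoint supports have no nonzero morphisms
between them. By strong duality every `a` is a retract of `(a ⊗ a') ⊗ a`, so a morphism `a ⟶ b`
factors through `(a ⊗ a') ⊗ b`; disjoint supports leave `a ⊗ b` with empty support, and Zorn's lemma
supplies enough primes to force it to vanish. Hence a morphism dying over U₁ composed with one dying
over U₂ is zero, in either order.

Decomposition (`exists_iso_biprod_of_supportedOn`): an object supported on Z₁ ∪ Z₂ is a sum `c₁ ⊞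
c₂` with `cᵢ` supported on Zᵢ. The objects having an endomorphism that is 0 over U₁ and 1 over U₂
form a thick tensor ideal, and every prime containing that ideal lies outside Z₁ ∪ Z₂, by
quasi-compactness. Orthogonality makes the endomorphism idempotent, and it splits.

The cone of a U₁₂-isomorphism therefore splits. This defines ∂, independently of choices because
maps between split cones are diagonal, and factors the U₁₂-isomorphism into a U₂-isomorphism
followed by a U₁-isomorphism. Morphisms agreeing over U₁₂ glue (`exists_rho_map_eq`), though not
uniquely: the ambiguity is the image of ∂. Objects of K isomorphic over U₁₂ glue by weak push-outs;
general objects of K(Uᵢ) are retracts of these, and are glued by extending the isomorphism to a sum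
and lifting an idempotent (`exists_isGluing`). A gluing is unique up to a non-canonical isomorphism.

Exactness is then read off. Products of values of ∂ vanish, so 1 + ∂ is multiplicative; gluings of
units tensor to gluings, so δ is a homomorphism; an object of K invertible over both Uᵢ is
invertible because its product with a glued inverse is a value of δ. -/

namespace TTGlue

/-! ### Thick tensor ideals, supports and the Zariski topology -/

section Ideals

variable {C : Type u} [Category.{v} C] [HasZeroObject C] [HasShift C ℤ] [Preadditive C]
  [∀ n : ℤ, (shiftFunctor C n).Additive] [Pretriangulated C]

/-- The triangle on a split monomorphism has zero third map, hence splits. This reconciles thickness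
for direct summands with thickness for retracts. -/
theorem exists_iso_biprod_of_retract {a b : C} (i : a ⟶ b) (r : b ⟶ a) (h : i ≫ r = 𝟙 a) :
    ∃ c : C, Nonempty (b ≅ a ⊞ c) := by
  obtain ⟨c, g, k, hT⟩ := distinguished_cocone_triangle i
  have : Mono i := mono_of_mono_fac h
  obtain ⟨e, -⟩ := exists_iso_binaryBiproduct_of_distTriang _ hT
    (Triangle.mor₃_eq_zero_of_mono₁ _ hT this)
  exact ⟨c, ⟨e⟩⟩

variable [MonoidalCategory C]

/-- Thick triangulated tensor ideals, with thickness expressed by retracts. -/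
structure IsThickIdeal (P : ObjectProperty C) : Prop where
  isTriangulated : P.IsTriangulated
  retract {a b : C} (i : a ⟶ b) (r : b ⟶ a) : i ≫ r = 𝟙 a → P b → P a
  ideal (a b : C) : P a → P (a ⊗ b)

theorem IsThickIdeal.isClosedUnderIso {P : ObjectProperty C} (h : IsThickIdeal P) :
    P.IsClosedUnderIsomorphisms where
  of_iso e ha := h.retract e.inv e.hom e.inv_hom_id ha

theorem IsPrimeIdeal.isThickIdeal {P : ObjectProperty C} (h : IsPrimeIdeal C P) :
    IsThickIdeal P where
  isTriangulated := h.isTriangulated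
  retract i r hir hb := by
    have := h.isClosedUnderIso
    obtain ⟨c, ⟨e⟩⟩ := exists_iso_biprod_of_retract i r hir
    exact (h.thick _ c (P.prop_of_iso e hb)).1
  ideal := h.ideal

theorem IsThickIdeal.ideal_left [SymmetricCategory C] {P : ObjectProperty C} (h : IsThickIdeal P)
    (a b : C) (hb : P b) : P (a ⊗ b) := by
  have := h.isClosedUnderIso
  exact P.prop_of_iso (β_ b a) (h.ideal b a hb)

theorem supportedOn_of_retract {Y : Set (Spc C)} {a b : C} (i : a ⟶ b) (r : b ⟶ a)
    (h : i ≫ r = 𝟙 a) (hb : supportedOn Y b) : supportedOn Y a :=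
  fun P hP => hb fun h' => hP (P.2.isThickIdeal.retract i r h h')

theorem mem_supp_tensor [SymmetricCategory C] (a b : C) (P : Spc C) :
    P ∈ supp (a ⊗ b) ↔ P ∈ supp a ∧ P ∈ supp b :=
  ⟨fun h => ⟨fun h' => h (P.2.ideal _ _ h'), fun h' => h (P.2.isThickIdeal.ideal_left _ _ h')⟩,
    fun h h' => (P.2.prime _ _ h').elim h.1 h.2⟩

theorem mem_supp_unit (P : Spc C) : P ∈ supp (𝟙_ C) := fun h => by
  obtain ⟨a, ha⟩ := P.2.proper
  have := P.2.isClosedUnderIso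
  exact ha (P.1.prop_of_iso (λ_ a) (P.2.ideal _ a h))

theorem mem_supp_biprod (a b : C) (P : Spc C) :
    P ∈ supp (a ⊞ b) ↔ P ∈ supp a ∨ P ∈ supp b := by
  have := P.2.isClosedUnderIso
  have := P.2.isTriangulated
  constructor
  · intro h
    by_contra! hn
    exact h (P.1.ext_of_isTriangulatedClosed₂ _ (binaryBiproductTriangle_distinguished a b)
      (not_not.1 hn.1) (not_not.1 hn.2))
  · rintro (h | h) h'
    · exact h (P.2.thick _ _ h').1
    · exact h (P.2.thick _ _ h').2

theorem isTopologicalBasis_compl_supp :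
    TopologicalSpace.IsTopologicalBasis {U : Set (Spc C) | ∃ a : C, U = (supp a)ᶜ} where
  exists_subset_inter := by
    rintro _ ⟨a, rfl⟩ _ ⟨b, rfl⟩ P hP
    -- Direct sums give unions of supports, hence intersections of basic opens.
    refine ⟨_, ⟨a ⊞ b, rfl⟩, ?_, ?_⟩
    · simp only [Set.mem_inter_iff, Set.mem_compl_iff, mem_supp_biprod] at hP ⊢
      tauto
    · intro Q hQ
      simp only [Set.mem_inter_iff, Set.mem_compl_iff, mem_supp_biprod] at hQ ⊢
      tauto
  sUnion_eq := Set.eq_univ_of_forall fun P => ⟨_, ⟨_, rfl⟩, by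
    have := P.2.isClosedUnderIso
    have := P.2.isTriangulated
    simpa [supp] using P.1.prop_zero⟩
  eq_generateFrom := rfl

/-- The complement of a quasi-compact open subset is the support of an object. -/
theorem exists_supp_eq_compl [SymmetricCategory C] (U : TopologicalSpace.Opens (Spc C))
    (hU : IsCompact (U : Set (Spc C))) : ∃ a : C, supp a = (U : Set (Spc C))ᶜ := by
  have hb : TopologicalSpace.IsTopologicalBasis
      (Set.range fun a : C => (supp a : Set (Spc C))ᶜ) := by
    convert isTopologicalBasis_compl_supp (C := C) using 1
    ext V
    exact ⟨fun ⟨a, h⟩ => ⟨a, h.symm⟩, fun ⟨a, h⟩ => ⟨a, h.symm⟩⟩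
  obtain ⟨s, hs, hUs⟩ :=
    eq_finite_iUnion_of_isTopologicalBasis_of_isCompact_open _ hb (U : Set (Spc C)) hU U.2
  suffices ∀ s : Set C, s.Finite → ∃ a : C, supp a = (⋃ i ∈ s, (supp i : Set (Spc C))ᶜ)ᶜ by
    rw [hUs]; exact this s hs
  intro s hs
  induction s, hs using Set.Finite.induction_on with
  | empty => exact ⟨𝟙_ C, by ext P; simpa using mem_supp_unit P⟩
  | @insert b s _ _ ih =>
    obtain ⟨a, ha⟩ := ih
    -- Quasi-compactness gives finitely many supports to intersect, and tensor products realise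
    -- intersections of supports.
    refine ⟨b ⊗ a, ?_⟩
    ext P
    rw [mem_supp_tensor, ha]
    simp only [Set.biUnion_insert, Set.compl_union, compl_compl, Set.mem_inter_iff]

end Ideals

/-! ### Existence of primes, and orthogonality of objects with disjoint supports -/

section Primes

variable {C : Type u} [Category.{v} C] [HasZeroObject C] [HasShift C ℤ] [Preadditive C]
  [∀ n : ℤ, (shiftFunctor C n).Additive] [Pretriangulated C] [MonoidalCategory C]

/-- A triangle identity of duality: `a'` is the dual, `e` the evaluation, and `i` comes from the
coevaluation, obtained by pulling the name of the identity of `a` back through the invertible map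
`D(a) ⊗ a ⟶ hom(a, a)`. -/
theorem StronglyClosed.exists_retract_tensor [MonoidalClosed C] [StronglyClosed C] (a : C) :
    ∃ (a' : C) (i : a ⟶ (a ⊗ a') ⊗ a) (e : a ⊗ a' ⟶ 𝟙_ C), i ≫ e ▷ a ≫ (λ_ a).hom = 𝟙 a := by
  have := StronglyClosed.dualizable a a
  let θ : (ihom a).obj (𝟙_ C) ⊗ a ⟶ (ihom a).obj a := MonoidalClosed.curry
    ((α_ a ((ihom a).obj (𝟙_ C)) a).inv ≫ (ihom.ev a).app (𝟙_ C) ▷ a ≫ (λ_ a).hom)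
  have hθ : a ◁ θ ≫ (ihom.ev a).app a =
      (α_ a ((ihom a).obj (𝟙_ C)) a).inv ≫ (ihom.ev a).app (𝟙_ C) ▷ a ≫ (λ_ a).hom := by
    rw [← MonoidalClosed.uncurry_eq, MonoidalClosed.uncurry_curry]
  have : IsIso θ := this
  refine ⟨(ihom a).obj (𝟙_ C), (ρ_ a).inv ≫ a ◁ (MonoidalClosed.curry (ρ_ a).hom ≫ inv θ) ≫
    (α_ a ((ihom a).obj (𝟙_ C)) a).inv, (ihom.ev a).app (𝟙_ C), ?_⟩
  rw [assoc, assoc, ← hθ, ← MonoidalCategory.whiskerLeft_comp_assoc, assoc, IsIso.inv_hom_id,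
    comp_id, ← MonoidalClosed.uncurry_eq, MonoidalClosed.uncurry_curry, Iso.inv_hom_id]

variable [SymmetricCategory C]

/-- Thick ideals are radical, because `a` is a retract of an object isomorphic to `a' ⊗ (a ⊗ a)`. -/
theorem IsThickIdeal.of_tensor_self [MonoidalClosed C] [StronglyClosed C] {P : ObjectProperty C}
    (h : IsThickIdeal P) {a : C} (ha : P (a ⊗ a)) : P a := by
  obtain ⟨a', i, e, hi⟩ := StronglyClosed.exists_retract_tensor a
  have := h.isClosedUnderIso
  refine h.retract i _ hi (P.prop_of_iso ?_ (h.ideal_left a' _ ha))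
  exact (α_ a' a a).symm ≪≫ whiskerRightIso (β_ a' a) a

variable [TensorTriangulated C]

/-- The analogue of the colon ideal (P : c), to which maximality is applied in the proof of
primality. -/
theorem isThickIdeal_inverseImage_tensorLeft {P : ObjectProperty C} (h : IsThickIdeal P) (c : C) :
    IsThickIdeal (P.inverseImage (tensorLeft c)) where
  isTriangulated := by
    have := h.isTriangulated
    have := h.isClosedUnderIso
    infer_instance
  retract i r hir hb := h.retract (c ◁ i) (c ◁ r) (by
    rw [← MonoidalCategory.whiskerLeft_comp, hir, MonoidalCategory.whiskerLeft_id]; rfl) hb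
  ideal a b ha := by
    have := h.isClosedUnderIso
    exact P.prop_of_iso (α_ c a b) (h.ideal (c ⊗ a) b ha)

theorem isThickIdeal_isZero : IsThickIdeal (fun a : C => IsZero a) where
  isTriangulated :=
    { exists_zero := ⟨_, isZero_zero C, isZero_zero C⟩
      isStableUnderShiftBy := fun n => ⟨fun _ ha => (shiftFunctor C n).map_isZero ha⟩
      ext₂' := fun T hT h₁ h₃ => ⟨_, T.isZero₂_of_isZero₁₃ hT h₁ h₃, ⟨Iso.refl _⟩⟩ }
  retract i r hir hb := by
    rw [IsZero.iff_id_eq_zero, ← hir, hb.eq_of_tgt i 0, zero_comp]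
  ideal a b ha := (tensorRight b).map_isZero ha

/-- As in commutative algebra, a thick ideal maximal among those containing J and avoiding `a` is
prime; radicality makes avoiding the single object `a` enough. -/
theorem exists_isPrimeIdeal [MonoidalClosed C] [StronglyClosed C] {J : ObjectProperty C}
    (hJ : IsThickIdeal J) {a : C} (ha : ¬ J a) :
    ∃ P : ObjectProperty C, IsPrimeIdeal C P ∧ J ≤ P ∧ ¬ P a := by
  obtain ⟨P, hJP, hP⟩ := zorn_le_nonempty₀ {P : ObjectProperty C | IsThickIdeal P ∧ ¬ P a}
    (fun c hc hch I hI => by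
      refine ⟨fun x => ∃ P ∈ c, P x, ⟨⟨?_, ?_, ?_⟩, ?_⟩, fun P hP x hx => ⟨P, hP, hx⟩⟩
      · exact
          { exists_zero := ⟨_, isZero_zero C, I, hI, by
              have := (hc hI).1.isTriangulated
              have := (hc hI).1.isClosedUnderIso
              exact I.prop_zero⟩
            isStableUnderShiftBy := fun n => ⟨fun x ⟨P, hP, hx⟩ => ⟨P, hP, by
              have := (hc hP).1.isTriangulated
              exact P.le_shift n _ hx⟩⟩
            ext₂' := by
              rintro T hT ⟨P, hP, h₁⟩ ⟨Q, hQ, h₃⟩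
              refine ⟨_, ?_, ⟨Iso.refl _⟩⟩
              obtain ⟨R, hR, h₁, h₃⟩ : ∃ R ∈ c, R T.obj₁ ∧ R T.obj₃ := by
                rcases hch.total hP hQ with h | h
                · exact ⟨Q, hQ, h _ h₁, h₃⟩
                · exact ⟨P, hP, h₁, h _ h₃⟩
              have := (hc hR).1.isTriangulated
              have := (hc hR).1.isClosedUnderIso
              exact ⟨R, hR, R.ext_of_isTriangulatedClosed₂ T hT h₁ h₃⟩ }
      · rintro x y i r hir ⟨P, hP, hy⟩
        exact ⟨P, hP, (hc hP).1.retract i r hir hy⟩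
      · rintro x y ⟨P, hP, hx⟩
        exact ⟨P, hP, (hc hP).1.ideal x y hx⟩
      · rintro ⟨P, hP, h⟩
        exact (hc hP).2 h) J ⟨hJ, ha⟩
  obtain ⟨⟨hP, haP⟩, hmax⟩ := hP
  -- The colon ideal (P : z) contains P and also `y`, so by maximality it must contain `a`.
  have key : ∀ z y : C, P (z ⊗ y) → ¬ P y → P (z ⊗ a) := fun z y hzy hy => by
    by_contra hn
    exact hy (hmax ⟨isThickIdeal_inverseImage_tensorLeft hP z, hn⟩
      (fun x hx => hP.ideal_left z x hx) y hzy)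
  have := hP.isClosedUnderIso
  refine ⟨P, ⟨hP.isTriangulated, hP.isClosedUnderIso, fun x y h => ⟨?_, ?_⟩, hP.ideal, ?_,
    ⟨a, haP⟩⟩, hJP, haP⟩
  · exact hP.retract biprod.inl biprod.fst (by simp) h
  · exact hP.retract biprod.inr biprod.snd (by simp) h
  · intro x y h
    by_contra! hn
    -- Applying `key` twice replaces first `y`, then `x`, by `a`, which puts `a ⊗ a` in P.
    have h₁ := P.prop_of_iso (β_ x a) (key x y h hn.2)
    exact haP (hP.of_tensor_self (key a x h₁ hn.1))

variable [MonoidalClosed C] [StronglyClosed C]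

theorem isZero_of_supp_eq_empty {a : C} (h : supp a = ∅) : IsZero a := by
  by_contra hn
  obtain ⟨P, hP, -, ha⟩ := exists_isPrimeIdeal (isThickIdeal_isZero (C := C)) hn
  exact (h ▸ (show (⟨P, hP⟩ : Spc C) ∈ supp a from ha) : (⟨P, hP⟩ : Spc C) ∈ (∅ : Set (Spc C)))

theorem eq_zero_of_disjoint_supp {a b : C} (h : Disjoint (supp a) (supp b)) (f : a ⟶ b) :
    f = 0 := by
  have hab : IsZero (a ⊗ b) := isZero_of_supp_eq_empty (by
    ext P
    rw [mem_supp_tensor]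
    exact ⟨fun hP => h.le_bot hP, fun hP => hP.elim⟩)
  obtain ⟨a', i, e, hi⟩ := StronglyClosed.exists_retract_tensor a
  have hz : IsZero ((a ⊗ a') ⊗ b) := ((tensorLeft a').map_isZero hab).of_iso
    (whiskerRightIso (β_ a a') b ≪≫ α_ a' a b)
  -- The retraction of `a` carries `f` through the zero object `(a ⊗ a') ⊗ b`.
  calc f = i ≫ (a ⊗ a') ◁ f ≫ e ▷ b ≫ (λ_ b).hom := by
        rw [whisker_exchange_assoc, leftUnitor_naturality, reassoc_of% hi]
    _ = 0 := by rw [hz.eq_of_tgt ((a ⊗ a') ◁ f) 0, zero_comp, comp_zero]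

end Primes

end TTGlue

namespace TTGlue

/-! ### Exactness of Hom on explicitly given triangles -/

section Triangles

variable {C : Type u} [Category.{v} C] [HasZeroObject C] [HasShift C ℤ] [Preadditive C]
  [∀ n : ℤ, (shiftFunctor C n).Additive] [Pretriangulated C] {a b c x : C}
  {f : a ⟶ b} {g : b ⟶ c} {h : c ⟶ a⟦(1 : ℤ)⟧} (hT : Triangle.mk f g h ∈ distTriang C)

include hT

theorem distTriang_comp₁₂ : f ≫ g = 0 := comp_distTriang_mor_zero₁₂ _ hT

theorem distTriang_comp₂₃ : g ≫ h = 0 := comp_distTriang_mor_zero₂₃ _ hT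

theorem distTriang_comp₃₁ : h ≫ f⟦(1 : ℤ)⟧' = 0 := comp_distTriang_mor_zero₃₁ _ hT

theorem distTriang_yoneda₂ (u : b ⟶ x) (hu : f ≫ u = 0) : ∃ v : c ⟶ x, u = g ≫ v :=
  Triangle.yoneda_exact₂ _ hT u hu

theorem distTriang_yoneda₃ (u : c ⟶ x) (hu : g ≫ u = 0) : ∃ v : a⟦(1 : ℤ)⟧ ⟶ x, u = h ≫ v :=
  Triangle.yoneda_exact₃ _ hT u hu

theorem distTriang_coyoneda₂ (u : x ⟶ b) (hu : u ≫ g = 0) : ∃ v : x ⟶ a, u = v ≫ f :=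
  Triangle.coyoneda_exact₂ _ hT u hu

theorem distTriang_coyoneda₃ (u : x ⟶ c) (hu : u ≫ h = 0) : ∃ v : x ⟶ b, u = v ≫ g :=
  Triangle.coyoneda_exact₃ _ hT u hu

end Triangles

/-! ### Calculus of fractions for the restriction to an open set -/

section Calculus

variable {C : Type u} [Category.{v} C] [HasZeroObject C] [HasShift C ℤ] [Preadditive C]
  [∀ n : ℤ, (shiftFunctor C n).Additive] [Pretriangulated C] [IsTriangulated C]
  [MonoidalCategory C] [SymmetricCategory C] [TensorTriangulated C]
  {U V : TopologicalSpace.Opens (Spc C)} {a b c d : C}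

theorem rho_map_surjective_hom (g : Mor U a b) :
    ∃ g' : (toLU U).obj a ⟶ (toLU U).obj b, g = (toKaroubi (LU U)).map g' :=
  ⟨_, ((toKaroubi (LU U)).map_preimage g).symm⟩

theorem exists_right_fraction (g : Mor U a b) :
    ∃ (x : C) (s : x ⟶ a) (f : x ⟶ b), uW U s ∧ (rho U).map s ≫ g = (rho U).map f := by
  obtain ⟨g, rfl⟩ := rho_map_surjective_hom g
  obtain ⟨φ, hφ⟩ := Localization.exists_rightFraction (toLU U) (uW U) g
  refine ⟨φ.X', φ.s, φ.f, φ.hs, ?_⟩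
  rw [hφ]
  change (toKaroubi (LU U)).map _ ≫ _ = _
  rw [← Functor.map_comp, φ.map_s_comp_map]
  rfl

theorem exists_left_fraction (g : Mor U a b) :
    ∃ (y : C) (s : b ⟶ y) (f : a ⟶ y), uW U s ∧ g ≫ (rho U).map s = (rho U).map f := by
  obtain ⟨g, rfl⟩ := rho_map_surjective_hom g
  obtain ⟨φ, hφ⟩ := Localization.exists_leftFraction (toLU U) (uW U) g
  refine ⟨φ.Y', φ.s, φ.f, φ.hs, ?_⟩
  rw [hφ]
  change _ ≫ (toKaroubi (LU U)).map _ = _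
  rw [← Functor.map_comp, φ.map_comp_map_s]
  rfl

theorem isIso_rho_map {s : a ⟶ b} (hs : uW U s) : IsIso ((rho U).map s) := by
  have := Localization.inverts (toLU U) (uW U) s hs
  change IsIso ((toKaroubi (LU U)).map ((toLU U).map s))
  infer_instance

theorem rho_map_eq_iff {f g : a ⟶ b} :
    (rho U).map f = (rho U).map g ↔ ∃ (x : C) (s : x ⟶ a), uW U s ∧ s ≫ f = s ≫ g := by
  rw [Functor.comp_map, Functor.comp_map, (toKaroubi (LU U)).map_injective.eq_iff,
    MorphismProperty.map_eq_iff_precomp (toLU U) (uW U)]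
  exact ⟨fun ⟨x, s, hs, h⟩ => ⟨x, s, hs, h⟩, fun ⟨x, s, hs, h⟩ => ⟨x, s, hs, h⟩⟩

theorem rho_map_eq_zero_of_factor {f : a ⟶ b} (hc : supportedOn (U : Set (Spc C))ᶜ c)
    (i : a ⟶ c) (p : c ⟶ b) (h : i ≫ p = f) : (rho U).map f = 0 := by
  have hc' : (rho U).map (𝟙 c) = 0 := by
    rw [← (rho U).map_zero, rho_map_eq_iff]
    exact ⟨_, 0, ⟨_, _, _, contractible_distinguished₁ c, hc⟩, by simp⟩
  rw [← h, ← id_comp p, Functor.map_comp, Functor.map_comp, hc', zero_comp, comp_zero]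

/-- A morphism dying over U is killed by precomposition with some `s` in `uW U`, so it factors
through the cone of `s`. -/
theorem exists_factor_of_rho_map_eq_zero {f : a ⟶ b} (h : (rho U).map f = 0) :
    ∃ (c : C) (i : a ⟶ c) (p : c ⟶ b), supportedOn (U : Set (Spc C))ᶜ c ∧ i ≫ p = f := by
  rw [← (rho U).map_zero, rho_map_eq_iff] at h
  obtain ⟨x, s, ⟨c, i, k, hT, hc⟩, h⟩ := h
  obtain ⟨p, hp⟩ := distTriang_yoneda₂ hT f (h.trans comp_zero)
  exact ⟨c, i, p, hc, hp.symm⟩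

theorem supportedOn_of_rho_map_id_eq_zero (h : (rho U).map (𝟙 a) = 0) :
    supportedOn (U : Set (Spc C))ᶜ a := by
  obtain ⟨c, i, p, hc, h⟩ := exists_factor_of_rho_map_eq_zero h
  exact supportedOn_of_retract i p h hc

theorem rho_map_eq_iff' {f g : a ⟶ b} :
    (rho U).map f = (rho U).map g ↔ ∃ (y : C) (s : b ⟶ y), uW U s ∧ f ≫ s = g ≫ s := by
  rw [Functor.comp_map, Functor.comp_map, (toKaroubi (LU U)).map_injective.eq_iff,
    MorphismProperty.map_eq_iff_postcomp (toLU U) (uW U)]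
  exact ⟨fun ⟨x, s, hs, h⟩ => ⟨x, s, hs, h⟩, fun ⟨x, s, hs, h⟩ => ⟨x, s, hs, h⟩⟩

/-- Passing to the idempotent completion inverts nothing new: both maps adjacent to the cone of `s`
die over U, hence so does the identity of the cone, and the objects supported on the complement of U
are closed under retracts. -/
theorem isUIso_iff {s : a ⟶ b} : IsUIso U s ↔ uW U s := by
  refine ⟨fun h => ?_, fun h => isIso_rho_map h⟩
  obtain ⟨c, p, q, hT⟩ := distinguished_cocone_triangle s
  refine ⟨c, p, q, hT, supportedOn_of_rho_map_id_eq_zero ?_⟩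
  have : IsIso ((rho U).map s) := h
  have hsp : s ≫ p = 0 := distTriang_comp₁₂ hT
  have hqs : q ≫ s⟦(1 : ℤ)⟧' = 0 := distTriang_comp₃₁ hT
  have hp : (rho U).map p = 0 := by
    rw [← cancel_epi ((rho U).map s), ← Functor.map_comp, hsp, Functor.map_zero, comp_zero]
  -- Writing the inverse of `s` as a left fraction gives a U-isomorphism `t ≫ r` divisible by `s`;
  -- its suspension kills `q`.
  have hq : (rho U).map q = 0 := by
    obtain ⟨y, t, f, ht, htf⟩ := exists_left_fraction (inv ((rho U).map s))
    rw [IsIso.inv_comp_eq, ← Functor.map_comp, rho_map_eq_iff'] at htf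
    obtain ⟨z, r, hr, h⟩ := htf
    have := isIso_rho_map (ObjectProperty.trW.shift ((uW U).comp_mem _ _ ht hr) 1)
    rw [← cancel_mono ((rho U).map ((t ≫ r)⟦(1 : ℤ)⟧')), ← Functor.map_comp, h, assoc,
      Functor.map_comp (shiftFunctor C (1 : ℤ)), reassoc_of% hqs, zero_comp, Functor.map_zero,
      zero_comp]
  rw [← (rho U).map_zero, rho_map_eq_iff] at hq
  obtain ⟨z, r, hr, hrq⟩ := hq
  -- The U-isomorphism `r` into the cone lifts through `p`, so it is both zero and invertible over
  -- U.
  obtain ⟨k, hk⟩ := distTriang_coyoneda₃ hT r (hrq.trans comp_zero)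
  have := isIso_rho_map hr
  rw [← cancel_epi ((rho U).map r), ← Functor.map_comp, comp_id, hk, Functor.map_comp, hp,
    comp_zero, zero_comp]

theorem exists_common_refinement {g : Mor U a b} {x y : C} {s : x ⟶ a} {f : x ⟶ b} {t : y ⟶ a}
    {h : y ⟶ b} (hs : uW U s) (ht : uW U t) (hf : (rho U).map s ≫ g = (rho U).map f)
    (hh : (rho U).map t ≫ g = (rho U).map h) :
    ∃ (z : C) (p : z ⟶ x) (q : z ⟶ y), uW U p ∧ uW U q ∧ p ≫ s = q ≫ t ∧ p ≫ f = q ≫ h := by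
  obtain ⟨w, p, q, hp, hpq⟩ : ∃ (w : C) (p : w ⟶ x) (q : w ⟶ y), uW U p ∧ p ≫ s = q ≫ t := by
    obtain ⟨ψ, hψ⟩ := (MorphismProperty.LeftFraction.mk s t ht).exists_rightFraction
    exact ⟨ψ.X', ψ.s, ψ.f, ψ.hs, hψ⟩
  have hpq' : (rho U).map (p ≫ f) = (rho U).map (q ≫ h) := by
    rw [Functor.map_comp, Functor.map_comp, ← hf, ← hh, ← Functor.map_comp_assoc,
      ← Functor.map_comp_assoc, hpq]
  rw [rho_map_eq_iff] at hpq'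
  obtain ⟨z, r, hr, h'⟩ := hpq'
  have hrp := (uW U).comp_mem _ _ hr hp
  refine ⟨z, r ≫ p, r ≫ q, hrp, ?_, by simp only [assoc, hpq], by simpa using h'⟩
  -- The second leg is a U-isomorphism by two-out-of-three, applied to invertibility over U.
  rw [← isUIso_iff] at ht ⊢
  have hc := (uW U).comp_mem _ _ hrp hs
  rw [assoc, hpq, ← assoc, ← isUIso_iff] at hc
  have : IsIso ((rho U).map t) := ht
  have hc : IsIso ((rho U).map ((r ≫ q) ≫ t)) := hc
  rw [Functor.map_comp] at hc
  exact IsIso.of_isIso_comp_right _ ((rho U).map t)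

theorem exists_common_denominator (g g' : Mor U a b) :
    ∃ (x : C) (s : x ⟶ a) (f f' : x ⟶ b), uW U s ∧ (rho U).map s ≫ g = (rho U).map f ∧
      (rho U).map s ≫ g' = (rho U).map f' := by
  obtain ⟨x, s, f, hs, hf⟩ := exists_right_fraction g
  obtain ⟨y, t, h, ht, hh⟩ := exists_right_fraction ((rho U).map s ≫ g')
  refine ⟨y, t ≫ s, t ≫ f, h, (uW U).comp_mem _ _ ht hs, ?_, ?_⟩
  · rw [Functor.map_comp, assoc, hf, ← Functor.map_comp]
  · rw [Functor.map_comp, assoc, hh]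

/-- Localization is essentially surjective, and the idempotent completion adds only retracts. -/
theorem exists_retract_rho (P : KU U) :
    ∃ (x : C) (i : P ⟶ (rho U).obj x) (r : (rho U).obj x ⟶ P), i ≫ r = 𝟙 P := by
  have := Localization.essSurj (toLU U) (uW U)
  let e := (toLU U).objObjPreimageIso P.X
  refine ⟨(toLU U).objPreimage P.X, P.decompId_i ≫ (toKaroubi (LU U)).map e.inv,
    (toKaroubi (LU U)).map e.hom ≫ P.decompId_p, ?_⟩
  rw [assoc, ← Functor.map_comp_assoc, e.inv_hom_id, CategoryTheory.Functor.map_id, id_comp]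
  exact P.decompId.symm

end Calculus

/-! ### Restriction from one open set to a smaller one -/

section Restriction

variable {C : Type u} [Category.{v} C] [HasZeroObject C] [HasShift C ℤ] [Preadditive C]
  [∀ n : ℤ, (shiftFunctor C n).Additive] [Pretriangulated C] [IsTriangulated C]
  [MonoidalCategory C] [SymmetricCategory C] [TensorTriangulated C]
  {U V : TopologicalSpace.Opens (Spc C)} (h : U ≤ V) {a b c : C}

theorem resMor_apply (g : Mor V a b) :
    resMor h a b g = (resComp h).inv.app a ≫ (res h).map g ≫ (resComp h).hom.app b := rfl

theorem resMor_rho_map (f : a ⟶ b) : resMor h a b ((rho V).map f) = (rho U).map f := by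
  rw [resMor_apply]
  exact NatIso.naturality_1 (resComp h) f

theorem resMor_comp (f : Mor V a b) (g : Mor V b c) :
    resMor h a c (f ≫ g) = resMor h a b f ≫ resMor h b c g := by
  simp only [resMor_apply, assoc, Functor.map_comp, Iso.hom_inv_id_app_assoc]

theorem resMor_id : resMor h a a (𝟙 _) = 𝟙 _ := by
  rw [← (rho V).map_id, resMor_rho_map, CategoryTheory.Functor.map_id]

theorem isIso_resMor (f : Mor V a b) [IsIso f] : IsIso (resMor h a b f) :=
  ⟨resMor h b a (inv f), by rw [← resMor_comp, IsIso.hom_inv_id, resMor_id],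
    by rw [← resMor_comp, IsIso.inv_hom_id, resMor_id]⟩

open Functor.Monoidal Functor.LaxMonoidal in
theorem ε_comp_resComp :
    ε (res h) ≫ (res h).map (ε (rho V)) ≫ (resComp h).hom.app (𝟙_ C) = ε (rho U) := by
  have H : (ε (resL h) ≫ (resL h).map (ε (toLU V))) ≫
      (Localization.Lifting.iso (toLU V) (uW V) (toLU U) (resL h)).hom.app (𝟙_ C) =
        ε (toLU U) := NatTrans.IsMonoidal.unit
    (τ := (Localization.Lifting.iso (toLU V) (uW V) (toLU U) (resL h)).hom)
  ext
  change (𝟙 _ ≫ ε (resL h)) ≫ (resL h).map (𝟙 _ ≫ ε (toLU V)) ≫ (resL h).map (𝟙 _) ≫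
    ((resL h).map (𝟙 _) ≫ 𝟙 _) ≫ 𝟙 _ ≫
      (Localization.Lifting.iso (toLU V) (uW V) (toLU U) (resL h)).hom.app (𝟙_ C) =
    𝟙 _ ≫ ε (toLU U)
  simp only [id_comp, comp_id, CategoryTheory.Functor.map_id, ← H, assoc]

end Restriction

end TTGlue

namespace TTGlue

/-! ### Weak push-outs and factorizations from the octahedral axiom -/

section Octahedra

variable {C : Type u} [Category.{v} C] [HasZeroObject C] [HasShift C ℤ] [Preadditive C]
  [∀ n : ℤ, (shiftFunctor C n).Additive] [Pretriangulated C]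

theorem distTriang_of_iso {a b c a' b' c' : C} {f : a ⟶ b} {g : b ⟶ c} {h : c ⟶ a⟦(1 : ℤ)⟧}
    {f' : a' ⟶ b'} {g' : b' ⟶ c'} {h' : c' ⟶ a'⟦(1 : ℤ)⟧}
    (hT : Triangle.mk f g h ∈ distTriang C) (e₁ : a' ≅ a) (e₂ : b' ≅ b) (e₃ : c' ≅ c)
    (w₁ : f' ≫ e₂.hom = e₁.hom ≫ f) (w₂ : g' ≫ e₃.hom = e₂.hom ≫ g)
    (w₃ : h' ≫ e₁.hom⟦(1 : ℤ)⟧' = e₃.hom ≫ h) : Triangle.mk f' g' h' ∈ distTriang C :=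
  isomorphic_distinguished _ hT _ (Triangle.isoMk _ _ e₁ e₂ e₃ w₁ w₂ w₃)

theorem distTriang_rotate {a b c : C} {f : a ⟶ b} {g : b ⟶ c} {h : c ⟶ a⟦(1 : ℤ)⟧}
    (hT : Triangle.mk f g h ∈ distTriang C) :
    Triangle.mk g h (-f⟦(1 : ℤ)⟧') ∈ distTriang C :=
  rot_of_distTriang _ hT

theorem distTriang_inl_snd (a b : C) :
    Triangle.mk (biprod.inl : a ⟶ a ⊞ b) (biprod.snd : a ⊞ b ⟶ b) 0 ∈ distTriang C :=
  binaryBiproductTriangle_distinguished a b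

theorem distTriang_inr_fst (a b : C) :
    Triangle.mk (biprod.inr : b ⟶ a ⊞ b) (biprod.fst : a ⊞ b ⟶ a) 0 ∈ distTriang C :=
  distTriang_of_iso (distTriang_inl_snd b a) (Iso.refl _) (biprod.braiding a b) (Iso.refl _)
    (by ext <;> simp) (by simp) (by simp)

theorem distTriang_biprod_swap {x a c₁ c₂ : C} {s : x ⟶ a} {α : a ⟶ c₁} {β : a ⟶ c₂}
    {γ : c₁ ⟶ x⟦(1 : ℤ)⟧} {δ : c₂ ⟶ x⟦(1 : ℤ)⟧}
    (hT : Triangle.mk s (biprod.lift α β) (biprod.desc γ δ) ∈ distTriang C) :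
    Triangle.mk s (biprod.lift β α) (biprod.desc δ γ) ∈ distTriang C :=
  distTriang_of_iso hT (Iso.refl _) (Iso.refl _) (biprod.braiding c₂ c₁)
    (by simp) (by ext <;> simp) (by ext <;> simp)

theorem IsWeakPushout.swap {a b c d : C} {f : a ⟶ b} {g : a ⟶ c} {h : b ⟶ d} {k : c ⟶ d}
    (H : IsWeakPushout f g h k) : IsWeakPushout g f k h := by
  obtain ⟨H, l, hl⟩ := H
  exact ⟨H.symm, -l, distTriang_of_iso hl (Iso.refl _) (biprod.braiding c b)
    ⟨-𝟙 d, -𝟙 d, by simp, by simp⟩ (by ext <;> simp) (by ext <;> simp) (by simp)⟩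

theorem exists_isWeakPushout {a b c : C} (f : a ⟶ b) (g : a ⟶ c) :
    ∃ (d : C) (h : b ⟶ d) (k : c ⟶ d), IsWeakPushout f g h k := by
  obtain ⟨d, u, l, hT⟩ := distinguished_cocone_triangle (biprod.lift f g)
  have hu : biprod.desc (-(-(biprod.inl ≫ u))) (biprod.inr ≫ u) = u := by ext <;> simp
  have h0 := distTriang_comp₁₂ hT
  refine ⟨d, -(biprod.inl ≫ u), biprod.inr ≫ u, ?_, l, hu.symm ▸ hT⟩
  rw [← hu, biprod.lift_desc, neg_neg, ← neg_neg (f ≫ _), neg_add_eq_zero] at h0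
  rw [← h0, Preadditive.comp_neg]

theorem trW_of_distTriang_rotate {P : ObjectProperty C} [P.IsTriangulated] {a b c : C} {f : a ⟶ b}
    {g : b ⟶ c} {h : c ⟶ a⟦(1 : ℤ)⟧} (hT : Triangle.mk f g h ∈ distTriang C) (hb : P b) :
    P.trW h :=
  ⟨_, _, _, distTriang_rotate (distTriang_rotate hT), P.le_shift 1 _ hb⟩

variable [IsTriangulated C]

theorem exists_octahedron {a b c d e f : C} {u : a ⟶ b} {v : b ⟶ c} {w : a ⟶ c}
    (comm : u ≫ v = w) {p : b ⟶ d} {p' : d ⟶ a⟦(1 : ℤ)⟧}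
    (hu : Triangle.mk u p p' ∈ distTriang C) {q : c ⟶ e} {q' : e ⟶ b⟦(1 : ℤ)⟧}
    (hv : Triangle.mk v q q' ∈ distTriang C) {r : c ⟶ f} {r' : f ⟶ a⟦(1 : ℤ)⟧}
    (hw : Triangle.mk w r r' ∈ distTriang C) :
    ∃ (m : d ⟶ f) (n : f ⟶ e), p ≫ m = v ≫ r ∧ m ≫ r' = p' ∧
      Triangle.mk m n (q' ≫ p⟦(1 : ℤ)⟧') ∈ distTriang C :=
  let O := Triangulated.someOctahedron comm hu hv hw
  ⟨O.m₁, O.m₃, O.comm₁, O.comm₂, O.mem⟩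

/-- Parallel sides of a weak push-out have the same cone. The octahedron on `a ⟶ b ⊞ c ⟶ c`, whose
composite is `g`, puts the cone of `g` in a triangle with the suspension of `h`. -/
theorem IsWeakPushout.trW_left {P : ObjectProperty C} [P.IsTriangulated]
    {a b c d : C} {f : a ⟶ b} {g : a ⟶ c} {h : b ⟶ d} {k : c ⟶ d}
    (H : IsWeakPushout f g h k) (hg : P.trW g) : P.trW h := by
  obtain ⟨-, l, hl⟩ := H
  obtain ⟨z, p, q, hT, hz⟩ := hg
  obtain ⟨m, n, -, -, hO⟩ := exists_octahedron (biprod.lift_snd f g) hl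
    (distTriang_rotate (distTriang_inl_snd b c)) hT
  rw [Preadditive.neg_comp, ← Functor.map_comp, biprod.inl_desc, Functor.map_neg, neg_neg] at hO
  exact ObjectProperty.trW.unshift (n := 1) P (trW_of_distTriang_rotate hO hz)

theorem IsWeakPushout.trW_right {P : ObjectProperty C} [P.IsTriangulated]
    {a b c d : C} {f : a ⟶ b} {g : a ⟶ c} {h : b ⟶ d} {k : c ⟶ d}
    (H : IsWeakPushout f g h k) (hf : P.trW f) : P.trW k :=
  H.swap.trW_left hf

/-- A morphism whose cone is `c₁ ⊞ c₂` factors as a morphism with cone `c₂` followed by a morphism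
with cone `c₁`. -/
theorem exists_factor_of_distTriang_biprod {x a c₁ c₂ : C} {s : x ⟶ a} {α : a ⟶ c₁} {β : a ⟶ c₂}
    {γ : c₁ ⟶ x⟦(1 : ℤ)⟧} {δ : c₂ ⟶ x⟦(1 : ℤ)⟧}
    (hT : Triangle.mk s (biprod.lift α β) (biprod.desc γ δ) ∈ distTriang C) :
    ∃ (x₁ : C) (s₂ : x ⟶ x₁) (s₁ : x₁ ⟶ a) (ε : c₁ ⟶ x₁⟦(1 : ℤ)⟧),
      s₂ ≫ s₁ = s ∧ Triangle.mk s₁ α ε ∈ distTriang C ∧ γ ≫ s₂⟦(1 : ℤ)⟧' = ε ∧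
      δ ≫ s₂⟦(1 : ℤ)⟧' = 0 ∧ ∀ (P : ObjectProperty C) [P.IsTriangulated], P c₂ → P.trW s₂ := by
  obtain ⟨x₁, s₁, ε, h₁⟩ := distinguished_cocone_triangle₁ α
  -- `x₁` is the fibre of `α`, the composite of `(α, β)` with the first projection; the octahedron
  -- compares the two fibres, and their difference is `c₂`.
  obtain ⟨m, n, e₁, e₂, hO⟩ := exists_octahedron (biprod.lift_fst α β) (distTriang_rotate hT)
    (distTriang_rotate (distTriang_inr_fst c₁ c₂)) (distTriang_rotate h₁)
  obtain ⟨s₂, rfl⟩ := (shiftFunctor C (1 : ℤ)).map_surjective m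
  refine ⟨x₁, s₂, s₁, ε, ?_, h₁, ?_, ?_, fun P _ hP => ?_⟩
  · apply (shiftFunctor C (1 : ℤ)).map_injective
    rw [Functor.map_comp, ← neg_inj, ← e₂, Preadditive.comp_neg]
  · rw [← biprod.inl_desc_assoc γ δ, e₁, biprod.inl_fst_assoc]
  · rw [← biprod.inr_desc_assoc γ δ, e₁, biprod.inr_fst_assoc, zero_comp]
  · exact ObjectProperty.trW.unshift (n := 1) P ⟨_, _, _, hO, P.le_shift 1 _ hP⟩

end Octahedra

/-! ### Objects supported on the two disjoint complements, and their decomposition -/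

section Disjoint

variable {C : Type u} [Category.{v} C] [HasZeroObject C] [HasShift C ℤ] [Preadditive C]
  [∀ n : ℤ, (shiftFunctor C n).Additive] [Pretriangulated C] [MonoidalCategory C]
  {U₁ U₂ : TopologicalSpace.Opens (Spc C)} {a b : C}

theorem supportedOn_disjoint (hU : U₁ ⊔ U₂ = ⊤) (ha : supportedOn (U₁ : Set (Spc C))ᶜ a)
    (hb : supportedOn (U₂ : Set (Spc C))ᶜ b) : Disjoint (supp a) (supp b) := by
  rw [Set.disjoint_left]
  intro P hPa hPb
  have hP : P ∈ U₁ ⊔ U₂ := hU ▸ trivial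
  rcases hP with hP | hP
  · exact ha hPa hP
  · exact hb hPb hP

theorem eq_zero_of_supportedOn [SymmetricCategory C] [TensorTriangulated C]
    [MonoidalClosed C] [StronglyClosed C] (hU : U₁ ⊔ U₂ = ⊤)
    (ha : supportedOn (U₁ : Set (Spc C))ᶜ a)
    (hb : supportedOn (U₂ : Set (Spc C))ᶜ b) (f : a ⟶ b) : f = 0 :=
  eq_zero_of_disjoint_supp (supportedOn_disjoint hU ha hb) f

end Disjoint

section Decomposition

variable {C : Type u} [Category.{v} C] [HasZeroObject C] [HasShift C ℤ] [Preadditive C]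
  [∀ n : ℤ, (shiftFunctor C n).Additive] [Pretriangulated C] [IsTriangulated C]
  [MonoidalCategory C] [SymmetricCategory C] [TensorTriangulated C]
  {U U₁ U₂ : TopologicalSpace.Opens (Spc C)} {a b c : C}

/-- Factoring through a supported object is stable under suspension, so no suspension on K(U) is
needed. -/
theorem rho_map_shift_eq_zero {f : a ⟶ b} (h : (rho U).map f = 0) (n : ℤ) :
    (rho U).map (f⟦n⟧') = 0 := by
  obtain ⟨c, i, p, hc, h⟩ := exists_factor_of_rho_map_eq_zero h
  exact rho_map_eq_zero_of_factor (ObjectProperty.le_shift _ n _ hc) (i⟦n⟧') (p⟦n⟧')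
    (by rw [← Functor.map_comp, h])

theorem rho_map_shift_eq_zero_iff {f : a ⟶ b} {n : ℤ} :
    (rho U).map (f⟦n⟧') = 0 ↔ (rho U).map f = 0 := by
  refine ⟨fun h => ?_, fun h => rho_map_shift_eq_zero h n⟩
  have h' := rho_map_shift_eq_zero h (-n)
  have e := ((shiftEquiv C n).unitIso.hom.naturality f)
  dsimp at e
  rw [← cancel_mono ((rho U).map ((shiftEquiv C n).unitIso.hom.app b)), ← Functor.map_comp,
    zero_comp]
  refine (congrArg (rho U).map e).trans ((Functor.map_comp _ _ _).trans ?_)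
  exact (congrArg _ h').trans comp_zero

theorem rho_map_whiskerRight_eq_zero {f : a ⟶ b} (h : (rho U).map f = 0) (d : C) :
    (rho U).map (f ▷ d) = 0 := by
  obtain ⟨c, i, p, hc, h⟩ := exists_factor_of_rho_map_eq_zero h
  exact rho_map_eq_zero_of_factor (supportedOn_tensorRight _ d _ hc) (i ▷ d) (p ▷ d)
    (by rw [← comp_whiskerRight, h])

/-- Over U, `y` dies after the second map, so up to a U-isomorphism it lifts through the first map;
a further `y` turns into `x`, which dies. Only the square of `y` is controlled. -/
theorem rho_map_comp_self_eq_zero {T : Triangle C} (hT : T ∈ distTriang C) {x : T.obj₁ ⟶ T.obj₁}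
    {y : T.obj₂ ⟶ T.obj₂} {z : T.obj₃ ⟶ T.obj₃} (hx : (rho U).map x = 0) (hz : (rho U).map z = 0)
    (hxy : T.mor₁ ≫ y = x ≫ T.mor₁) (hyz : T.mor₂ ≫ z = y ≫ T.mor₂) :
    (rho U).map (y ≫ y) = 0 := by
  have h : (rho U).map (y ≫ T.mor₂) = (rho U).map 0 := by
    rw [← hyz, Functor.map_comp, hz, comp_zero, Functor.map_zero]
  rw [rho_map_eq_iff] at h
  obtain ⟨w, s, hs, h⟩ := h
  rw [comp_zero, ← assoc] at h
  obtain ⟨k, hk⟩ := Triangle.coyoneda_exact₂ _ hT _ h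
  have := isIso_rho_map hs
  rw [← cancel_epi ((rho U).map s), ← Functor.map_comp, ← assoc, hk, assoc, hxy,
    Functor.map_comp, Functor.map_comp, hx, zero_comp, comp_zero, comp_zero]

variable (hU : U₁ ⊔ U₂ = ⊤)
include hU

variable [MonoidalClosed C] [StronglyClosed C]

/-- The two factors pass through objects with disjoint supports. Most later vanishing statements
come down to this. -/
theorem comp_eq_zero_of_rho_map_eq_zero {f : a ⟶ b} {g : b ⟶ c} (hf : (rho U₁).map f = 0)
    (hg : (rho U₂).map g = 0) : f ≫ g = 0 := by
  obtain ⟨x, i, p, hx, rfl⟩ := exists_factor_of_rho_map_eq_zero hf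
  obtain ⟨y, j, q, hy, rfl⟩ := exists_factor_of_rho_map_eq_zero hg
  rw [assoc, ← assoc p, eq_zero_of_supportedOn hU hx hy (p ≫ j), zero_comp, comp_zero]

/-- The cone is supported on both complements, which are disjoint, so its identity vanishes. -/
theorem isIso_of_isUIso {s : a ⟶ b} (h₁ : IsUIso U₁ s) (h₂ : IsUIso U₂ s) : IsIso s := by
  obtain ⟨c, p, q, hT⟩ := distinguished_cocone_triangle s
  have hc₁ := ((supportedOn (U₁ : Set (Spc C))ᶜ).trW_iff_of_distinguished _ hT).1
    (isUIso_iff.1 h₁)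
  have hc₂ := ((supportedOn (U₂ : Set (Spc C))ᶜ).trW_iff_of_distinguished _ hT).1
    (isUIso_iff.1 h₂)
  refine (Triangle.isZero₃_iff_isIso₁ _ hT).1 ?_
  rw [IsZero.iff_id_eq_zero]
  exact eq_zero_of_supportedOn hU hc₁ hc₂ _

/-- The endomorphism `e` plays the role of the projection to the part supported off U₁. Stability
under extensions is the real content. -/
theorem isThickIdeal_exists_splitting : IsThickIdeal (fun a : C =>
    ∃ e : a ⟶ a, (rho U₁).map e = 0 ∧ (rho U₂).map (𝟙 a - e) = 0) where
  isTriangulated :=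
    { exists_zero := ⟨_, isZero_zero C, 0, Functor.map_zero _ _ _, by
        rw [(isZero_zero C).eq_of_src (𝟙 _ - 0) 0, Functor.map_zero]⟩
      isStableUnderShiftBy := fun n => ⟨fun a ⟨e, h₁, h₂⟩ => ⟨e⟦n⟧', rho_map_shift_eq_zero h₁ n, by
        rw [← CategoryTheory.Functor.map_id, ← Functor.map_sub]
        exact rho_map_shift_eq_zero h₂ n⟩⟩
      ext₂' := by
        rintro T hT ⟨x, hx₁, hx₂⟩ ⟨z, hz₁, hz₂⟩
        refine ⟨_, ?_, ⟨Iso.refl _⟩⟩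
        -- By orthogonality both sides equal `z ≫ T.mor₃ ≫ x⟦1⟧'`.
        have hc : T.mor₃ ≫ x⟦(1 : ℤ)⟧' = z ≫ T.mor₃ := by
          have h₁ : (z ≫ T.mor₃) ≫ (𝟙 _ - x)⟦(1 : ℤ)⟧' = 0 :=
            comp_eq_zero_of_rho_map_eq_zero hU
              (by rw [Functor.map_comp, hz₁, zero_comp]) (rho_map_shift_eq_zero hx₂ 1)
          have h₂ : (𝟙 _ - z) ≫ (T.mor₃ ≫ x⟦(1 : ℤ)⟧') = 0 :=
            comp_eq_zero_of_rho_map_eq_zero (sup_comm U₁ U₂ ▸ hU) hz₂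
              (by rw [Functor.map_comp, rho_map_shift_eq_zero hx₁ 1, comp_zero])
          rw [Functor.map_sub, CategoryTheory.Functor.map_id, Preadditive.comp_sub, comp_id,
            sub_eq_zero] at h₁
          rw [Preadditive.sub_comp, id_comp, sub_eq_zero] at h₂
          rw [h₁, h₂, assoc]
        obtain ⟨y, hxy, hyz⟩ := complete_distinguished_triangle_morphism₂ T T hT hT x z hc
        have h₁ := rho_map_comp_self_eq_zero hT hx₁ hz₁ hxy hyz
        have h₂ := rho_map_comp_self_eq_zero (y := 𝟙 _ - y) hT hx₂ hz₂
          (by rw [Preadditive.comp_sub, Preadditive.sub_comp, hxy, comp_id, id_comp])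
          (by rw [Preadditive.comp_sub, Preadditive.sub_comp, hyz, comp_id, id_comp])
        -- Only `y²` over U₁ and `(1 - y)²` over U₂ are known to vanish. The polynomial `y²(3 - 2y)`
        -- is divisible by the first, and `1 - y²(3 - 2y) = (1 - y)²(1 + 2y)` by the second.
        refine ⟨(y ≫ y) ≫ (𝟙 _ + 𝟙 _ + 𝟙 _ - y - y), ?_, ?_⟩
        · rw [Functor.map_comp, h₁, zero_comp]
        · have : 𝟙 _ - (y ≫ y) ≫ (𝟙 _ + 𝟙 _ + 𝟙 _ - y - y) =
              ((𝟙 _ - y) ≫ (𝟙 _ - y)) ≫ (𝟙 _ + y + y) := by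
            simp only [Preadditive.comp_sub, Preadditive.sub_comp, Preadditive.comp_add, comp_id,
              id_comp, assoc]
            abel
          rw [this, Functor.map_comp, h₂, zero_comp] }
  retract := by
    rintro a b i r hir ⟨e, h₁, h₂⟩
    refine ⟨i ≫ e ≫ r, ?_, ?_⟩
    · rw [Functor.map_comp, Functor.map_comp, h₁, zero_comp, comp_zero]
    · have : 𝟙 a - i ≫ e ≫ r = i ≫ (𝟙 b - e) ≫ r := by
        rw [Preadditive.sub_comp, Preadditive.comp_sub, id_comp, hir]
      rw [this, Functor.map_comp, Functor.map_comp, h₂, zero_comp, comp_zero]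
  ideal := by
    rintro a b ⟨e, h₁, h₂⟩
    refine ⟨e ▷ b, rho_map_whiskerRight_eq_zero h₁ b, ?_⟩
    have : 𝟙 (a ⊗ b) - e ▷ b = (𝟙 a - e) ▷ b := by
      change _ = (tensorRight b).map (𝟙 a - e)
      rw [Functor.map_sub, CategoryTheory.Functor.map_id]
      rfl
    rw [this]
    exact rho_map_whiskerRight_eq_zero h₂ b

theorem exists_iso_biprod_of_supportedOn [IsIdempotentComplete C]
    (hU₁ : IsCompact (U₁ : Set (Spc C))) (hU₂ : IsCompact (U₂ : Set (Spc C)))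
    (ha : supportedOn ((U₁ ⊓ U₂ : TopologicalSpace.Opens (Spc C)) : Set (Spc C))ᶜ a) :
    ∃ c₁ c₂ : C, supportedOn (U₁ : Set (Spc C))ᶜ c₁ ∧ supportedOn (U₂ : Set (Spc C))ᶜ c₂ ∧
      Nonempty (a ≅ c₁ ⊞ c₂) := by
  obtain ⟨e, h₁, h₂⟩ : ∃ e : a ⟶ a, (rho U₁).map e = 0 ∧ (rho U₂).map (𝟙 a - e) = 0 := by
    by_contra hn
    -- Otherwise some prime contains every splittable object but not `a`, so it lies in Z₁ ∪ Z₂. But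
    -- Zᵢ is the support of an object `bᵢ` that splits trivially, with `e = 1` for `b₁` and `e = 0`
    -- for `b₂`.
    obtain ⟨P, hP, hJ, hPa⟩ := exists_isPrimeIdeal (isThickIdeal_exists_splitting hU) hn
    obtain ⟨b₁, hb₁⟩ := exists_supp_eq_compl U₁ hU₁
    obtain ⟨b₂, hb₂⟩ := exists_supp_eq_compl U₂ hU₂
    have hP' : (⟨P, hP⟩ : Spc C) ∈ (U₁ : Set (Spc C))ᶜ ∪ (U₂ : Set (Spc C))ᶜ := by
      rw [← Set.compl_inter]
      exact ha hPa
    rcases hP' with hP' | hP'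
    · rw [← hb₁] at hP'
      exact hP' (hJ b₁ ⟨𝟙 _, rho_map_eq_zero_of_factor hb₁.subset (𝟙 _) (𝟙 _) (id_comp _),
        by rw [sub_self, Functor.map_zero]⟩)
    · rw [← hb₂] at hP'
      exact hP' (hJ b₂ ⟨0, Functor.map_zero _ _ _,
        rho_map_eq_zero_of_factor hb₂.subset (𝟙 _) (𝟙 _) (by rw [id_comp, sub_zero])⟩)
  have he : e ≫ (𝟙 a - e) = 0 := comp_eq_zero_of_rho_map_eq_zero hU h₁ h₂
  have hi : e ≫ e = e := by
    rw [Preadditive.comp_sub, comp_id, sub_eq_zero] at he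
    exact he.symm
  obtain ⟨c₁, i₁, r₁, hir₁, hri₁⟩ := IsIdempotentComplete.idempotents_split a e hi
  obtain ⟨c₂, i₂, r₂, hir₂, hri₂⟩ := IsIdempotentComplete.idempotents_split a _
    (idem_of_id_sub_idem e hi)
  have h₁₂ : i₁ ≫ r₂ = 0 := by
    have : i₁ ≫ r₂ = (i₁ ≫ e) ≫ (𝟙 a - e) ≫ r₂ := by
      rw [← hri₁, ← assoc i₁, hir₁, id_comp, hri₁, ← hri₂, assoc, hir₂, comp_id]
    rw [this, assoc, reassoc_of% he, zero_comp, comp_zero]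
  have h₂₁ : i₂ ≫ r₁ = 0 := by
    have he' : (𝟙 a - e) ≫ e = 0 := by rw [Preadditive.sub_comp, id_comp, hi, sub_self]
    have : i₂ ≫ r₁ = (i₂ ≫ (𝟙 a - e)) ≫ e ≫ r₁ := by
      rw [← hri₂, ← assoc i₂, hir₂, id_comp, ← hri₁, assoc, hir₁, comp_id]
    rw [this, assoc, reassoc_of% he', zero_comp, comp_zero]
  refine ⟨c₁, c₂, supportedOn_of_rho_map_id_eq_zero ?_, supportedOn_of_rho_map_id_eq_zero ?_,
    ⟨⟨biprod.lift r₁ r₂, biprod.desc i₁ i₂, ?_, ?_⟩⟩⟩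
  · have : 𝟙 c₁ = i₁ ≫ e ≫ r₁ := by rw [← hri₁, assoc, hir₁, comp_id, hir₁]
    rw [this, Functor.map_comp, Functor.map_comp, h₁, zero_comp, comp_zero]
  · have : 𝟙 c₂ = i₂ ≫ (𝟙 a - e) ≫ r₂ := by rw [← hri₂, assoc, hir₂, comp_id, hir₂]
    rw [this, Functor.map_comp, Functor.map_comp, h₂, zero_comp, comp_zero]
  · rw [biprod.lift_desc, hri₁, hri₂, add_sub_cancel]
  · ext <;> simp [hir₁, hir₂, h₁₂, h₂₁]

end Decomposition

end TTGlue

namespace TTGlue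

/-! ### Orthogonality applied to cones: diagonal maps and lifting -/

section Supports

variable {C : Type u} [Category.{v} C] [HasZeroObject C] [HasShift C ℤ] [Preadditive C]
  [∀ n : ℤ, (shiftFunctor C n).Additive] [Pretriangulated C] [MonoidalCategory C]
  {U₁ U₂ : TopologicalSpace.Opens (Spc C)} {a b x : C}

theorem supportedOn_biprod {c₁ c₂ : C} (h₁ : supportedOn (U₁ : Set (Spc C))ᶜ c₁)
    (h₂ : supportedOn (U₂ : Set (Spc C))ᶜ c₂) :
    supportedOn ((U₁ ⊓ U₂ : TopologicalSpace.Opens (Spc C)) : Set (Spc C))ᶜ (c₁ ⊞ c₂) := by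
  intro P hP hPU
  rcases (mem_supp_biprod c₁ c₂ P).1 hP with h | h
  · exact h₁ h hPU.1
  · exact h₂ h hPU.2

theorem uW_mono {U V : TopologicalSpace.Opens (Spc C)} (h : U ≤ V) {s : a ⟶ b} (hs : uW V s) :
    uW U s :=
  ObjectProperty.trW_monotone (supportedOn_mono (Set.compl_subset_compl.2 h)) s hs

variable [SymmetricCategory C] [TensorTriangulated C] [MonoidalClosed C] [StronglyClosed C]
  (hU : U₁ ⊔ U₂ = ⊤)

include hU

/-- Refining the denominator induces a map of split cones whose off-diagonal entries vanish, so the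
components through Z₁ are compared separately. This is the independence of choices behind ∂. -/
theorem comp_eq_comp_shift_of_distTriang {y c₁ c₂ c₁' c₂' : C} {s : x ⟶ a} {r : y ⟶ x}
    {α : a ⟶ c₁} {β : a ⟶ c₂} {γ : c₁ ⟶ x⟦(1 : ℤ)⟧} {δ : c₂ ⟶ x⟦(1 : ℤ)⟧}
    {α' : a ⟶ c₁'} {β' : a ⟶ c₂'} {γ' : c₁' ⟶ y⟦(1 : ℤ)⟧} {δ' : c₂' ⟶ y⟦(1 : ℤ)⟧}
    (hT : Triangle.mk s (biprod.lift α β) (biprod.desc γ δ) ∈ distTriang C)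
    (hT' : Triangle.mk (r ≫ s) (biprod.lift α' β') (biprod.desc γ' δ') ∈ distTriang C)
    (h₁ : supportedOn (U₁ : Set (Spc C))ᶜ c₁) (h₂ : supportedOn (U₂ : Set (Spc C))ᶜ c₂)
    (h₁' : supportedOn (U₁ : Set (Spc C))ᶜ c₁') (h₂' : supportedOn (U₂ : Set (Spc C))ᶜ c₂') :
    α ≫ γ = α' ≫ γ' ≫ r⟦(1 : ℤ)⟧' := by
  obtain ⟨φ, hφ₁, hφ₂⟩ : ∃ φ : c₁' ⊞ c₂' ⟶ c₁ ⊞ c₂,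
      biprod.lift α' β' ≫ φ = biprod.lift α β ∧
        biprod.desc γ' δ' ≫ r⟦(1 : ℤ)⟧' = φ ≫ biprod.desc γ δ := by
    obtain ⟨φ, h₁, h₂⟩ := complete_distinguished_triangle_morphism _ _ hT' hT r (𝟙 a) (comp_id _)
    exact ⟨φ, h₁.trans (id_comp _), h₂⟩
  have h₂₁ : biprod.inr ≫ φ ≫ biprod.fst = 0 :=
    eq_zero_of_supportedOn (sup_comm U₁ U₂ ▸ hU) h₂' h₁ _
  have h₁₂ : biprod.inl ≫ φ ≫ biprod.snd = 0 := eq_zero_of_supportedOn hU h₁' h₂ _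
  have e₁ : α' ≫ biprod.inl ≫ φ ≫ biprod.fst = α := by
    have := hφ₁ =≫ biprod.fst
    rwa [biprod.lift_fst, biprod.lift_eq, Preadditive.add_comp, Preadditive.add_comp, assoc, assoc,
      assoc, assoc, h₂₁, comp_zero, add_zero] at this
  have e₂ : (biprod.inl ≫ φ ≫ biprod.fst) ≫ γ = γ' ≫ r⟦(1 : ℤ)⟧' := by
    have := biprod.inl ≫= hφ₂
    rw [biprod.inl_desc_assoc, biprod.desc_eq, Preadditive.comp_add, Preadditive.comp_add] at this
    simp only [assoc] at h₁₂ ⊢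
    rw [this, reassoc_of% h₁₂, zero_comp, add_zero]
  rw [← e₁, ← e₂]
  simp only [assoc]

/-- U₁-isomorphisms lift against U₂-isomorphisms: the obstruction is a map from the cone of `s` to
the cone of `t`. -/
theorem exists_gluing_of_comm {x₁ y : C} {s : x₁ ⟶ a} {t : b ⟶ y} (hs : uW U₁ s) (ht : uW U₂ t)
    {f₁ : x₁ ⟶ b} {f₂ : a ⟶ y} (h : f₁ ≫ t = s ≫ f₂) : ∃ k : a ⟶ b, s ≫ k = f₁ ∧ k ≫ t = f₂ := by
  have hs' := hs
  have ht' := ht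
  obtain ⟨c₁, p₁, q₁, hT₁, hc₁⟩ := hs
  obtain ⟨c₂, p₂, q₂, hT₂, hc₂⟩ := ht
  obtain ⟨e₁, m₁, n₁, hE₁, he₁⟩ := (ObjectProperty.trW_iff' _ s).1 hs'
  obtain ⟨e₂, m₂, n₂, hE₂, he₂⟩ := (ObjectProperty.trW_iff' _ t).1 ht'
  obtain ⟨v, hv⟩ := distTriang_yoneda₂ hT₁ (f₂ ≫ p₂) (by
    rw [← assoc, ← h, assoc, distTriang_comp₁₂ hT₂, comp_zero])
  rw [eq_zero_of_supportedOn hU hc₁ hc₂ v, comp_zero] at hv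
  obtain ⟨k, hk⟩ := distTriang_coyoneda₂ hT₂ f₂ hv
  -- The first lift is correct only after `t`. Its error on `x₁` factors through the fibre of `t`
  -- and, by orthogonality with the fibre of `s`, extends along `s`; subtracting this extension
  -- corrects `k`.
  obtain ⟨w, hw⟩ := distTriang_coyoneda₂ hE₂ (s ≫ k - f₁) (by
    rw [Preadditive.sub_comp, assoc, ← hk, h, sub_self])
  obtain ⟨w', hw'⟩ := distTriang_yoneda₂ hE₁ w (eq_zero_of_supportedOn hU he₁ he₂ _)
  refine ⟨k - w' ≫ m₂, ?_, ?_⟩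
  · rw [Preadditive.comp_sub, ← assoc, ← hw', ← hw, sub_sub_cancel]
  · rw [Preadditive.sub_comp, assoc, distTriang_comp₁₂ hE₂, comp_zero, sub_zero, hk]

end Supports

/-! ### The connecting homomorphism and gluing of morphisms -/

section Connecting

variable {C : Type u} [Category.{v} C] [HasZeroObject C] [HasShift C ℤ] [Preadditive C]
  [∀ n : ℤ, (shiftFunctor C n).Additive] [Pretriangulated C] [IsTriangulated C]
  [MonoidalCategory C] [SymmetricCategory C] [TensorTriangulated C]
  {U₁ U₂ : TopologicalSpace.Opens (Spc C)} {a b c x : C}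

theorem IsConnecting.rho_map_eq_zero_left {g : Mor (U₁ ⊓ U₂) a b} {d : a ⟶ b⟦(1 : ℤ)⟧}
    (H : IsConnecting U₁ U₂ g d) : (rho U₁).map d = 0 := by
  obtain ⟨x, c₁, c₂, s, f, α, β, γ, δ, hs, hf, h₁, h₂, hT, rfl⟩ := H
  exact rho_map_eq_zero_of_factor h₁ α _ rfl

/-- Consecutive maps of a triangle compose to zero, so `α ≫ γ = -(β ≫ δ)` and `d` factors through
`c₂` as well. -/
theorem IsConnecting.rho_map_eq_zero_right {g : Mor (U₁ ⊓ U₂) a b} {d : a ⟶ b⟦(1 : ℤ)⟧}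
    (H : IsConnecting U₁ U₂ g d) : (rho U₂).map d = 0 := by
  obtain ⟨x, c₁, c₂, s, f, α, β, γ, δ, hs, hf, h₁, h₂, hT, rfl⟩ := H
  refine rho_map_eq_zero_of_factor h₂ β (-(δ ≫ f⟦(1 : ℤ)⟧')) ?_
  have h0 := distTriang_comp₂₃ hT
  rw [biprod.lift_desc, add_eq_zero_iff_eq_neg] at h0
  rw [reassoc_of% h0, Preadditive.comp_neg, Preadditive.neg_comp, assoc]

/-- The two factorizations of `h`, through `c₁` and `c₂`, have zero difference on `a`. The fibre of
`a ⟶ c₁ ⊞ c₂` is the denominator of the fraction, and the difference map on the sum extends to its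
numerator. -/
theorem exists_isConnecting {h : a ⟶ b⟦(1 : ℤ)⟧} (h₁ : (rho U₁).map h = 0)
    (h₂ : (rho U₂).map h = 0) : ∃ g : Mor (U₁ ⊓ U₂) a b, IsConnecting U₁ U₂ g h := by
  obtain ⟨c₁, α, p₁, hc₁, hp₁⟩ := exists_factor_of_rho_map_eq_zero h₁
  obtain ⟨c₂, β, p₂, hc₂, hp₂⟩ := exists_factor_of_rho_map_eq_zero h₂
  obtain ⟨x, s, k, hT⟩ := distinguished_cocone_triangle₁ (biprod.lift α β)
  have hk : biprod.desc (biprod.inl ≫ k) (biprod.inr ≫ k) = k := by ext <;> simp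
  obtain ⟨v, hv⟩ := distTriang_yoneda₃ hT (biprod.desc p₁ (-p₂)) (by
    rw [biprod.lift_desc, hp₁, Preadditive.comp_neg, hp₂, add_neg_cancel])
  obtain ⟨f, rfl⟩ := (shiftFunctor C (1 : ℤ)).map_surjective v
  have hs : uW (U₁ ⊓ U₂) s := ⟨_, _, _, hT, supportedOn_biprod hc₁ hc₂⟩
  have := isIso_rho_map hs
  refine ⟨inv ((rho (U₁ ⊓ U₂)).map s) ≫ (rho (U₁ ⊓ U₂)).map f, x, c₁, c₂, s, f, α, β, _, _, this,
    IsIso.hom_inv_id_assoc _ _, hc₁, hc₂, hk.symm ▸ hT, ?_⟩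
  rw [assoc, ← hv, biprod.inl_desc, hp₁]

theorem resMor_fraction {U V : TopologicalSpace.Opens (Spc C)} (h : U ≤ V) {s : x ⟶ a} {f : x ⟶ b}
    {g : Mor V a b} (hg : (rho V).map s ≫ g = (rho V).map f) :
    (rho U).map s ≫ resMor h a b g = (rho U).map f := by
  rw [← resMor_rho_map h s, ← resMor_comp, hg, resMor_rho_map]

/-- Factor the denominator both ways, with cone `c₁` for `s₁` and `c₂` for `t₂`. The numerator
becomes `s₂ ≫ f₁ + t₁ ≫ f₂ + s ≫ k`, so `g` is a fraction over U₁, plus one over U₂, plus the global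
morphism `k`. -/
theorem IsConnecting.exists_of_zero {g : Mor (U₁ ⊓ U₂) a b} (H : IsConnecting U₁ U₂ g 0) :
    ∃ (g₁ : Mor U₁ a b) (g₂ : Mor U₂ a b),
      resMor inf_le_left a b g₁ - resMor inf_le_right a b g₂ = g := by
  obtain ⟨x, c₁, c₂, s, f, α, β, γ, δ, hs, hf, h₁, h₂, hT, h0⟩ := H
  obtain ⟨x₁, s₂, s₁, ε₁, hs₁, hT₁, hγ₁, hδ₁, -⟩ := exists_factor_of_distTriang_biprod hT
  obtain ⟨x₂, t₁, t₂, ε₂, ht₁, hT₂, hδ₂, hγ₂, -⟩ :=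
    exists_factor_of_distTriang_biprod (distTriang_biprod_swap hT)
  obtain ⟨f₁, hf₁⟩ : ∃ f₁ : x₁ ⟶ b, γ ≫ f⟦(1 : ℤ)⟧' = ε₁ ≫ f₁⟦(1 : ℤ)⟧' := by
    obtain ⟨v, hv⟩ := distTriang_yoneda₃ hT₁ (γ ≫ f⟦(1 : ℤ)⟧') h0.symm
    obtain ⟨f₁, rfl⟩ := (shiftFunctor C (1 : ℤ)).map_surjective v
    exact ⟨f₁, hv⟩
  have hγ' : γ ≫ (f - s₂ ≫ f₁)⟦(1 : ℤ)⟧' = 0 := by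
    rw [Functor.map_sub, Functor.map_comp, Preadditive.comp_sub, reassoc_of% hγ₁, hf₁, sub_self]
  obtain ⟨f₂, hf₂⟩ : ∃ f₂ : x₂ ⟶ b, δ ≫ (f - s₂ ≫ f₁)⟦(1 : ℤ)⟧' = ε₂ ≫ f₂⟦(1 : ℤ)⟧' := by
    obtain ⟨v, hv⟩ := distTriang_yoneda₃ hT₂ (δ ≫ (f - s₂ ≫ f₁)⟦(1 : ℤ)⟧') (by
      have h0 := distTriang_comp₂₃ hT
      rw [biprod.lift_desc, add_comm, add_eq_zero_iff_eq_neg] at h0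
      rw [reassoc_of% h0, Preadditive.neg_comp, assoc, hγ', comp_zero, neg_zero])
    obtain ⟨f₂, rfl⟩ := (shiftFunctor C (1 : ℤ)).map_surjective v
    exact ⟨f₂, hv⟩
  obtain ⟨k, hk⟩ : ∃ k : a ⟶ b, f - s₂ ≫ f₁ - t₁ ≫ f₂ = s ≫ k := by
    obtain ⟨v, hv⟩ := distTriang_yoneda₂ (distTriang_rotate (distTriang_rotate hT))
      ((f - s₂ ≫ f₁ - t₁ ≫ f₂)⟦(1 : ℤ)⟧') (by
        rw [(shiftFunctor C (1 : ℤ)).map_sub (f := f - s₂ ≫ f₁), Functor.map_comp _ t₁]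
        ext
        · rw [biprod.inl_desc_assoc, Preadditive.comp_sub, hγ', reassoc_of% hγ₂, zero_comp,
            sub_zero, comp_zero]
        · rw [biprod.inr_desc_assoc, Preadditive.comp_sub, hf₂, reassoc_of% hδ₂, sub_self,
            comp_zero])
    obtain ⟨k, rfl⟩ := (shiftFunctor C (1 : ℤ)).map_surjective v
    -- The sign undoes the one on the suspension of `s` in the rotated triangle.
    refine ⟨-k, (shiftFunctor C (1 : ℤ)).map_injective ?_⟩
    rw [hv, Functor.map_comp, Functor.map_neg, Preadditive.comp_neg, Preadditive.neg_comp]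
  have := isIso_rho_map (U := U₁) ⟨_, _, _, hT₁, h₁⟩
  have := isIso_rho_map (U := U₂) ⟨_, _, _, hT₂, h₂⟩
  have : IsIso ((rho (U₁ ⊓ U₂)).map s) := hs
  refine ⟨inv ((rho U₁).map s₁) ≫ (rho U₁).map f₁ + (rho U₁).map k,
    -(inv ((rho U₂).map t₂) ≫ (rho U₂).map f₂), ?_⟩
  rw [← cancel_epi ((rho (U₁ ⊓ U₂)).map s), hf, map_add, map_neg, resMor_rho_map, sub_neg_eq_add,
    Preadditive.comp_add, Preadditive.comp_add]
  have e₁ := resMor_fraction (inf_le_left : U₁ ⊓ U₂ ≤ U₁) (s := s₁) (f := f₁)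
    (IsIso.hom_inv_id_assoc ((rho U₁).map s₁) ((rho U₁).map f₁))
  have e₂ := resMor_fraction (inf_le_right : U₁ ⊓ U₂ ≤ U₂) (s := t₂) (f := f₂)
    (IsIso.hom_inv_id_assoc ((rho U₂).map t₂) ((rho U₂).map f₂))
  have e₃ : f = s₂ ≫ f₁ + s ≫ k + t₁ ≫ f₂ := by rw [← hk]; abel
  rw [e₃, Functor.map_add, Functor.map_add, Functor.map_comp _ s₂, Functor.map_comp _ t₁, ← e₁,
    ← e₂, ← Functor.map_comp_assoc, ← Functor.map_comp_assoc, hs₁, ht₁, Functor.map_comp]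

variable [MonoidalClosed C] [StronglyClosed C] (hU : U₁ ⊔ U₂ = ⊤)

include hU

variable [IsIdempotentComplete C]
  (hU₁ : IsCompact (U₁ : Set (Spc C))) (hU₂ : IsCompact (U₂ : Set (Spc C)))

include hU₁ hU₂

theorem exists_distTriang_biprod {s : x ⟶ a} (hs : uW (U₁ ⊓ U₂) s) :
    ∃ (c₁ c₂ : C) (α : a ⟶ c₁) (β : a ⟶ c₂) (γ : c₁ ⟶ x⟦(1 : ℤ)⟧) (δ : c₂ ⟶ x⟦(1 : ℤ)⟧),
      supportedOn (U₁ : Set (Spc C))ᶜ c₁ ∧ supportedOn (U₂ : Set (Spc C))ᶜ c₂ ∧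
      Triangle.mk s (biprod.lift α β) (biprod.desc γ δ) ∈ distTriang C := by
  obtain ⟨c, p, q, hT, hc⟩ := hs
  obtain ⟨c₁, c₂, h₁, h₂, ⟨e⟩⟩ := exists_iso_biprod_of_supportedOn hU hU₁ hU₂ hc
  refine ⟨c₁, c₂, p ≫ e.hom ≫ biprod.fst, p ≫ e.hom ≫ biprod.snd, biprod.inl ≫ e.inv ≫ q,
    biprod.inr ≫ e.inv ≫ q, h₁, h₂, distTriang_of_iso hT (Iso.refl _) (Iso.refl _) e.symm
    (by simp) ?_ ?_⟩
  · rw [Iso.symm_hom, Iso.comp_inv_eq, Iso.refl_hom, id_comp]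
    ext <;> simp
  · ext <;> simp

theorem isConnecting_exists (g : Mor (U₁ ⊓ U₂) a b) : ∃ d, IsConnecting U₁ U₂ g d := by
  obtain ⟨x, s, f, hs, hf⟩ := exists_right_fraction g
  obtain ⟨c₁, c₂, α, β, γ, δ, h₁, h₂, hT⟩ := exists_distTriang_biprod hU hU₁ hU₂ hs
  exact ⟨_, x, c₁, c₂, s, f, α, β, γ, δ, isIso_rho_map hs, hf, h₁, h₂, hT, rfl⟩

/-- The connecting morphism can be computed with any representation as a fraction and any
decomposition of the cone. -/
theorem IsConnecting.eq {g : Mor (U₁ ⊓ U₂) a b} {d : a ⟶ b⟦(1 : ℤ)⟧} (H : IsConnecting U₁ U₂ g d)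
    {s : x ⟶ a} {f : x ⟶ b} (hs : uW (U₁ ⊓ U₂) s)
    (hf : (rho (U₁ ⊓ U₂)).map s ≫ g = (rho (U₁ ⊓ U₂)).map f) {c₁ c₂ : C}
    {α : a ⟶ c₁} {β : a ⟶ c₂} {γ : c₁ ⟶ x⟦(1 : ℤ)⟧} {δ : c₂ ⟶ x⟦(1 : ℤ)⟧}
    (h₁ : supportedOn (U₁ : Set (Spc C))ᶜ c₁) (h₂ : supportedOn (U₂ : Set (Spc C))ᶜ c₂)
    (hT : Triangle.mk s (biprod.lift α β) (biprod.desc γ δ) ∈ distTriang C) :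
    d = α ≫ γ ≫ f⟦(1 : ℤ)⟧' := by
  obtain ⟨x', c₁', c₂', s', f', α', β', γ', δ', hs', hf', h₁', h₂', hT', rfl⟩ := H
  -- Both constructions are compared with one over a common refinement.
  obtain ⟨z, p, q, hp, hq, hpq, hpq'⟩ := exists_common_refinement hs (isUIso_iff.1 hs') hf hf'
  obtain ⟨e₁, e₂, α'', β'', γ'', δ'', he₁, he₂, hT''⟩ :=
    exists_distTriang_biprod hU hU₁ hU₂ ((uW _).comp_mem _ _ hp hs)
  have E₁ := comp_eq_comp_shift_of_distTriang hU hT hT'' h₁ h₂ he₁ he₂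
  have E₂ := comp_eq_comp_shift_of_distTriang hU hT' (hpq ▸ hT'') h₁' h₂' he₁ he₂
  rw [← assoc α, ← assoc α', E₁, E₂]
  simp only [assoc, ← Functor.map_comp, hpq']

theorem IsConnecting.unique {g : Mor (U₁ ⊓ U₂) a b} {d d' : a ⟶ b⟦(1 : ℤ)⟧}
    (H : IsConnecting U₁ U₂ g d) (H' : IsConnecting U₁ U₂ g d') : d = d' := by
  obtain ⟨x', c₁', c₂', s', f', α', β', γ', δ', hs', hf', h₁', h₂', hT', rfl⟩ := H'
  exact H.eq hU hU₁ hU₂ (isUIso_iff.1 hs') hf' h₁' h₂' hT'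

theorem exists_connecting_hom (a b : C) : ∃ D : Mor (U₁ ⊓ U₂) a b →+ (a ⟶ b⟦(1 : ℤ)⟧),
    ∀ g d, D g = d ↔ IsConnecting U₁ U₂ g d := by
  choose D hD using fun g => isConnecting_exists (a := a) (b := b) hU hU₁ hU₂ g
  refine ⟨AddMonoidHom.mk' D fun g g' => ?_, fun g d =>
    ⟨fun h => h ▸ hD g, fun h => (hD g).unique hU hU₁ hU₂ h⟩⟩
  obtain ⟨x, s, f, f', hs, hf, hf'⟩ := exists_common_denominator g g'
  obtain ⟨c₁, c₂, α, β, γ, δ, h₁, h₂, hT⟩ := exists_distTriang_biprod hU hU₁ hU₂ hs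
  rw [(hD g).eq hU hU₁ hU₂ hs hf h₁ h₂ hT, (hD g').eq hU hU₁ hU₂ hs hf' h₁ h₂ hT,
    (hD (g + g')).eq hU hU₁ hU₂ hs (f := f + f')
      (by rw [Preadditive.comp_add, hf, hf', Functor.map_add]) h₁ h₂ hT,
    Functor.map_add, Preadditive.comp_add, Preadditive.comp_add]

/-- A denominator defined over U₁ has its whole cone on Z₁, so `c₂` is zero and the triangle
relation kills `α ≫ γ`. -/
theorem isConnecting_resMor_left (g : Mor U₁ a b) :
    IsConnecting U₁ U₂ (resMor inf_le_left a b g) 0 := by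
  obtain ⟨x, s, f, hs, hf⟩ := exists_right_fraction g
  have hs' := uW_mono (inf_le_left : U₁ ⊓ U₂ ≤ U₁) hs
  obtain ⟨c₁, c₂, α, β, γ, δ, h₁, h₂, hT⟩ := exists_distTriang_biprod hU hU₁ hU₂ hs'
  refine ⟨x, c₁, c₂, s, f, α, β, γ, δ, isIso_rho_map hs', ?_, h₁, h₂, hT, ?_⟩
  · rw [← resMor_rho_map inf_le_left s, ← resMor_comp, hf, resMor_rho_map]
  · have hc : supportedOn (U₁ : Set (Spc C))ᶜ c₂ := supportedOn_of_retract biprod.inr biprod.snd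
      (by simp) (((supportedOn (U₁ : Set (Spc C))ᶜ).trW_iff_of_distinguished _ hT).1 hs)
    have hβ : β = 0 := by rw [← comp_id β, eq_zero_of_supportedOn hU hc h₂ (𝟙 c₂), comp_zero]
    have h0 := distTriang_comp₂₃ hT
    rw [biprod.lift_desc, hβ, zero_comp, add_zero] at h0
    rw [reassoc_of% h0, zero_comp]

theorem isConnecting_resMor_right (g : Mor U₂ a b) :
    IsConnecting U₁ U₂ (resMor inf_le_right a b g) 0 := by
  obtain ⟨x, s, f, hs, hf⟩ := exists_right_fraction g
  have hs' := uW_mono (inf_le_right : U₁ ⊓ U₂ ≤ U₂) hs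
  obtain ⟨c₁, c₂, α, β, γ, δ, h₁, h₂, hT⟩ := exists_distTriang_biprod hU hU₁ hU₂ hs'
  refine ⟨x, c₁, c₂, s, f, α, β, γ, δ, isIso_rho_map hs', ?_, h₁, h₂, hT, ?_⟩
  · rw [← resMor_rho_map inf_le_right s, ← resMor_comp, hf, resMor_rho_map]
  · have hc : supportedOn (U₂ : Set (Spc C))ᶜ c₁ := supportedOn_of_retract biprod.inl biprod.fst
      (by simp) (((supportedOn (U₂ : Set (Spc C))ᶜ).trW_iff_of_distinguished _ hT).1 hs)
    rw [← comp_id α, eq_zero_of_supportedOn hU h₁ hc (𝟙 c₁), comp_zero, zero_comp]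

/-- Gluing of morphisms. -/
theorem exists_rho_map_eq {g₁ : Mor U₁ a b} {g₂ : Mor U₂ a b}
    (h : resMor inf_le_left a b g₁ = resMor inf_le_right a b g₂) :
    ∃ k : a ⟶ b, (rho U₁).map k = g₁ ∧ (rho U₂).map k = g₂ := by
  obtain ⟨x, s, f₁, hs, hf₁⟩ := exists_right_fraction g₁
  -- A right fraction over U₁ against a left fraction over U₂ turns gluing into the lifting problem
  -- of `exists_gluing_of_comm`.
  obtain ⟨y, t, f₂, ht, hf₂⟩ := exists_left_fraction g₂
  have h0 : (rho (U₁ ⊓ U₂)).map (f₁ ≫ t - s ≫ f₂) = 0 := by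
    rw [Functor.map_sub, Functor.map_comp, Functor.map_comp, ← resMor_fraction inf_le_left hf₁, h,
      ← resMor_rho_map inf_le_right t, assoc, ← resMor_comp, hf₂, resMor_rho_map, sub_self]
  obtain ⟨c, i, p, hc, hip⟩ := exists_factor_of_rho_map_eq_zero h0
  obtain ⟨c₁, c₂, hc₁, hc₂, ⟨e⟩⟩ := exists_iso_biprod_of_supportedOn hU hU₁ hU₂ hc
  -- The square commutes only over U₁₂. Its defect through `c₁` is killed by a further
  -- U₁-isomorphism at the source, that through `c₂` by a further U₂-isomorphism at the target.
  obtain ⟨x', r, m, hT₁⟩ := distinguished_cocone_triangle₁ (i ≫ e.hom ≫ biprod.fst)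
  obtain ⟨y', q, n, hT₂⟩ := distinguished_cocone_triangle (biprod.inr ≫ e.inv ≫ p)
  have hr : uW U₁ r := ⟨_, _, _, hT₁, hc₁⟩
  have hq : uW U₂ q := ObjectProperty.trW.mk' _ hT₂ hc₂
  have hr0 := distTriang_comp₁₂ hT₁
  have hq0 := distTriang_comp₁₂ hT₂
  have key : (r ≫ f₁) ≫ t ≫ q = (r ≫ s) ≫ f₂ ≫ q := by
    have h1 : r ≫ (f₁ ≫ t - s ≫ f₂) ≫ q = 0 := by
      have : f₁ ≫ t - s ≫ f₂ = (i ≫ e.hom ≫ biprod.fst) ≫ biprod.inl ≫ e.inv ≫ p +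
          i ≫ e.hom ≫ biprod.snd ≫ biprod.inr ≫ e.inv ≫ p := by
        rw [← hip, assoc, assoc, ← Preadditive.comp_add, ← Preadditive.comp_add, ← assoc biprod.fst,
          ← assoc biprod.snd, ← Preadditive.add_comp, biprod.total, id_comp, Iso.hom_inv_id_assoc]
      simp only [assoc] at hq0
      rw [this, Preadditive.add_comp, Preadditive.comp_add, ← assoc r, ← assoc r, hr0, zero_comp,
        zero_comp, zero_add]
      simp only [assoc, hq0, comp_zero]
    rw [Preadditive.sub_comp, Preadditive.comp_sub, sub_eq_zero] at h1
    simpa only [assoc] using h1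
  obtain ⟨k, hk₁, hk₂⟩ := exists_gluing_of_comm hU ((uW U₁).comp_mem _ _ hr hs)
    ((uW U₂).comp_mem _ _ ht hq) key
  have i₁ := isIso_rho_map ((uW U₁).comp_mem _ _ hr hs)
  have i₂ := isIso_rho_map ((uW U₂).comp_mem _ _ ht hq)
  refine ⟨k, ?_, ?_⟩
  · rw [← cancel_epi ((rho U₁).map (r ≫ s)), ← Functor.map_comp, hk₁, Functor.map_comp,
      Functor.map_comp, assoc, hf₁]
  · rw [← cancel_mono ((rho U₂).map (t ≫ q)), ← Functor.map_comp, hk₂, Functor.map_comp,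
      Functor.map_comp, ← assoc, hf₂]

end Connecting

end TTGlue

namespace TTGlue

/-! ### Restricting morphisms between objects of K and objects of K(V) -/

section Mixed

variable {C : Type u} [Category.{v} C] [HasZeroObject C] [HasShift C ℤ] [Preadditive C]
  [∀ n : ℤ, (shiftFunctor C n).Additive] [Pretriangulated C] [IsTriangulated C]
  [MonoidalCategory C] [SymmetricCategory C] [TensorTriangulated C]
  {U V : TopologicalSpace.Opens (Spc C)} (h : U ≤ V) {a b c : C} {P Q : KU V}

/-- The restriction to `U` of a morphism over `V` from an object of `K`. -/
noncomputable def resTo (p : (rho V).obj a ⟶ P) : (rho U).obj a ⟶ (res h).obj P :=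
  (resComp h).inv.app a ≫ (res h).map p

/-- The restriction to `U` of a morphism over `V` to an object of `K`. -/
noncomputable def resFrom (q : P ⟶ (rho V).obj a) : (res h).obj P ⟶ (rho U).obj a :=
  (res h).map q ≫ (resComp h).hom.app a

theorem resMor_comp_resTo (g : Mor V a b) (p : (rho V).obj b ⟶ P) :
    resMor h a b g ≫ resTo h p = resTo h (g ≫ p) := by
  simp only [resMor_apply, resTo, assoc, Functor.map_comp, Iso.hom_inv_id_app_assoc]

theorem rho_map_comp_resTo (f : a ⟶ b) (p : (rho V).obj b ⟶ P) :
    (rho U).map f ≫ resTo h p = resTo h ((rho V).map f ≫ p) := by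
  rw [← resMor_rho_map h, resMor_comp_resTo]

theorem resTo_comp_map (p : (rho V).obj a ⟶ P) (g : P ⟶ Q) :
    resTo h p ≫ (res h).map g = resTo h (p ≫ g) := by
  simp only [resTo, assoc, Functor.map_comp]

theorem resTo_comp_resFrom (p : (rho V).obj a ⟶ P) (q : P ⟶ (rho V).obj b) :
    resTo h p ≫ resFrom h q = resMor h a b (p ≫ q) := by
  simp only [resMor_apply, resTo, resFrom, assoc, Functor.map_comp]

theorem resFrom_comp_resMor (q : P ⟶ (rho V).obj a) (g : Mor V a b) :
    resFrom h q ≫ resMor h a b g = resFrom h (q ≫ g) := by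
  simp only [resMor_apply, resFrom, assoc, Functor.map_comp, Iso.hom_inv_id_app_assoc]

theorem resFrom_comp_rho_map (q : P ⟶ (rho V).obj a) (f : a ⟶ b) :
    resFrom h q ≫ (rho U).map f = resFrom h (q ≫ (rho V).map f) := by
  rw [← resMor_rho_map h, resFrom_comp_resMor]

theorem resFrom_comp_resTo (q : P ⟶ (rho V).obj a) (p : (rho V).obj a ⟶ Q) :
    resFrom h q ≫ resTo h p = (res h).map (q ≫ p) := by
  simp only [resTo, resFrom, assoc, Functor.map_comp, Iso.hom_inv_id_app_assoc]

instance (p : (rho V).obj a ⟶ P) [IsIso p] : IsIso (resTo h p) := by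
  unfold resTo; infer_instance

end Mixed

/-! ### Gluing objects of K by weak push-outs, and uniqueness of gluings -/

section Gluing

variable {C : Type u} [Category.{v} C] [HasZeroObject C] [HasShift C ℤ] [Preadditive C]
  [∀ n : ℤ, (shiftFunctor C n).Additive] [Pretriangulated C] [IsTriangulated C]
  [MonoidalCategory C] [SymmetricCategory C] [TensorTriangulated C]
  {U₁ U₂ : TopologicalSpace.Opens (Spc C)}

theorem IsGluing.of_iso {a₁ : KU U₁} {a₂ : KU U₂}
    {σ : (res (inf_le_left : U₁ ⊓ U₂ ≤ U₁)).obj a₁ ≅ (res (inf_le_right : U₁ ⊓ U₂ ≤ U₂)).obj a₂}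
    {p q : C} (hp : IsGluing U₁ U₂ σ p) (e : p ≅ q) : IsGluing U₁ U₂ σ q := by
  obtain ⟨f₁, f₂, H⟩ := hp
  refine ⟨(rho U₁).mapIso e.symm ≪≫ f₁, (rho U₂).mapIso e.symm ≪≫ f₂, ?_⟩
  rw [← assoc] at H ⊢
  change resTo _ ((rho U₁).map e.inv ≫ f₁.hom) ≫ σ.hom = resTo _ ((rho U₂).map e.inv ≫ f₂.hom)
  rw [← rho_map_comp_resTo, ← rho_map_comp_resTo, assoc]
  exact congrArg _ H

/-- Since parallel sides share cones, `u₁` is a U₁-isomorphism like `t₁` and `u₂` a U₂-isomorphism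
like `s₂`. Thus `p` is `y₁`, hence `x₁`, over U₁, and `y₂`, hence `x₂`, over U₂. -/
theorem isGluing_isWeakPushout {x y₁ y₂ x₁ x₂ p : C} {s₂ : x ⟶ y₁} {s₁ : y₁ ⟶ x₁} {t₁ : x ⟶ y₂}
    {t₂ : y₂ ⟶ x₂} {u₁ : y₁ ⟶ p} {u₂ : y₂ ⟶ p} (hs₁ : IsUIso U₁ s₁) (hs₂ : IsUIso U₂ s₂)
    (ht₁ : IsUIso U₁ t₁) (ht₂ : IsUIso U₂ t₂) (H : IsWeakPushout s₂ t₁ u₁ u₂)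
    {τ : Mor (U₁ ⊓ U₂) x₁ x₂}
    (hτ : (rho (U₁ ⊓ U₂)).map (s₂ ≫ s₁) ≫ τ = (rho (U₁ ⊓ U₂)).map (t₁ ≫ t₂)) :
    ∃ (f₁ : (rho U₁).obj p ≅ (rho U₁).obj x₁) (f₂ : (rho U₂).obj p ≅ (rho U₂).obj x₂),
      resMor inf_le_left p x₁ f₁.hom ≫ τ = resMor inf_le_right p x₂ f₂.hom := by
  have hu₁ : IsUIso U₁ u₁ := isUIso_iff.2 (H.trW_left (isUIso_iff.1 ht₁))
  have hu₂ : IsUIso U₂ u₂ := isUIso_iff.2 (H.trW_right (isUIso_iff.1 hs₂))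
  have : IsIso ((rho U₁).map u₁) := hu₁
  have : IsIso ((rho U₂).map u₂) := hu₂
  have : IsIso ((rho U₁).map s₁) := hs₁
  have : IsIso ((rho U₂).map t₂) := ht₂
  refine ⟨(asIso ((rho U₁).map u₁)).symm ≪≫ asIso ((rho U₁).map s₁),
    (asIso ((rho U₂).map u₂)).symm ≪≫ asIso ((rho U₂).map t₂), ?_⟩
  have : IsIso ((rho (U₁ ⊓ U₂)).map (s₂ ≫ u₁)) := by
    rw [Functor.map_comp]
    have := isIso_rho_map (uW_mono inf_le_left (isUIso_iff.1 hu₁) : uW (U₁ ⊓ U₂) u₁)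
    have := isIso_rho_map (uW_mono inf_le_right (isUIso_iff.1 hs₂) : uW (U₁ ⊓ U₂) s₂)
    infer_instance
  have e₁ : (rho (U₁ ⊓ U₂)).map u₁ ≫ resMor inf_le_left p x₁
      (inv ((rho U₁).map u₁) ≫ (rho U₁).map s₁) = (rho (U₁ ⊓ U₂)).map s₁ := by
    rw [← resMor_rho_map inf_le_left, ← resMor_comp, IsIso.hom_inv_id_assoc, resMor_rho_map]
  have e₂ : (rho (U₁ ⊓ U₂)).map u₂ ≫ resMor inf_le_right p x₂
      (inv ((rho U₂).map u₂) ≫ (rho U₂).map t₂) = (rho (U₁ ⊓ U₂)).map t₂ := by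
    rw [← resMor_rho_map inf_le_right, ← resMor_comp, IsIso.hom_inv_id_assoc, resMor_rho_map]
  rw [← cancel_epi ((rho (U₁ ⊓ U₂)).map (s₂ ≫ u₁))]
  change _ ≫ resMor inf_le_left p x₁ (inv ((rho U₁).map u₁) ≫ (rho U₁).map s₁) ≫ τ =
    _ ≫ resMor inf_le_right p x₂ (inv ((rho U₂).map u₂) ≫ (rho U₂).map t₂)
  conv_rhs => rw [H.1]
  rw [Functor.map_comp, Functor.map_comp, assoc, assoc, e₂, ← assoc ((rho (U₁ ⊓ U₂)).map u₁), e₁,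
    ← Functor.map_comp, ← hτ, Functor.map_comp, assoc]

variable [MonoidalClosed C] [StronglyClosed C] (hU : U₁ ⊔ U₂ = ⊤)

section
include hU

/-- The comparison isomorphisms over U₁ and U₂ agree on the overlap; any morphism gluing them is
invertible over both, hence invertible. -/
theorem IsGluing.nonempty_iso {a₁ : KU U₁} {a₂ : KU U₂}
    {σ : (res (inf_le_left : U₁ ⊓ U₂ ≤ U₁)).obj a₁ ≅ (res (inf_le_right : U₁ ⊓ U₂ ≤ U₂)).obj a₂}
    (hU₁ : IsCompact (U₁ : Set (Spc C))) (hU₂ : IsCompact (U₂ : Set (Spc C)))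
    [IsIdempotentComplete C]
    {p q : C} (hp : IsGluing U₁ U₂ σ p) (hq : IsGluing U₁ U₂ σ q) : Nonempty (p ≅ q) := by
  obtain ⟨f₁, f₂, H⟩ := hp
  obtain ⟨g₁, g₂, H'⟩ := hq
  rw [← assoc] at H H'
  change resTo _ f₁.hom ≫ σ.hom = resTo _ f₂.hom at H
  change resTo _ g₁.hom ≫ σ.hom = resTo _ g₂.hom at H'
  have e : resMor inf_le_left p q (f₁.hom ≫ g₁.inv) = resMor inf_le_right p q (f₂.hom ≫ g₂.inv) := by
    rw [← cancel_mono (resTo inf_le_right g₂.hom), resMor_comp_resTo, assoc, g₂.inv_hom_id, comp_id,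
      ← H, ← H', ← assoc, resMor_comp_resTo, assoc, g₁.inv_hom_id, comp_id]
  obtain ⟨k, h₁, h₂⟩ := exists_rho_map_eq hU hU₁ hU₂ e
  have : IsIso k := isIso_of_isUIso hU (by rw [IsUIso, h₁]; infer_instance)
    (by rw [IsUIso, h₂]; infer_instance)
  exact ⟨asIso k⟩

variable [IsIdempotentComplete C]
  (hU₁ : IsCompact (U₁ : Set (Spc C))) (hU₂ : IsCompact (U₂ : Set (Spc C)))
include hU₁ hU₂

theorem exists_factor_of_uW {x a : C} {s : x ⟶ a} (hs : uW (U₁ ⊓ U₂) s) :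
    ∃ (x₁ : C) (s₂ : x ⟶ x₁) (s₁ : x₁ ⟶ a), s₂ ≫ s₁ = s ∧ IsUIso U₁ s₁ ∧ IsUIso U₂ s₂ := by
  obtain ⟨c₁, c₂, α, β, γ, δ, h₁, h₂, hT⟩ := exists_distTriang_biprod hU hU₁ hU₂ hs
  obtain ⟨x₁, s₂, s₁, ε, e, hT', -, -, hP⟩ := exists_factor_of_distTriang_biprod hT
  exact ⟨x₁, s₂, s₁, e, isUIso_iff.2 ⟨_, _, _, hT', h₁⟩, isUIso_iff.2 (hP _ h₂)⟩

theorem exists_isWeakPushout_of_isIso {x₁ x₂ : C} (τ : Mor (U₁ ⊓ U₂) x₁ x₂) [IsIso τ] :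
    ∃ (p x y₁ y₂ : C) (s₂ : x ⟶ y₁) (s₁ : y₁ ⟶ x₁) (t₁ : x ⟶ y₂)
      (t₂ : y₂ ⟶ x₂) (u₁ : y₁ ⟶ p) (u₂ : y₂ ⟶ p), IsUIso U₁ s₁ ∧ IsUIso U₂ s₂ ∧
      IsUIso U₁ t₁ ∧ IsUIso U₂ t₂ ∧ IsUIso (U₁ ⊓ U₂) (s₂ ≫ s₁) ∧ IsUIso (U₁ ⊓ U₂) (t₁ ≫ t₂) ∧
      (rho (U₁ ⊓ U₂)).map (s₂ ≫ s₁) ≫ τ = (rho (U₁ ⊓ U₂)).map (t₁ ≫ t₂) ∧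
      IsWeakPushout s₂ t₁ u₁ u₂ := by
  obtain ⟨x, s, t, hs, e⟩ := exists_right_fraction τ
  have hsi := isIso_rho_map hs
  have ht : IsUIso (U₁ ⊓ U₂) t := by rw [IsUIso, ← e]; infer_instance
  obtain ⟨y₁, s₂, s₁, rfl, hs₁, hs₂⟩ := exists_factor_of_uW hU hU₁ hU₂ hs
  -- The numerator is factored with U₁ and U₂ interchanged, so that `t₁` is the U₁-isomorphism.
  have ht' : uW (U₂ ⊓ U₁) t := by rw [inf_comm]; exact isUIso_iff.1 ht
  obtain ⟨y₂, t₁, t₂, rfl, ht₂, ht₁⟩ := exists_factor_of_uW (by rw [sup_comm, hU]) hU₂ hU₁ ht'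
  obtain ⟨p, u₁, u₂, H⟩ := exists_isWeakPushout s₂ t₁
  exact ⟨p, x, y₁, y₂, s₂, s₁, t₁, t₂, u₁, u₂, hs₁, hs₂, ht₁, ht₂, hsi, ht, e, H⟩

theorem exists_gluing_of_isIso {x₁ x₂ : C} (τ : Mor (U₁ ⊓ U₂) x₁ x₂) [IsIso τ] :
    ∃ (p : C) (f₁ : (rho U₁).obj p ≅ (rho U₁).obj x₁) (f₂ : (rho U₂).obj p ≅ (rho U₂).obj x₂),
      resMor inf_le_left p x₁ f₁.hom ≫ τ = resMor inf_le_right p x₂ f₂.hom := by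
  obtain ⟨p, x, y₁, y₂, s₂, s₁, t₁, t₂, u₁, u₂, hs₁, hs₂, ht₁, ht₂, -, -, e, H⟩ :=
    exists_isWeakPushout_of_isIso hU hU₁ hU₂ τ
  exact ⟨p, isGluing_isWeakPushout hs₁ hs₂ ht₁ ht₂ H e⟩

end

end Gluing

end TTGlue

namespace TTGlue

/-! ### Gluing arbitrary objects of K(U₁) and K(U₂) through retracts -/

section Preadditive

variable {D : Type u} [Category.{v} D] [Preadditive D]

/-- An isomorphism `σ` between retracts `P₁`, `P₂` of `X₁`, `X₂` is induced by an automorphism of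
`X₁ ⊕ X₂`. -/
theorem exists_involution {X₁ X₂ S P₁ P₂ : D} {l₁ : X₁ ⟶ S} {l₂ : X₂ ⟶ S} {f₁ : S ⟶ X₁} {f₂ : S ⟶ X₂}
    (h₁₁ : l₁ ≫ f₁ = 𝟙 X₁) (h₂₂ : l₂ ≫ f₂ = 𝟙 X₂) (h₁₂ : l₁ ≫ f₂ = 0) (h₂₁ : l₂ ≫ f₁ = 0)
    (hS : f₁ ≫ l₁ + f₂ ≫ l₂ = 𝟙 S) {i₁ : P₁ ⟶ X₁} {r₁ : X₁ ⟶ P₁} {i₂ : P₂ ⟶ X₂} {r₂ : X₂ ⟶ P₂}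
    (e₁ : i₁ ≫ r₁ = 𝟙 P₁) (e₂ : i₂ ≫ r₂ = 𝟙 P₂) (σ : P₁ ≅ P₂) :
    ∃ τ : S ⟶ S, τ ≫ τ = 𝟙 S ∧ i₁ ≫ l₁ ≫ τ = σ.hom ≫ i₂ ≫ l₂ ∧
      τ ≫ f₂ ≫ r₂ = f₁ ≫ r₁ ≫ σ.hom := by
  have e₁' : ∀ {Z : D} (z : P₁ ⟶ Z), i₁ ≫ r₁ ≫ z = z := fun z => by
    rw [← assoc, e₁, id_comp]
  have e₂' : ∀ {Z : D} (z : P₂ ⟶ Z), i₂ ≫ r₂ ≫ z = z := fun z => by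
    rw [← assoc, e₂, id_comp]
  have h₁₁' : ∀ {Z : D} (z : X₁ ⟶ Z), l₁ ≫ f₁ ≫ z = z := fun z => by
    rw [← assoc, h₁₁, id_comp]
  have h₂₂' : ∀ {Z : D} (z : X₂ ⟶ Z), l₂ ≫ f₂ ≫ z = z := fun z => by
    rw [← assoc, h₂₂, id_comp]
  have h₁₂' : ∀ {Z : D} (z : X₂ ⟶ Z), l₁ ≫ f₂ ≫ z = 0 := fun z => by
    rw [← assoc, h₁₂, zero_comp]
  have h₂₁' : ∀ {Z : D} (z : X₁ ⟶ Z), l₂ ≫ f₁ ≫ z = 0 := fun z => by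
    rw [← assoc, h₂₁, zero_comp]
  -- Exchange the summands `P₁` and `P₂` by `σ` and its inverse, and be the identity on both
  -- complements.
  refine ⟨(f₁ ≫ l₁ - f₁ ≫ r₁ ≫ i₁ ≫ l₁) + f₁ ≫ r₁ ≫ σ.hom ≫ i₂ ≫ l₂ +
    (f₂ ≫ l₂ - f₂ ≫ r₂ ≫ i₂ ≫ l₂) + f₂ ≫ r₂ ≫ σ.inv ≫ i₁ ≫ l₁, ?_, ?_, ?_⟩
  · rw [← hS]
    simp only [Preadditive.add_comp, Preadditive.sub_comp, Preadditive.comp_add,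
      Preadditive.comp_sub, assoc, h₁₁', h₂₂', h₁₂', h₂₁', e₁', e₂', comp_zero, sub_zero, add_zero,
      zero_add, σ.hom_inv_id_assoc, σ.inv_hom_id_assoc]
    abel
  · simp only [Preadditive.comp_add, Preadditive.comp_sub, h₁₁', h₁₂', e₁', comp_zero]
    abel
  · simp only [Preadditive.add_comp, Preadditive.sub_comp, assoc, h₁₂', h₂₂', e₂,
      comp_zero, comp_id]
    abel

/-- Idempotents lift modulo a square-zero error: for `e' = 3e² - 2e³`, the difference `e'² - e'` is
a multiple of `(e² - e)²`. -/
theorem exists_idempotent_of_sq_eq_zero {X : D} (e : X ⟶ X)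
    (h : (e ≫ e - e) ≫ (e ≫ e - e) = 0) :
    ∃ e' : X ⟶ X, e' ≫ e' = e' ∧ e' = 3 • (e ≫ e) - 2 • (e ≫ e ≫ e) := by
  refine ⟨_, ?_, rfl⟩
  have key : ∀ x : End X, (x * x - x) * (x * x - x) = 0 →
      (3 • (x * x) - 2 • (x * x * x)) * (3 • (x * x) - 2 • (x * x * x)) =
        3 • (x * x) - 2 • (x * x * x) := fun x hx => by
    have : (3 • (x * x) - 2 • (x * x * x)) * (3 • (x * x) - 2 • (x * x * x)) -
        (3 • (x * x) - 2 • (x * x * x)) =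
        ((x * x - x) * (x * x - x)) * (4 • (x * x) - 4 • x - 3 • 1) := by noncomm_ring
    rw [hx, zero_mul] at this
    exact sub_eq_zero.1 this
  exact key e h

end Preadditive

section Gluing

variable {C : Type u} [Category.{v} C] [HasZeroObject C] [HasShift C ℤ] [Preadditive C]
  [∀ n : ℤ, (shiftFunctor C n).Additive] [Pretriangulated C] [IsTriangulated C]
  [MonoidalCategory C] [SymmetricCategory C] [TensorTriangulated C]
  {U₁ U₂ : TopologicalSpace.Opens (Spc C)} [MonoidalClosed C] [StronglyClosed C]
  (hU : U₁ ⊔ U₂ = ⊤) [IsIdempotentComplete C]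
include hU

/-- The error `e² - e` dies over both open sets, so its square is zero; the correction `3e² - 2e³`
does not change `e` over either one. -/
theorem exists_idempotent_lift {b : C} {e : b ⟶ b}
    (h₁ : (rho U₁).map e ≫ (rho U₁).map e = (rho U₁).map e)
    (h₂ : (rho U₂).map e ≫ (rho U₂).map e = (rho U₂).map e) :
    ∃ (q : C) (i : q ⟶ b) (r : b ⟶ q), i ≫ r = 𝟙 q ∧ (rho U₁).map (r ≫ i) = (rho U₁).map e ∧
      (rho U₂).map (r ≫ i) = (rho U₂).map e := by
  obtain ⟨e', he', rfl⟩ := exists_idempotent_of_sq_eq_zero e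
    (comp_eq_zero_of_rho_map_eq_zero hU (by rw [Functor.map_sub, Functor.map_comp, h₁, sub_self])
      (by rw [Functor.map_sub, Functor.map_comp, h₂, sub_self]))
  obtain ⟨q, i, r, hir, hri⟩ := IsIdempotentComplete.idempotents_split _ _ he'
  refine ⟨q, i, r, hir, ?_, ?_⟩
  · rw [hri, Functor.map_sub, Functor.map_nsmul, Functor.map_nsmul, Functor.map_comp,
      Functor.map_comp, Functor.map_comp, h₁, h₁]
    abel
  · rw [hri, Functor.map_sub, Functor.map_nsmul, Functor.map_nsmul, Functor.map_comp,
      Functor.map_comp, Functor.map_comp, h₂, h₂]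
    abel

/-- Embed `P₁` and `P₂` as retracts of objects of K, glue two copies of the sum along an involution
extending `σ`, and cut out the wanted object by an idempotent of the glued object. -/
theorem exists_isGluing (hU₁ : IsCompact (U₁ : Set (Spc C))) (hU₂ : IsCompact (U₂ : Set (Spc C)))
    {P₁ : KU U₁} {P₂ : KU U₂}
    (σ : (res (inf_le_left : U₁ ⊓ U₂ ≤ U₁)).obj P₁ ≅ (res (inf_le_right : U₁ ⊓ U₂ ≤ U₂)).obj P₂) :
    ∃ p, IsGluing U₁ U₂ σ p := by
  obtain ⟨x₁, i₁, r₁, h₁⟩ := exists_retract_rho P₁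
  obtain ⟨x₂, i₂, r₂, h₂⟩ := exists_retract_rho P₂
  have hl : (U₁ ⊓ U₂) ≤ U₁ := inf_le_left
  have hr : (U₁ ⊓ U₂) ≤ U₂ := inf_le_right
  obtain ⟨τ, hτ, hτi, hτr⟩ := exists_involution
    (l₁ := (rho (U₁ ⊓ U₂)).map (biprod.inl : x₁ ⟶ x₁ ⊞ x₂))
    (l₂ := (rho (U₁ ⊓ U₂)).map (biprod.inr : x₂ ⟶ x₁ ⊞ x₂))
    (f₁ := (rho (U₁ ⊓ U₂)).map biprod.fst) (f₂ := (rho (U₁ ⊓ U₂)).map biprod.snd)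
    (by rw [← Functor.map_comp, biprod.inl_fst, CategoryTheory.Functor.map_id])
    (by rw [← Functor.map_comp, biprod.inr_snd, CategoryTheory.Functor.map_id])
    (by rw [← Functor.map_comp, biprod.inl_snd, Functor.map_zero])
    (by rw [← Functor.map_comp, biprod.inr_fst, Functor.map_zero])
    (by rw [← Functor.map_comp, ← Functor.map_comp, ← Functor.map_add, biprod.total,
      CategoryTheory.Functor.map_id])
    (i₁ := resFrom hl i₁) (r₁ := resTo hl r₁) (i₂ := resFrom hr i₂) (r₂ := resTo hr r₂)
    (by rw [resFrom_comp_resTo, h₁, CategoryTheory.Functor.map_id])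
    (by rw [resFrom_comp_resTo, h₂, CategoryTheory.Functor.map_id]) σ
  have : IsIso τ := ⟨τ, hτ, hτ⟩
  obtain ⟨b, f₁, f₂, hf⟩ := exists_gluing_of_isIso hU hU₁ hU₂ τ
  obtain ⟨p₁, hp₁⟩ : ∃ p₁, p₁ = f₁.hom ≫ (rho U₁).map biprod.fst ≫ r₁ := ⟨_, rfl⟩
  obtain ⟨p₂, hp₂⟩ : ∃ p₂, p₂ = f₂.hom ≫ (rho U₂).map biprod.snd ≫ r₂ := ⟨_, rfl⟩
  obtain ⟨q₁, hq₁⟩ : ∃ q₁, q₁ = i₁ ≫ (rho U₁).map biprod.inl ≫ f₁.inv := ⟨_, rfl⟩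
  obtain ⟨q₂, hq₂⟩ : ∃ q₂, q₂ = i₂ ≫ (rho U₂).map biprod.inr ≫ f₂.inv := ⟨_, rfl⟩
  have e₁ : q₁ ≫ p₁ = 𝟙 P₁ := by
    rw [hp₁, hq₁, assoc, assoc, f₁.inv_hom_id_assoc, ← assoc ((rho U₁).map _), ← Functor.map_comp,
      biprod.inl_fst, CategoryTheory.Functor.map_id, id_comp, h₁]
  have e₂ : q₂ ≫ p₂ = 𝟙 P₂ := by
    rw [hp₂, hq₂, assoc, assoc, f₂.inv_hom_id_assoc, ← assoc ((rho U₂).map _), ← Functor.map_comp,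
      biprod.inr_snd, CategoryTheory.Functor.map_id, id_comp, h₂]
  have hp : resTo hl p₁ ≫ σ.hom = resTo hr p₂ := by
    rw [hp₁, hp₂, ← resMor_comp_resTo hl f₁.hom, ← resMor_comp_resTo hr f₂.hom, ← rho_map_comp_resTo,
      ← rho_map_comp_resTo, assoc, assoc, ← hτr, ← assoc, hf]
  have hq : resFrom hl q₁ = σ.hom ≫ resFrom hr q₂ := by
    have := isIso_resMor hr f₂.hom
    rw [← cancel_mono (resMor hr _ _ f₂.hom), assoc, resFrom_comp_resMor, hq₂, ← hf, ← assoc,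
      resFrom_comp_resMor, hq₁]
    simp only [assoc, Iso.inv_hom_id, comp_id]
    rw [← resFrom_comp_rho_map, ← resFrom_comp_rho_map, assoc, hτi]
  -- The involution carries the projector onto `P₁` to the projector onto `P₂`, so the two
  -- projectors glue, a priori to a non-idempotent.
  have he : resMor hl b b (p₁ ≫ q₁) = resMor hr b b (p₂ ≫ q₂) := by
    rw [← resTo_comp_resFrom, ← resTo_comp_resFrom, hq, ← hp, assoc]
  obtain ⟨e, he₁, he₂⟩ := exists_rho_map_eq hU hU₁ hU₂ he
  obtain ⟨q, i, r, hir, hr₁, hr₂⟩ := exists_idempotent_lift hU (e := e)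
    (by rw [he₁, assoc, ← assoc q₁, e₁, id_comp]) (by rw [he₂, assoc, ← assoc q₂, e₂, id_comp])
  rw [he₁, Functor.map_comp] at hr₁
  rw [he₂, Functor.map_comp] at hr₂
  refine ⟨q, ⟨(rho U₁).map i ≫ p₁, q₁ ≫ (rho U₁).map r, ?_, ?_⟩,
    ⟨(rho U₂).map i ≫ p₂, q₂ ≫ (rho U₂).map r, ?_, ?_⟩, ?_⟩
  · rw [assoc, ← assoc p₁, ← hr₁, assoc, ← Functor.map_comp, hir, ← Functor.map_comp, ← Functor.map_comp,
      comp_id, hir, CategoryTheory.Functor.map_id]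
  · rw [assoc, ← assoc ((rho U₁).map r), hr₁, assoc, e₁, comp_id, e₁]
  · rw [assoc, ← assoc p₂, ← hr₂, assoc, ← Functor.map_comp, hir, ← Functor.map_comp, ← Functor.map_comp,
      comp_id, hir, CategoryTheory.Functor.map_id]
  · rw [assoc, ← assoc ((rho U₂).map r), hr₂, assoc, e₂, comp_id, e₂]
  · rw [← assoc]
    change resTo hl ((rho U₁).map i ≫ p₁) ≫ σ.hom = resTo hr ((rho U₂).map i ≫ p₂)
    rw [← rho_map_comp_resTo, ← rho_map_comp_resTo, assoc, hp]

end Gluing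

end TTGlue

namespace TTGlue

open Functor.Monoidal Functor.LaxMonoidal in
theorem rep_μ_toKaroubi {D : Type u} [Category.{v} D] [MonoidalCategory D] (X Y : D) :
    Rep (μ (toKaroubi D) X Y) (𝟙 (X ⊗ Y)) := ⟨rfl, by
  change 𝟙 _ ≫ 𝟙 _ = (𝟙 X ⊗ₘ 𝟙 Y) ≫ 𝟙 _
  simp⟩

open Functor.Monoidal Functor.LaxMonoidal in
theorem rep_μ_karoubiMap {D : Type u} [Category.{v} D] {E : Type u'} [Category.{v'} E]
    [MonoidalCategory D] [MonoidalCategory E] (F : D ⥤ E) [F.Monoidal] (P Q : Karoubi D) :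
    Rep (μ (karoubiMap F) P Q) (μ F P.X Q.X) :=
  rep_karoubiIso_hom (P := (karoubiMap F).obj P ⊗ (karoubiMap F).obj Q)
    (Q := (karoubiMap F).obj (P ⊗ Q)) (μIso F P.X Q.X) (μ_natural F P.p Q.p)

/-! ### Compatibility of restriction with the tensor product -/

section Monoidal

variable {C : Type u} [Category.{v} C] [HasZeroObject C] [HasShift C ℤ] [Preadditive C]
  [∀ n : ℤ, (shiftFunctor C n).Additive] [Pretriangulated C] [IsTriangulated C]
  [MonoidalCategory C] [SymmetricCategory C] [TensorTriangulated C]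
  {U V : TopologicalSpace.Opens (Spc C)} (h : U ≤ V) (a b : C)

theorem rep_resComp : Rep ((resComp h).hom.app a)
    ((Localization.Lifting.iso (toLU V) (uW V) (toLU U) (resL h)).hom.app a) := by
  have e₁ : ((resComp h).hom.app a).f = (resL h).map (𝟙 _) ≫ ((resL h).map (𝟙 _) ≫ 𝟙 _) ≫ 𝟙 _ ≫
      (Localization.Lifting.iso (toLU V) (uW V) (toLU U) (resL h)).hom.app a := rfl
  constructor
  · rw [e₁]
    change (resL h).map (𝟙 _) ≫ _ = _
    simp only [id_comp, comp_id, CategoryTheory.Functor.map_id]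
  · rw [e₁]
    simp only [id_comp, comp_id, CategoryTheory.Functor.map_id]
    exact comp_id _

open Functor.Monoidal Functor.LaxMonoidal in
theorem rep_μ_rho : Rep (μ (rho U) a b) (𝟙 _ ≫ μ (toLU U) a b) := by
  have := (rep_μ_toKaroubi ((toLU U).obj a) ((toLU U).obj b)).comp
    (.self ((toKaroubi _).map (μ (toLU U) a b)))
  exact this

open Functor.Monoidal Functor.LaxMonoidal in
theorem μ_comp_resComp :
    μ (res h) _ _ ≫ (res h).map (μ (rho V) a b) ≫ (resComp h).hom.app (a ⊗ b) =
      ((resComp h).hom.app a ⊗ₘ (resComp h).hom.app b) ≫ μ (rho U) a b := by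
  have H : (μ (resL h) _ _ ≫ (resL h).map (μ (toLU V) a b)) ≫
      (Localization.Lifting.iso (toLU V) (uW V) (toLU U) (resL h)).hom.app (a ⊗ b) =
      ((Localization.Lifting.iso (toLU V) (uW V) (toLU U) (resL h)).hom.app a ⊗ₘ
       (Localization.Lifting.iso (toLU V) (uW V) (toLU U) (resL h)).hom.app b) ≫
        μ (toLU U) a b := NatTrans.IsMonoidal.tensor
    (τ := (Localization.Lifting.iso (toLU V) (uW V) (toLU U) (resL h)).hom) a b
  have hμ : Rep (μ (res h) ((rho V).obj a) ((rho V).obj b)) (μ (resL h) _ _) :=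
    rep_μ_karoubiMap (resL h) _ _
  refine Rep.ext (hμ.comp (((rep_μ_rho a b).map (resL h)).comp (rep_resComp h _)))
    (((rep_resComp h a).tensor (rep_resComp h b)).comp (rep_μ_rho a b)) ?_
  rw [id_comp, id_comp]
  exact (assoc _ _ _).symm.trans H

open Functor.Monoidal Functor.OplaxMonoidal in
theorem resComp_inv_comp_δ :
    (resComp h).inv.app (a ⊗ b) ≫ (res h).map (δ (rho V) a b) ≫ δ (res h) _ _ =
      δ (rho U) a b ≫ ((resComp h).inv.app a ⊗ₘ (resComp h).inv.app b) := by
  rw [← cancel_mono (Functor.LaxMonoidal.μ (res h) _ _), assoc, assoc, δ_μ, comp_id,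
    ← cancel_mono ((res h).map (Functor.LaxMonoidal.μ (rho V) a b)), assoc, ← Functor.map_comp, δ_μ,
    ← cancel_mono ((resComp h).hom.app (a ⊗ b)), assoc, assoc, assoc]
  erw [μ_comp_resComp]
  simp

/-- The restriction to `U` of a morphism over `V` from an object of `K` to the unit object. -/
noncomputable def resUnit {a : C} (f : (rho V).obj a ⟶ 𝟙_ (KU V)) : (rho U).obj a ⟶ 𝟙_ (KU U) :=
  resTo h f ≫ Functor.OplaxMonoidal.η (res h)

instance {a : C} (f : (rho V).obj a ⟶ 𝟙_ (KU V)) [IsIso f] : IsIso (resUnit h f) := by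
  unfold resUnit; infer_instance

open Functor.Monoidal Functor.OplaxMonoidal in
theorem resUnit_η : resUnit h (η (rho V)) = η (rho U) := by
  rw [← cancel_epi (Functor.LaxMonoidal.ε (rho U)), ε_η, ← ε_comp_resComp h]
  simp only [resUnit, resTo, assoc, Iso.hom_inv_id_app_assoc]
  erw [← Functor.map_comp_assoc, ε_η]
  rw [CategoryTheory.Functor.map_id, id_comp, ε_η]

/-- The tensor product of two morphisms from objects of `K` to the unit object. -/
noncomputable def tensorUnit {a b : C} (f : (rho U).obj a ⟶ 𝟙_ (KU U))
    (g : (rho U).obj b ⟶ 𝟙_ (KU U)) : (rho U).obj (a ⊗ b) ⟶ 𝟙_ (KU U) :=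
  Functor.OplaxMonoidal.δ (rho U) a b ≫ (f ⊗ₘ g) ≫ (λ_ (𝟙_ (KU U))).hom

instance {a b : C} (f : (rho U).obj a ⟶ 𝟙_ (KU U)) (g : (rho U).obj b ⟶ 𝟙_ (KU U)) [IsIso f]
    [IsIso g] : IsIso (tensorUnit f g) := by
  unfold tensorUnit; infer_instance

open Functor.Monoidal Functor.OplaxMonoidal in
theorem resUnit_tensorUnit {a b : C} (f : (rho V).obj a ⟶ 𝟙_ (KU V))
    (g : (rho V).obj b ⟶ 𝟙_ (KU V)) :
    resUnit h (tensorUnit f g) = tensorUnit (resUnit h f) (resUnit h g) := by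
  have e := resComp_inv_comp_δ h a b
  have e' : (res h).map (f ⊗ₘ g) = δ (res h) _ _ ≫ ((res h).map f ⊗ₘ (res h).map g) ≫
      Functor.LaxMonoidal.μ (res h) _ _ := by
    rw [Functor.LaxMonoidal.μ_natural, δ_μ_assoc]
  simp only [resUnit, tensorUnit, resTo, Functor.map_comp, assoc, e']
  have e'' : Functor.LaxMonoidal.μ (res h) _ _ ≫ (res h).map (λ_ (𝟙_ (KU V))).hom ≫ η (res h) =
      (η (res h) ⊗ₘ η (res h)) ≫ (λ_ _).hom := by
    rw [MonoidalCategory.tensorHom_def, assoc, leftUnitor_naturality, map_leftUnitor, assoc, assoc,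
      μ_δ_assoc]
  rw [e'', ← assoc ((res h).map _), ← assoc ((resComp h).inv.app _)]
  erw [e]
  simp only [assoc, ← tensorHom_comp_tensorHom]

/-- Tensoring two trivializations multiplies their gluing units; this is what makes δ
multiplicative. -/
theorem tensorUnit_comp {a b : C} (f : (rho U).obj a ⟶ 𝟙_ (KU U)) (g : (rho U).obj b ⟶ 𝟙_ (KU U))
    (s t : 𝟙_ (KU U) ⟶ 𝟙_ (KU U)) :
    tensorUnit (f ≫ s) (g ≫ t) = tensorUnit f g ≫ s ≫ t := by
  have e : (s ⊗ₘ t) ≫ (λ_ (𝟙_ (KU U))).hom = (λ_ (𝟙_ (KU U))).hom ≫ s ≫ t := by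
    rw [MonoidalCategory.tensorHom_def, assoc, leftUnitor_naturality, unitors_equal,
      rightUnitor_naturality_assoc]
  rw [tensorUnit, tensorUnit, ← tensorHom_comp_tensorHom, assoc, assoc, assoc, e]

end Monoidal

/-! ### Gluings of two copies of the unit object -/

section Gluing

variable {C : Type u} [Category.{v} C] [HasZeroObject C] [HasShift C ℤ] [Preadditive C]
  [∀ n : ℤ, (shiftFunctor C n).Additive] [Pretriangulated C] [IsTriangulated C]
  [MonoidalCategory C] [SymmetricCategory C] [TensorTriangulated C]
  {U₁ U₂ : TopologicalSpace.Opens (Spc C)}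

open Functor.Monoidal Functor.OplaxMonoidal in
theorem isGluing_unitGlueIso_iff {σ : Gm (KU (U₁ ⊓ U₂))} {p : C} :
    IsGluing U₁ U₂ (unitGlueIso U₁ U₂ σ) p ↔
      ∃ (f₁ : (rho U₁).obj p ≅ 𝟙_ (KU U₁)) (f₂ : (rho U₂).obj p ≅ 𝟙_ (KU U₂)),
        resUnit inf_le_left f₁.hom ≫ σ.1 = resUnit inf_le_right f₂.hom := by
  refine exists_congr fun f₁ => exists_congr fun f₂ => ?_
  rw [← cancel_mono (η (res (inf_le_right : U₁ ⊓ U₂ ≤ U₂)))]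
  have : (unitGlueIso U₁ U₂ σ).hom ≫ η (res inf_le_right) = η (res inf_le_left) ≫ σ.1 := by
    change (η _ ≫ σ.1 ≫ Functor.LaxMonoidal.ε _) ≫ η _ = _
    simp
  simp only [resUnit, resTo, assoc, this]

theorem isGluing_tensor {σ τ : Gm (KU (U₁ ⊓ U₂))} {p q : C}
    (hp : IsGluing U₁ U₂ (unitGlueIso U₁ U₂ σ) p) (hq : IsGluing U₁ U₂ (unitGlueIso U₁ U₂ τ) q) :
    IsGluing U₁ U₂ (unitGlueIso U₁ U₂ (σ * τ)) (p ⊗ q) := by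
  obtain ⟨f₁, f₂, hf⟩ := isGluing_unitGlueIso_iff.1 hp
  obtain ⟨g₁, g₂, hg⟩ := isGluing_unitGlueIso_iff.1 hq
  refine isGluing_unitGlueIso_iff.2 ⟨asIso (tensorUnit f₁.hom g₁.hom),
    asIso (tensorUnit f₂.hom g₂.hom), ?_⟩
  -- Multiplication of endomorphisms is composition in the opposite order; commutativity restores
  -- the order `σ`, then `τ`.
  rw [mul_comm]
  change resUnit _ (tensorUnit f₁.hom g₁.hom) ≫ σ.1 ≫ τ.1 = resUnit _ (tensorUnit f₂.hom g₂.hom)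
  rw [resUnit_tensorUnit, resUnit_tensorUnit, ← hf, ← hg, tensorUnit_comp]

theorem isGluing_unit_iff {p : C} :
    IsGluing U₁ U₂ (unitGlueIso U₁ U₂ 1) p ↔
      ∃ (f₁ : (rho U₁).obj p ≅ 𝟙_ (KU U₁)) (f₂ : (rho U₂).obj p ≅ 𝟙_ (KU U₂)),
        resUnit inf_le_left f₁.hom = resUnit inf_le_right f₂.hom := by
  refine isGluing_unitGlueIso_iff.trans (exists_congr fun f₁ => exists_congr fun f₂ => ?_)
  change _ ≫ 𝟙 _ = _ ↔ _
  rw [comp_id]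

open Functor.Monoidal Functor.OplaxMonoidal in
theorem isGluing_one : IsGluing U₁ U₂ (unitGlueIso U₁ U₂ 1) (𝟙_ C) :=
  isGluing_unit_iff.2 ⟨(εIso (rho U₁)).symm, (εIso (rho U₂)).symm, by
    change resUnit _ (η _) = resUnit _ (η _)
    rw [resUnit_η, resUnit_η]⟩

theorem exists_isGluing_of_iso {p : C} (f₁ : (rho U₁).obj p ≅ 𝟙_ (KU U₁))
    (f₂ : (rho U₂).obj p ≅ 𝟙_ (KU U₂)) : ∃ σ, IsGluing U₁ U₂ (unitGlueIso U₁ U₂ σ) p := by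
  refine ⟨(Aut.unitsEndEquivAut _).symm ((asIso (resUnit inf_le_left f₁.hom)).symm ≪≫
    asIso (resUnit inf_le_right f₂.hom)), isGluing_unitGlueIso_iff.2 ⟨f₁, f₂, ?_⟩⟩
  change _ ≫ inv _ ≫ _ = _
  rw [IsIso.hom_inv_id_assoc]
  rfl

end Gluing

end TTGlue

namespace TTGlue

/-! ### Units, and the homomorphism δ -/

section Units

variable {D : Type u} [Category.{v} D] [MonoidalCategory D]

/-- The automorphism of the unit object corresponding to a unit. -/
def gmIso (w : Gm D) : 𝟙_ D ≅ 𝟙_ D := Aut.unitsEndEquivAut _ w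

/-- The unit corresponding to an automorphism of the unit object. -/
def isoGm (e : 𝟙_ D ≅ 𝟙_ D) : Gm D := (Aut.unitsEndEquivAut _).symm e

variable {E : Type u'} [Category.{v'} E] [MonoidalCategory E] (F : D ⥤ E) [F.Monoidal]

open Functor.Monoidal Functor.LaxMonoidal Functor.OplaxMonoidal in
theorem endUnitMap_eq_iff {f : End (𝟙_ D)} {w : End (𝟙_ E)} :
    endUnitMap F f = w ↔ F.map f = η F ≫ w ≫ ε F := by
  change ε F ≫ F.map f ≫ η F = w ↔ _
  constructor
  · rintro rfl; simp
  · intro h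
    rw [h]
    simp

theorem monoidHom_toSkeleton (X : D) :
    Skeleton.monoidHom F (toSkeleton X) = toSkeleton (F.obj X) :=
  F.mapSkeleton_obj_toSkeleton X

end Units

section

variable {C : Type u} [Category.{v} C] [HasZeroObject C] [HasShift C ℤ] [Preadditive C]
  [∀ n : ℤ, (shiftFunctor C n).Additive] [Pretriangulated C]

theorem IsWeakPushout.of_iso {a b c d d' : C} {f : a ⟶ b} {g : a ⟶ c} {h : b ⟶ d} {k : c ⟶ d}
    (H : IsWeakPushout f g h k) (e : d ≅ d') : IsWeakPushout f g (h ≫ e.hom) (k ≫ e.hom) := by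
  obtain ⟨w, l, hT⟩ := H
  refine ⟨by rw [← assoc, w, assoc], e.inv ≫ l, ?_⟩
  refine distTriang_of_iso hT (Iso.refl _) (Iso.refl _) e.symm (by simp) ?_ (by simp)
  ext <;> simp

end

section UnitGluing

variable {C : Type u} [Category.{v} C] [HasZeroObject C] [HasShift C ℤ] [Preadditive C]
  [∀ n : ℤ, (shiftFunctor C n).Additive] [Pretriangulated C] [IsTriangulated C]
  [MonoidalCategory C] [SymmetricCategory C] [TensorTriangulated C]
  {U V U₁ U₂ : TopologicalSpace.Opens (Spc C)} (h : U ≤ V)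

theorem resMor_comp_resUnit {a b : C} (g : Mor V a b) (p : (rho V).obj b ⟶ 𝟙_ (KU V)) :
    resMor h a b g ≫ resUnit h p = resUnit h (g ≫ p) := by
  rw [resUnit, resUnit, ← assoc, resMor_comp_resTo]

theorem resUnit_comp {a : C} (p : (rho V).obj a ⟶ 𝟙_ (KU V)) (w : End (𝟙_ (KU V))) :
    resUnit h (p ≫ w) = resUnit h p ≫ endUnitMap (res h) w := by
  rw [resUnit, resUnit, ← resTo_comp_map, assoc, assoc, (endUnitMap_eq_iff (res h)).1 rfl, assoc,
    assoc, Functor.Monoidal.ε_η, comp_id]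

open Functor.LaxMonoidal Functor.OplaxMonoidal in
theorem resMor_unit (w : End (𝟙_ (KU V))) :
    resMor h (𝟙_ C) (𝟙_ C) (η (rho V) ≫ w ≫ ε (rho V)) =
      η (rho U) ≫ endUnitMap (res h) w ≫ ε (rho U) := by
  rw [← cancel_mono (η (rho U)), assoc, assoc, Functor.Monoidal.ε_η, comp_id]
  conv_lhs => rw [← resUnit_η h]
  rw [resMor_comp_resUnit, assoc, assoc, Functor.Monoidal.ε_η, comp_id, resUnit_comp, resUnit_η]

open Functor.LaxMonoidal Functor.OplaxMonoidal in
theorem endUnitMap_res_rho (f : End (𝟙_ C)) :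
    endUnitMap (res h) (endUnitMap (rho V) f) = endUnitMap (rho U) f := by
  symm
  rw [endUnitMap_eq_iff, ← resMor_unit, ← (endUnitMap_eq_iff (rho V)).1 rfl, resMor_rho_map]

open Functor.Monoidal Functor.OplaxMonoidal in
-- Trivializations of the unit object over Uᵢ are exactly the units of K(Uᵢ); this yields the kernel
-- of δ.
theorem isGluing_unit_object_iff {σ : Gm (KU (U₁ ⊓ U₂))} :
    IsGluing U₁ U₂ (unitGlueIso U₁ U₂ σ) (𝟙_ C) ↔
      ∃ (w₁ : Gm (KU U₁)) (w₂ : Gm (KU U₂)),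
        σ * gmMap (res inf_le_left) w₁ = gmMap (res inf_le_right) w₂ := by
  rw [isGluing_unitGlueIso_iff]
  constructor
  · rintro ⟨f₁, f₂, h⟩
    refine ⟨isoGm (εIso (rho U₁) ≪≫ f₁), isoGm (εIso (rho U₂) ≪≫ f₂), Units.ext ?_⟩
    change endUnitMap _ (Functor.LaxMonoidal.ε (rho U₁) ≫ f₁.hom) ≫ σ.1 =
      endUnitMap _ (Functor.LaxMonoidal.ε (rho U₂) ≫ f₂.hom)
    rw [← cancel_epi (η (rho (U₁ ⊓ U₂)))]
    conv_lhs => rw [← resUnit_η (inf_le_left : U₁ ⊓ U₂ ≤ U₁), ← assoc, ← resUnit_comp]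
    conv_rhs => rw [← resUnit_η (inf_le_right : U₁ ⊓ U₂ ≤ U₂), ← resUnit_comp]
    rwa [η_ε_assoc, η_ε_assoc]
  · rintro ⟨w₁, w₂, h⟩
    refine ⟨(εIso (rho U₁)).symm ≪≫ gmIso w₁, (εIso (rho U₂)).symm ≪≫ gmIso w₂, ?_⟩
    change resUnit _ (η (rho U₁) ≫ w₁.1) ≫ σ.1 = resUnit _ (η (rho U₂) ≫ w₂.1)
    rw [resUnit_comp, resUnit_comp, resUnit_η, resUnit_η, assoc]
    exact congrArg (η (rho (U₁ ⊓ U₂)) ≫ ·) (congrArg Units.val h)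

open Functor.Monoidal Functor.OplaxMonoidal in
theorem IsWeakPushoutGluing.isGluing {σ : Gm (KU (U₁ ⊓ U₂))} {p : C}
    (H : IsWeakPushoutGluing U₁ U₂ σ p) : IsGluing U₁ U₂ (unitGlueIso U₁ U₂ σ) p := by
  obtain ⟨x, x₁, x₂, s, t, s₁, s₂, t₁, t₂, u₁, u₂, -, -, e, rfl, rfl, hs₁, hs₂, ht₁, ht₂, H⟩ := H
  obtain ⟨f₁, f₂, h⟩ := isGluing_isWeakPushout hs₁ hs₂ ht₁ ht₂ H e
  refine isGluing_unitGlueIso_iff.2 ⟨f₁ ≪≫ (εIso (rho U₁)).symm, f₂ ≪≫ (εIso (rho U₂)).symm, ?_⟩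
  change resUnit _ (f₁.hom ≫ η (rho U₁)) ≫ σ.1 = resUnit _ (f₂.hom ≫ η (rho U₂))
  rw [← resMor_comp_resUnit, ← resMor_comp_resUnit, resUnit_η, resUnit_η, ← h]
  change _ = (_ ≫ η _ ≫ σ.1 ≫ Functor.LaxMonoidal.ε _) ≫ η _
  simp only [assoc, ε_η, comp_id]

variable [MonoidalClosed C] [StronglyClosed C] [IsIdempotentComplete C] (hU : U₁ ⊔ U₂ = ⊤)
  (hU₁ : IsCompact (U₁ : Set (Spc C))) (hU₂ : IsCompact (U₂ : Set (Spc C)))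
include hU hU₁ hU₂

open Functor.Monoidal Functor.OplaxMonoidal in
-- Some weak push-out exists and is a gluing. By uniqueness of gluings it is isomorphic to `p`, and
-- weak push-outs may be transported along isomorphisms.
theorem isWeakPushoutGluing_iff {σ : Gm (KU (U₁ ⊓ U₂))} {p : C} :
    IsWeakPushoutGluing U₁ U₂ σ p ↔ IsGluing U₁ U₂ (unitGlueIso U₁ U₂ σ) p := by
  refine ⟨IsWeakPushoutGluing.isGluing, fun hp => ?_⟩
  let τ : (rho (U₁ ⊓ U₂)).obj (𝟙_ C) ≅ (rho (U₁ ⊓ U₂)).obj (𝟙_ C) :=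
    (εIso (rho (U₁ ⊓ U₂))).symm ≪≫ gmIso σ ≪≫ εIso (rho (U₁ ⊓ U₂))
  obtain ⟨q, x, x₁, x₂, s₂, s₁, t₁, t₂, u₁, u₂, hs₁, hs₂, ht₁, ht₂, hs, ht, e, H⟩ :=
    exists_isWeakPushout_of_isIso hU hU₁ hU₂ τ.hom
  have hq : ∀ {q' : C} (i : q ≅ q'), IsWeakPushoutGluing U₁ U₂ σ q' := fun i =>
    ⟨x, x₁, x₂, _, _, s₁, s₂, t₁, t₂, u₁ ≫ i.hom, u₂ ≫ i.hom, hs, ht, e, rfl, rfl, hs₁, hs₂, ht₁,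
      ht₂, H.of_iso i⟩
  obtain ⟨i⟩ := IsGluing.nonempty_iso hU hU₁ hU₂ (hq (Iso.refl q)).isGluing hp
  exact hq i

theorem exists_gluing_hom : ∃ δ : Gm (KU (U₁ ⊓ U₂)) →* Pic C, ∀ σ p,
    (δ σ : Skeleton C) = toSkeleton p ↔ IsGluing U₁ U₂ (unitGlueIso U₁ U₂ σ) p := by
  choose P hP using fun σ => exists_isGluing hU hU₁ hU₂ (unitGlueIso U₁ U₂ σ)
  have key : ∀ {σ p}, IsGluing U₁ U₂ (unitGlueIso U₁ U₂ σ) p → toSkeleton (P σ) = toSkeleton p :=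
    fun hp => toSkeleton_eq_toSkeleton_iff.2 (IsGluing.nonempty_iso hU hU₁ hU₂ (hP _) hp)
  let d : Gm (KU (U₁ ⊓ U₂)) →* Skeleton C :=
    { toFun σ := toSkeleton (P σ)
      map_one' := key isGluing_one
      map_mul' σ τ := (key (isGluing_tensor (hP σ) (hP τ))).trans
        (Skeleton.toSkeleton_tensorObj _ _) }
  refine ⟨d.toHomUnits, fun σ p => ⟨fun h => ?_, key⟩⟩
  obtain ⟨e⟩ := toSkeleton_eq_toSkeleton_iff.1 h
  exact (hP σ).of_iso e

end UnitGluing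

/-! ### Exactness at K and at Pic(K), and the homomorphism 1 + ∂ -/

section RestrictionExactness

variable {C : Type u} [Category.{v} C] [HasZeroObject C] [HasShift C ℤ] [Preadditive C]
  [∀ n : ℤ, (shiftFunctor C n).Additive] [Pretriangulated C] [IsTriangulated C]
  [MonoidalCategory C] [SymmetricCategory C] [TensorTriangulated C]
  {U₁ U₂ : TopologicalSpace.Opens (Spc C)}

theorem exact_conn_pairMor {a b : C} {c : Mor (U₁ ⊓ U₂) (a⟦(1 : ℤ)⟧) b →+ (a ⟶ b)}
    (hc : ∀ g d, c g = d ↔ IsConnecting U₁ U₂ g (d⟦(1 : ℤ)⟧')) :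
    Function.Exact c (pairMor U₁ U₂ a b) := by
  intro d
  constructor
  · intro h
    obtain ⟨g, hg⟩ := exists_isConnecting
      (rho_map_shift_eq_zero (congrArg Prod.fst h : (rho U₁).map d = 0) 1)
      (rho_map_shift_eq_zero (congrArg Prod.snd h : (rho U₂).map d = 0) 1)
    exact ⟨g, (hc g d).2 hg⟩
  · rintro ⟨g, rfl⟩
    have H := (hc g _).1 rfl
    exact Prod.ext (rho_map_shift_eq_zero_iff.1 H.rho_map_eq_zero_left)
      (rho_map_shift_eq_zero_iff.1 H.rho_map_eq_zero_right)

/-- Every value of ∂ dies over both open sets, so products of two values vanish and `(1 + ∂g)(1 +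
∂g') = 1 + ∂(g + g')`. -/
theorem exists_one_add_hom [MonoidalClosed C] [StronglyClosed C] (hU : U₁ ⊔ U₂ = ⊤)
    {c : Mor (U₁ ⊓ U₂) ((𝟙_ C)⟦(1 : ℤ)⟧) (𝟙_ C) →+ (𝟙_ C ⟶ 𝟙_ C)}
    (hc : ∀ g d, c g = d ↔ IsConnecting U₁ U₂ g (d⟦(1 : ℤ)⟧')) :
    ∃ φ : Multiplicative (Mor (U₁ ⊓ U₂) ((𝟙_ C)⟦(1 : ℤ)⟧) (𝟙_ C)) →* Gm C,
      ∀ g, (φ (Multiplicative.ofAdd g) : End (𝟙_ C)) = 𝟙 (𝟙_ C) + c g := by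
  have hz : ∀ g g', c g ≫ c g' = 0 := fun g g' =>
    comp_eq_zero_of_rho_map_eq_zero hU
      (congrArg Prod.fst ((exact_conn_pairMor hc).apply_apply_eq_zero g))
      (congrArg Prod.snd ((exact_conn_pairMor hc).apply_apply_eq_zero g'))
  have hm : ∀ g g', (𝟙 (𝟙_ C) + c g) ≫ (𝟙 (𝟙_ C) + c g') = 𝟙 (𝟙_ C) + c (g + g') := fun g g' => by
    rw [Preadditive.add_comp, Preadditive.comp_add, Preadditive.comp_add, hz, map_add]
    simp only [id_comp, comp_id]
    abel
  let φ : Multiplicative (Mor (U₁ ⊓ U₂) ((𝟙_ C)⟦(1 : ℤ)⟧) (𝟙_ C)) →* End (𝟙_ C) :=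
    { toFun g := 𝟙 (𝟙_ C) + c g.toAdd
      map_one' := by
        change 𝟙 (𝟙_ C) + c 0 = 𝟙 _
        rw [map_zero, add_zero]
      map_mul' g g' := by
        rw [mul_comm]
        exact (hm g'.toAdd g.toAdd).symm }
  exact ⟨φ.toHomUnits, fun g => rfl⟩

/-- A unit `w` is trivial over both open sets exactly when `w - 1` dies over both, which reduces to
additive exactness. -/
theorem mulExact_one_add_pairGm
    {c : Mor (U₁ ⊓ U₂) ((𝟙_ C)⟦(1 : ℤ)⟧) (𝟙_ C) →+ (𝟙_ C ⟶ 𝟙_ C)}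
    (hc : ∀ g d, c g = d ↔ IsConnecting U₁ U₂ g (d⟦(1 : ℤ)⟧'))
    {φ : Multiplicative (Mor (U₁ ⊓ U₂) ((𝟙_ C)⟦(1 : ℤ)⟧) (𝟙_ C)) →* Gm C}
    (hφ : ∀ g, (φ (Multiplicative.ofAdd g) : End (𝟙_ C)) = 𝟙 (𝟙_ C) + c g) :
    Function.MulExact φ (pairGm U₁ U₂) := by
  intro w
  obtain ⟨k, hk⟩ : ∃ k : 𝟙_ C ⟶ 𝟙_ C, k = w.1 := ⟨_, rfl⟩
  have h₀ : ∀ U : TopologicalSpace.Opens (Spc C),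
      gmMap (rho U) w = 1 ↔ (rho U).map (k - 𝟙 (𝟙_ C)) = 0 := fun U => by
    rw [← Units.val_inj]
    change endUnitMap (rho U) w.1 = 𝟙 _ ↔ _
    rw [← hk, endUnitMap_eq_iff, id_comp, Functor.Monoidal.η_ε, Functor.map_sub, sub_eq_zero,
      CategoryTheory.Functor.map_id]
  have h₁ : pairGm U₁ U₂ w = 1 ↔ pairMor U₁ U₂ (𝟙_ C) (𝟙_ C) (k - 𝟙 (𝟙_ C)) = 0 :=
    Prod.ext_iff.trans ((and_congr (h₀ U₁) (h₀ U₂)).trans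
      (Prod.ext_iff (x := pairMor U₁ U₂ (𝟙_ C) (𝟙_ C) (k - 𝟙 (𝟙_ C))) (y := 0)).symm)
  rw [h₁, exact_conn_pairMor hc]
  constructor
  · rintro ⟨g, hg⟩
    refine ⟨Multiplicative.ofAdd g, Units.ext ?_⟩
    rw [hφ, hg, ← hk]
    exact add_sub_cancel _ _
  · rintro ⟨g, rfl⟩
    refine ⟨g.toAdd, eq_sub_of_add_eq' ((hφ g.toAdd).symm.trans hk.symm)⟩

variable {δ : Gm (KU (U₁ ⊓ U₂)) →* Pic C} (hδ : ∀ σ p,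
    (δ σ : Skeleton C) = toSkeleton p ↔ IsGluing U₁ U₂ (unitGlueIso U₁ U₂ σ) p)
include hδ

theorem mulExact_diffGm_gluing : Function.MulExact (diffGm U₁ U₂) δ := by
  intro σ
  have h₁ : δ σ = 1 ↔ IsGluing U₁ U₂ (unitGlueIso U₁ U₂ σ) (𝟙_ C) := by
    rw [← hδ, ← Units.val_inj]
    exact Iff.rfl
  rw [h₁, isGluing_unit_object_iff]
  constructor
  · rintro ⟨w₁, w₂, h⟩
    refine ⟨(w₁⁻¹, w₂⁻¹), ?_⟩
    change gmMap (res inf_le_left) w₁⁻¹ / gmMap (res inf_le_right) w₂⁻¹ = σ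
    rw [map_inv, map_inv, ← h]
    simp
  · rintro ⟨⟨w₁, w₂⟩, rfl⟩
    refine ⟨w₁⁻¹, w₂⁻¹, ?_⟩
    change gmMap (res inf_le_left) w₁ / gmMap (res inf_le_right) w₂ * _ = _
    rw [map_inv, map_inv, div_mul_eq_mul_div, mul_inv_cancel, one_div]

theorem mulExact_gluing_pairPic : Function.MulExact δ (pairPic U₁ U₂) := by
  intro y
  obtain ⟨p, hp⟩ := Quotient.exists_rep (y : Skeleton C)
  have h₀ : ∀ U : TopologicalSpace.Opens (Spc C),
      picMap (rho U) y = 1 ↔ Nonempty ((rho U).obj p ≅ 𝟙_ (KU U)) := fun U => by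
    rw [← Units.val_inj, ← toSkeleton_eq_toSkeleton_iff, ← monoidHom_toSkeleton]
    change Skeleton.monoidHom (rho U) (y : Skeleton C) = _ ↔ _
    rw [← hp]
    exact Iff.rfl
  have h₁ : pairPic U₁ U₂ y = 1 ↔ picMap (rho U₁) y = 1 ∧ picMap (rho U₂) y = 1 := Prod.ext_iff
  rw [h₁, h₀, h₀]
  constructor
  · rintro ⟨⟨f₁⟩, ⟨f₂⟩⟩
    obtain ⟨σ, hσ⟩ := exists_isGluing_of_iso f₁ f₂
    exact ⟨σ, Units.ext (((hδ σ p).2 hσ).trans hp)⟩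
  · rintro ⟨σ, rfl⟩
    obtain ⟨f₁, f₂, -⟩ := (hδ σ p).1 hp.symm
    exact ⟨⟨f₁⟩, ⟨f₂⟩⟩

end RestrictionExactness

/-! ### Exactness at the remaining terms -/

section Exactness

variable {C : Type u} [Category.{v} C] [HasZeroObject C] [HasShift C ℤ] [Preadditive C]
  [∀ n : ℤ, (shiftFunctor C n).Additive] [Pretriangulated C] [IsTriangulated C]
  [MonoidalCategory C] [SymmetricCategory C] [TensorTriangulated C]
  {U₁ U₂ : TopologicalSpace.Opens (Spc C)} [MonoidalClosed C] [StronglyClosed C]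
  [IsIdempotentComplete C] (hU : U₁ ⊔ U₂ = ⊤) (hU₁ : IsCompact (U₁ : Set (Spc C)))
  (hU₂ : IsCompact (U₂ : Set (Spc C)))
include hU hU₁ hU₂

theorem exists_desuspended_connecting_hom (a b : C) :
    ∃ c : Mor (U₁ ⊓ U₂) (a⟦(1 : ℤ)⟧) b →+ (a ⟶ b), ∀ g d,
      c g = d ↔ IsConnecting U₁ U₂ g (d⟦(1 : ℤ)⟧') := by
  obtain ⟨D, hD⟩ := exists_connecting_hom hU hU₁ hU₂ (a⟦(1 : ℤ)⟧) b
  -- The construction yields a morphism of suspensions, and suspension is fully faithful.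
  have hc : ∀ g, ((shiftFunctor C (1 : ℤ)).preimage (D g))⟦(1 : ℤ)⟧' = D g := fun g =>
    Functor.map_preimage _ _
  refine ⟨AddMonoidHom.mk' (fun g => (shiftFunctor C (1 : ℤ)).preimage (D g)) fun g g' => ?_,
    fun g d => ?_⟩
  · apply (shiftFunctor C (1 : ℤ)).map_injective
    rw [Functor.map_add, hc, hc, hc, map_add]
  · rw [← hD, ← hc g]
    exact (shiftFunctor C (1 : ℤ)).map_injective.eq_iff.symm

section Connecting

variable {a b : C} {c : Mor (U₁ ⊓ U₂) (a⟦(1 : ℤ)⟧) b →+ (a ⟶ b)}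
  (hc : ∀ g d, c g = d ↔ IsConnecting U₁ U₂ g (d⟦(1 : ℤ)⟧'))
include hc

theorem exact_diffMor_conn : Function.Exact (diffMor U₁ U₂ (a⟦(1 : ℤ)⟧) b) c := by
  intro g
  constructor
  · intro h
    have H := (hc g 0).1 h
    rw [Functor.map_zero] at H
    obtain ⟨g₁, g₂, e⟩ := H.exists_of_zero
    exact ⟨(g₁, g₂), e⟩
  · rintro ⟨⟨g₁, g₂⟩, rfl⟩
    change c (resMor inf_le_left _ b g₁ - resMor inf_le_right _ b g₂) = 0
    rw [map_sub, (hc (resMor inf_le_left _ b g₁) 0).2, (hc (resMor inf_le_right _ b g₂) 0).2, sub_self]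
    · rw [Functor.map_zero]; exact isConnecting_resMor_right hU hU₁ hU₂ g₂
    · rw [Functor.map_zero]; exact isConnecting_resMor_left hU hU₁ hU₂ g₁

end Connecting

theorem exact_pairMor_diffMor (a b : C) :
    Function.Exact (pairMor U₁ U₂ a b) (diffMor U₁ U₂ a b) := by
  rintro ⟨g₁, g₂⟩
  change resMor inf_le_left a b g₁ - resMor inf_le_right a b g₂ = 0 ↔ _
  rw [sub_eq_zero]
  constructor
  · intro h
    obtain ⟨k, h₁, h₂⟩ := exists_rho_map_eq hU hU₁ hU₂ h
    exact ⟨k, Prod.ext h₁ h₂⟩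
  · rintro ⟨k, hk⟩
    have h₁ : (rho U₁).map k = g₁ := congrArg Prod.fst hk
    have h₂ : (rho U₂).map k = g₂ := congrArg Prod.snd hk
    rw [← h₁, ← h₂, resMor_rho_map, resMor_rho_map]

section OnePlus

variable {c : Mor (U₁ ⊓ U₂) ((𝟙_ C)⟦(1 : ℤ)⟧) (𝟙_ C) →+ (𝟙_ C ⟶ 𝟙_ C)}
  (hc : ∀ g d, c g = d ↔ IsConnecting U₁ U₂ g (d⟦(1 : ℤ)⟧'))
variable {φ : Multiplicative (Mor (U₁ ⊓ U₂) ((𝟙_ C)⟦(1 : ℤ)⟧) (𝟙_ C)) →* Gm C}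
  (hφ : ∀ g, (φ (Multiplicative.ofAdd g) : End (𝟙_ C)) = 𝟙 (𝟙_ C) + c g)
include hc hφ

theorem mulExact_diffMor_one_add :
    Function.MulExact (AddMonoidHom.toMultiplicative (diffMor U₁ U₂ ((𝟙_ C)⟦(1 : ℤ)⟧) (𝟙_ C))) φ := by
  intro g
  have h₁ : φ g = 1 ↔ c g.toAdd = 0 := by
    rw [← Units.val_inj]
    change (φ (Multiplicative.ofAdd g.toAdd) : End (𝟙_ C)) = 𝟙 (𝟙_ C) ↔ _
    rw [hφ]
    exact add_eq_left
  rw [h₁, exact_diffMor_conn hU hU₁ hU₂ hc]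
  exact Iff.rfl

end OnePlus

open Functor.Monoidal Functor.OplaxMonoidal in
theorem mulExact_pairGm_diffGm : Function.MulExact (pairGm U₁ U₂) (diffGm U₁ U₂) := by
  rintro ⟨w₁, w₂⟩
  change gmMap (res inf_le_left) w₁ / gmMap (res inf_le_right) w₂ = 1 ↔ _
  rw [div_eq_one, ← Units.val_inj]
  change endUnitMap (res inf_le_left) w₁.1 = endUnitMap (res inf_le_right) w₂.1 ↔ _
  constructor
  · intro h
    obtain ⟨k, h₁, h₂⟩ := exists_rho_map_eq hU hU₁ hU₂ ((resMor_unit inf_le_left w₁.1).trans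
      ((congrArg (fun z => η _ ≫ z ≫ Functor.LaxMonoidal.ε _) h).trans
        (resMor_unit inf_le_right w₂.1).symm))
    have i₁ : IsIso (w₁.1 : 𝟙_ (KU U₁) ⟶ _) := (gmIso w₁).isIso_hom
    have i₂ : IsIso (w₂.1 : 𝟙_ (KU U₂) ⟶ _) := (gmIso w₂).isIso_hom
    -- The glued endomorphism is a unit because it is invertible over both open sets.
    have : IsIso k := isIso_of_isUIso hU (by rw [IsUIso, h₁]; infer_instance)
      (by rw [IsUIso, h₂]; infer_instance)
    exact ⟨isoGm (asIso k), Prod.ext (Units.ext ((endUnitMap_eq_iff _).2 h₁))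
      (Units.ext ((endUnitMap_eq_iff _).2 h₂))⟩
  · rintro ⟨w, hw⟩
    have h₁ : endUnitMap (rho U₁) w.1 = w₁.1 := congrArg (fun z => z.1.1) hw
    have h₂ : endUnitMap (rho U₂) w.1 = w₂.1 := congrArg (fun z => z.2.1) hw
    rw [← h₁, ← h₂, endUnitMap_res_rho, endUnitMap_res_rho]

/-- `p ⊗ q` need not be the unit object, but it is a gluing of two copies of it, so its class is a
value of δ and hence invertible. -/
theorem isUnit_toSkeleton_of_iso {p q : C} (f₁ : (rho U₁).obj (p ⊗ q) ≅ 𝟙_ (KU U₁))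
    (f₂ : (rho U₂).obj (p ⊗ q) ≅ 𝟙_ (KU U₂)) : IsUnit (toSkeleton p) := by
  obtain ⟨δ, hδ⟩ := exists_gluing_hom hU hU₁ hU₂
  obtain ⟨σ, hσ⟩ := exists_isGluing_of_iso f₁ f₂
  refine isUnit_of_mul_isUnit_left (y := toSkeleton q) ?_
  rw [← Skeleton.toSkeleton_tensorObj, ← (hδ σ _).2 hσ]
  exact (δ σ).isUnit

open Functor.Monoidal in
theorem mulExact_pairPic_diffPic : Function.MulExact (pairPic U₁ U₂) (diffPic U₁ U₂) := by
  rintro ⟨y₁, y₂⟩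
  change picMap (res inf_le_left) y₁ / picMap (res inf_le_right) y₂ = 1 ↔ _
  rw [div_eq_one]
  constructor
  · intro h
    have glue : ∀ {z₁ : Pic (KU U₁)} {z₂ : Pic (KU U₂)} {a₁ a₂},
        picMap (res (inf_le_left : U₁ ⊓ U₂ ≤ U₁)) z₁ = picMap (res inf_le_right) z₂ →
        toSkeleton a₁ = (z₁ : Skeleton (KU U₁)) → toSkeleton a₂ = (z₂ : Skeleton (KU U₂)) →
        ∃ p : C, Nonempty ((rho U₁).obj p ≅ a₁) ∧ Nonempty ((rho U₂).obj p ≅ a₂) := by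
      intro z₁ z₂ a₁ a₂ h h₁ h₂
      have e : Skeleton.monoidHom (res inf_le_left) (z₁ : Skeleton (KU U₁)) =
        Skeleton.monoidHom (res inf_le_right) (z₂ : Skeleton (KU U₂)) := congrArg Units.val h
      rw [← h₁, ← h₂, monoidHom_toSkeleton, monoidHom_toSkeleton] at e
      obtain ⟨σ⟩ := toSkeleton_eq_toSkeleton_iff.1 e
      obtain ⟨p, f₁, f₂, -⟩ := exists_isGluing hU hU₁ hU₂ σ
      exact ⟨p, ⟨f₁⟩, ⟨f₂⟩⟩
    obtain ⟨a₁, h₁⟩ := Quotient.exists_rep (y₁ : Skeleton (KU U₁))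
    obtain ⟨a₂, h₂⟩ := Quotient.exists_rep (y₂ : Skeleton (KU U₂))
    obtain ⟨b₁, h₁'⟩ := Quotient.exists_rep ((y₁⁻¹ : Pic (KU U₁)) : Skeleton (KU U₁))
    obtain ⟨b₂, h₂'⟩ := Quotient.exists_rep ((y₂⁻¹ : Pic (KU U₂)) : Skeleton (KU U₂))
    obtain ⟨p, ⟨f₁⟩, ⟨f₂⟩⟩ := glue h h₁ h₂
    -- The inverses are glued too; `q` is an inverse of `p` only over U₁ and over U₂, which is
    -- enough for `p` to be invertible.
    obtain ⟨q, ⟨g₁⟩, ⟨g₂⟩⟩ := glue (by rw [map_inv, map_inv, h]) h₁' h₂'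
    have e₁ : toSkeleton (a₁ ⊗ b₁) = toSkeleton (𝟙_ (KU U₁)) := by
      rw [Skeleton.toSkeleton_tensorObj, ← Skeleton.one_eq, ← y₁.mul_inv, ← h₁, ← h₁']
    have e₂ : toSkeleton (a₂ ⊗ b₂) = toSkeleton (𝟙_ (KU U₂)) := by
      rw [Skeleton.toSkeleton_tensorObj, ← Skeleton.one_eq, ← y₂.mul_inv, ← h₂, ← h₂']
    obtain ⟨k₁⟩ := toSkeleton_eq_toSkeleton_iff.1 e₁
    obtain ⟨k₂⟩ := toSkeleton_eq_toSkeleton_iff.1 e₂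
    obtain ⟨w, hw⟩ := isUnit_toSkeleton_of_iso hU hU₁ hU₂
      ((μIso (rho U₁) p q).symm ≪≫ (f₁ ⊗ᵢ g₁) ≪≫ k₁)
      ((μIso (rho U₂) p q).symm ≪≫ (f₂ ⊗ᵢ g₂) ≪≫ k₂)
    refine ⟨w, Prod.ext (Units.ext ?_) (Units.ext ?_)⟩
    · change Skeleton.monoidHom (rho U₁) (w : Skeleton C) = _
      rw [hw, monoidHom_toSkeleton]
      exact (congr_toSkeleton_of_iso f₁).trans h₁
    · change Skeleton.monoidHom (rho U₂) (w : Skeleton C) = _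
      rw [hw, monoidHom_toSkeleton]
      exact (congr_toSkeleton_of_iso f₂).trans h₂
  · rintro ⟨w, hw⟩
    obtain ⟨p, hp⟩ := Quotient.exists_rep (w : Skeleton C)
    have h₁ : Skeleton.monoidHom (rho U₁) (w : Skeleton C) = y₁ := congrArg (fun z => z.1.1) hw
    have h₂ : Skeleton.monoidHom (rho U₂) (w : Skeleton C) = y₂ := congrArg (fun z => z.2.1) hw
    refine Units.ext ?_
    change Skeleton.monoidHom (res inf_le_left) (y₁ : Skeleton (KU U₁)) =
      Skeleton.monoidHom (res inf_le_right) (y₂ : Skeleton (KU U₂))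
    rw [← h₁, ← h₂, ← hp]
    change Skeleton.monoidHom _ (Skeleton.monoidHom _ (toSkeleton p)) =
      Skeleton.monoidHom _ (Skeleton.monoidHom _ (toSkeleton p))
    rw [monoidHom_toSkeleton, monoidHom_toSkeleton, monoidHom_toSkeleton, monoidHom_toSkeleton]
    exact congr_toSkeleton_of_iso ((resComp inf_le_left).app p ≪≫ ((resComp inf_le_right).app p).symm)

end Exactness

end TTGlue

/-- Mayer-Vietoris for Picard groups. -/
theorem mainTheorem3 {C : Type u} [Category.{v} C] [HasZeroObject C] [HasShift C ℤ] [Preadditive C]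
    [∀ n : ℤ, (shiftFunctor C n).Additive] [Pretriangulated C] [IsTriangulated C]
    [MonoidalCategory C] [SymmetricCategory C] [TensorTriangulated C]
    [MonoidalClosed C] [StronglyClosed C] [IsIdempotentComplete C]
    (U₁ U₂ : TopologicalSpace.Opens (Spc C)) (hU : U₁ ⊔ U₂ = ⊤)
    (hU₁ : IsCompact (U₁ : Set (Spc C))) (hU₂ : IsCompact (U₂ : Set (Spc C))) :
    ∃ (conn : ∀ a b : C, Mor (U₁ ⊓ U₂) (a⟦(1 : ℤ)⟧) b →+ (a ⟶ b))
      (onePlus : Multiplicative (Mor (U₁ ⊓ U₂) ((𝟙_ C)⟦(1 : ℤ)⟧) (𝟙_ C)) →* Gm C)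
      (δ : Gm (KU (U₁ ⊓ U₂)) →* Pic C),
      -- the connecting homomorphism is given by the construction with fractions and triangles,
      -- followed by the identification of `Mor(T a, T b)` with `Mor(a, b)`
      (∀ (a b : C) (g : Mor (U₁ ⊓ U₂) (a⟦(1 : ℤ)⟧) b) (d : a ⟶ b),
        conn a b g = d ↔ IsConnecting U₁ U₂ g (d⟦(1 : ℤ)⟧')) ∧
      -- the first multiplicative map is `1 + ∂`
      (∀ g : Mor (U₁ ⊓ U₂) ((𝟙_ C)⟦(1 : ℤ)⟧) (𝟙_ C),
        (onePlus (Multiplicative.ofAdd g) : End (𝟙_ C)) = 𝟙 (𝟙_ C) + conn (𝟙_ C) (𝟙_ C) g) ∧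
      -- `δ` glues two copies of the unit object
      (∀ (σ : Gm (KU (U₁ ⊓ U₂))) (p : C),
        (δ σ : Skeleton C) = toSkeleton p ↔ IsGluing U₁ U₂ (unitGlueIso U₁ U₂ σ) p) ∧
      -- explicit description of `δ` by weak push-outs
      (∀ (σ : Gm (KU (U₁ ⊓ U₂))) (p : C),
        (δ σ : Skeleton C) = toSkeleton p ↔ IsWeakPushoutGluing U₁ U₂ σ p) ∧
      -- exactness of the additive part on the left, for `Tⁿ 𝟙` with `n ≥ 1`
      (∀ n : ℕ, Function.Exact (conn (iterT C (n + 1)) (𝟙_ C))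
        (pairMor U₁ U₂ (iterT C (n + 1)) (𝟙_ C))) ∧
      (∀ n : ℕ, Function.Exact (pairMor U₁ U₂ (iterT C (n + 1)) (𝟙_ C))
        (diffMor U₁ U₂ (iterT C (n + 1)) (𝟙_ C))) ∧
      (∀ n : ℕ, Function.Exact (diffMor U₁ U₂ (iterT C (n + 2)) (𝟙_ C))
        (conn (iterT C (n + 1)) (𝟙_ C))) ∧
      -- exactness of the remaining part
      Function.MulExact (AddMonoidHom.toMultiplicative (diffMor U₁ U₂ (iterT C 1) (𝟙_ C))) onePlus ∧
      Function.MulExact onePlus (pairGm U₁ U₂) ∧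
      Function.MulExact (pairGm U₁ U₂) (diffGm U₁ U₂) ∧
      Function.MulExact (diffGm U₁ U₂) δ ∧
      Function.MulExact δ (pairPic U₁ U₂) ∧
      Function.MulExact (pairPic U₁ U₂) (diffPic U₁ U₂) := by
  choose conn hconn using exists_desuspended_connecting_hom hU hU₁ hU₂
  obtain ⟨onePlus, hone⟩ := exists_one_add_hom hU (hconn (𝟙_ C) (𝟙_ C))
  obtain ⟨δ, hδ⟩ := exists_gluing_hom hU hU₁ hU₂
  exact ⟨conn, onePlus, δ, hconn, hone, hδ,
    fun σ p => (hδ σ p).trans (isWeakPushoutGluing_iff hU hU₁ hU₂).symm,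
    fun n => exact_conn_pairMor (hconn _ _),
    fun n => exact_pairMor_diffMor hU hU₁ hU₂ _ _,
    fun n => exact_diffMor_conn hU hU₁ hU₂ (hconn _ _),
    mulExact_diffMor_one_add hU hU₁ hU₂ (hconn _ _) hone,
    mulExact_one_add_pairGm (hconn _ _) hone,
    mulExact_pairGm_diffGm hU hU₁ hU₂,
    mulExact_diffGm_gluing hδ,
    mulExact_gluing_pairPic hδ,
    mulExact_pairPic_diffPic hU hU₁ hU₂⟩
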